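/- **Corollary (deterministic $(2+\varepsilon)$-approximate minimum edge dominating set).** We work in the $\mathsf{LOCAL}$ model: the network is a finite simple graph $G=(V,E)$ with $n=|V|$ nodes and maximum degree $\Delta$; in each synchronous round every node may send a message of arbitrary size to each of its neighbours and then update its state by a deterministic rule. Every node $v$ has a unique identifier in $\{0,\dots,n^{c}\}$ for a constant $c$. Initially a node knows only its own identifier, its degree (its incident edges are numbered arbitrarily), $\varepsilon$, and a common estimate $L$ of $\log\Delta$ up to a constant factor $\kappa\ge 1$, i.e. $\tfrac1\kappa\log\Delta\le L\le\kappa\log\Delta$. All logarithms are to base $2$, with the convention $\log 0=0$; $\log^* n$ is the least number of times $\log$ has to be applied to $n$ until the value is at most $1$ (and $\log^*0=0$). An *edge dominating set* of $G$ is a set $D\subseteq E$ such that every edge of $G$ shares at least one endpoint with an edge of $D$; it is *minimum* if it has least cardinality, and $r$-*approximate* if $|D|\le r\,|D^*|$ for a minimum edge dominating set $D^*$. For a matching $M$ let $\Gamma^+(M)$ be the set of edges that share an endpoint with an edge of $M$ (including the edges of $M$); $M$ is *$\delta$-maximal* if $|\Gamma^+(M)|\ge(1-\delta)|E|$. For all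 constants $c$ and $\kappa$ there are a constant $C$ (depending only on $c$ and $\kappa$) and a deterministic distributed algorithm with parameter $\varepsilon$ such that, for every $\varepsilon>0$, every $G$, every such assignment of identifiers, every numbering of the incident edges and every such estimate $L$, all nodes halt after at most $$C\cdot\Bigl(\log^2\Delta\cdot\max\bigl\{1,\log\tfrac{\Delta}{\varepsilon}\bigr\}+\log^* n\Bigr)$$ rounds, and then both endpoints of every edge agree on whether it belongs to the output $D$, where $D$ is a $(2+\varepsilon)$-approximate minimum edge dominating set. Moreover $D=M\cup(E\setminus\Gamma^+(M))$ for a matching $M$ of $G$, and $M$ is $\tfrac{\varepsilon}{4\Delta}$-maximal if $0<\varepsilon\le1$ (for graphs with $\Delta\ge 1$; without edges there is nothing to say). -/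

import Mathlib

/-! ### Deterministic algorithms in the LOCAL model -/

/-- A deterministic distributed algorithm in the LOCAL model whose task is to select a set of edges.
All nodes run the same program. A node of degree `d` addresses its incident edges through its ports
`0, …, d - 1`. At the beginning it knows its own identifier, the common numerical parameter `L`
(an estimate of the logarithm of the maximum degree) and its degree, and nothing else.
Message sizes and local computation are unrestricted. -/
structure LocalAlgorithm where
  /-- the local states of a node -/
  State : Type
  /-- the messages -/
  Msg : Type
  /-- the initial state, from the identifier, the parameter `L` and the degree -/
  init : (ident : ℕ) → (L : ℝ) → (d : ℕ) → State
  /-- the message that a node of degree `d` sends through each port -/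
  send : (d : ℕ) → State → Fin d → Msg
  /-- the new state, from the old one and the messages received through the ports -/
  recv : (d : ℕ) → State → (Fin d → Msg) → State
  /-- `none` while the node is running; `some o` when it has halted, where `o p` tells whether
  the edge at port `p` is selected -/
  output : (d : ℕ) → State → Option (Fin d → Bool)

/-- A port numbering: every node numbers its neighbours by `0, …, deg v - 1` in some way. -/
abbrev PortNumbering {V : Type*} [Fintype V] (G : SimpleGraph V) [DecidableRel G.Adj] :=
  (v : V) → Fin (G.degree v) ≃ G.neighborSet v

namespace LocalAlgorithm

variable {V : Type*} [Fintype V] {G : SimpleGraph V} [DecidableRel G.Adj]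

/-- The message that arrives at port `p` of `v` when the nodes are in the states `σ`: the neighbour
`u` behind that port sends it through its own port that leads to `v`. -/
def inbox (A : LocalAlgorithm) (ports : PortNumbering G) (σ : V → A.State) (v : V)
    (p : Fin (G.degree v)) : A.Msg :=
  A.send (G.degree (ports v p : V)) (σ (ports v p))
    ((ports (ports v p : V)).symm ⟨v, SimpleGraph.Adj.symm (G.mem_neighborSet v _ |>.1 (ports v p).2)⟩)

/-- One synchronous communication round. The state of a node that has halted is frozen. -/
def round (A : LocalAlgorithm) (ports : PortNumbering G) (σ : V → A.State) : V → A.State :=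
  fun v => if (A.output (G.degree v) (σ v)).isSome then σ v
    else A.recv (G.degree v) (σ v) (A.inbox ports σ v)

/-- The states of all nodes after `t` rounds. -/
def run (A : LocalAlgorithm) (ports : PortNumbering G) (ident : V → ℕ) (L : ℝ) (t : ℕ) :
    V → A.State :=
  (A.round ports)^[t] (fun v => A.init (ident v) L (G.degree v))

/-- After at most `T` rounds every node has halted, and the nodes have selected exactly the edges in
`D`: each endpoint of each edge knows whether that edge is in `D`. -/
def ComputesIn (A : LocalAlgorithm) (ports : PortNumbering G) (ident : V → ℕ) (L : ℝ) (T : ℕ)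
    (D : Finset (Sym2 V)) : Prop :=
  ∀ v : V, ∃ o : Fin (G.degree v) → Bool,
    A.output (G.degree v) (A.run ports ident L T v) = some o ∧
      ∀ p, o p = true ↔ s(v, (ports v p : V)) ∈ D

end LocalAlgorithm

/-! ### Edge dominating sets and matchings -/

section EdgeSets

variable {V : Type*} [Fintype V] [DecidableEq V]

/-- Two edges share at least one endpoint, `e ∩ e' ≠ ∅`. -/
def EdgesMeet (e e' : Sym2 V) : Prop := ∃ v, v ∈ e ∧ v ∈ e'

/-- An edge dominating set: a set `D` of edges such that every edge shares an endpoint with an edge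
in `D`. -/
def IsEdgeDominatingSet (G : SimpleGraph V) [DecidableRel G.Adj] (D : Finset (Sym2 V)) : Prop :=
  D ⊆ G.edgeFinset ∧ ∀ e ∈ G.edgeFinset, ∃ e' ∈ D, EdgesMeet e e'

/-- An edge dominating set of minimum cardinality. -/
def IsMinimumEdgeDominatingSet (G : SimpleGraph V) [DecidableRel G.Adj]
    (D : Finset (Sym2 V)) : Prop :=
  IsEdgeDominatingSet G D ∧ ∀ D', IsEdgeDominatingSet G D' → D.card ≤ D'.card

/-- An `r`-approximate minimum edge dominating set. -/
def IsApproxMinimumEdgeDominatingSet (G : SimpleGraph V) [DecidableRel G.Adj] (r : ℝ)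
    (D : Finset (Sym2 V)) : Prop :=
  IsEdgeDominatingSet G D ∧
    ∀ D', IsMinimumEdgeDominatingSet G D' → (D.card : ℝ) ≤ r * (D'.card : ℝ)

/-- A matching: a set of pairwise disjoint edges. -/
def IsEdgeMatching (G : SimpleGraph V) [DecidableRel G.Adj] (M : Finset (Sym2 V)) : Prop :=
  M ⊆ G.edgeFinset ∧ ∀ e ∈ M, ∀ e' ∈ M, e ≠ e' → ¬ EdgesMeet e e'

open Classical in
/-- `Γ⁺(M)`: the edges in `M` and the edges that share an endpoint with an edge in `M`. -/
noncomputable def coveredEdges (G : SimpleGraph V) [DecidableRel G.Adj] (M : Finset (Sym2 V)) :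
    Finset (Sym2 V) :=
  G.edgeFinset.filter (fun e => ∃ e' ∈ M, EdgesMeet e e')

/-- A `δ`-maximal matching: a matching `M` with `|Γ⁺(M)| ≥ (1 - δ) |E|`. -/
def IsAlmostMaximalMatching (G : SimpleGraph V) [DecidableRel G.Adj] (δ : ℝ)
    (M : Finset (Sym2 V)) : Prop :=
  IsEdgeMatching G M ∧ (1 - δ) * (G.edgeFinset.card : ℝ) ≤ ((coveredEdges G M).card : ℝ)

end EdgeSets

/-! ### The iterated logarithm -/

/-- `log* n`: the least number of times that the binary logarithm has to be applied to `n` until the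
value is at most `1`. -/
noncomputable def logStar (n : ℕ) : ℕ := sInf {k : ℕ | (Real.logb 2)^[k] (n : ℝ) ≤ 1}

/-! For an edge dominating set `D*`, every matching `M` has at most `2|D*|` edges, because each edge
of `M` meets an endpoint of an edge of `D*` and no two edges of `M` share one. Adding to `M` the
edges it leaves uncovered gives an edge dominating set, so it suffices to leave at most `ε|D*|`
edges uncovered. The work is done on the line graph, where a matching is an independent set and
every neighbourhood is covered by two cliques.

One phase (`phaseSteps_spec`) covers at least 1/128 of the remaining weight `w`. Let `W e` be the
weight of the closed neighbourhood of `e`, and start with a power of two `x e` between `w e / (32 W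
e)` and `w e / (16 W e)`. The utility `∑ W e x e` is then at least 1/32 of the weight. The cost `∑ W
e x e x f` over ordered adjacent pairs is at most 1/8 of the utility, since `x` sums to at most 1/16
over a clique. For `i = ℓ, …, 1` the values `2⁻ⁱ` are doubled or dropped, one colour class at a
time, according to the sign of the derivative of utility minus `r` times cost. Only the quadratic
interaction inside a class is lost. A defective colouring with `O(ℓ)` colours keeps all but a
fraction `1/ℓ` of the conflict weight out of the classes, so each level is paid for by a factor `1 +
1/ℓ` in `r`, at most 3 in total, and 5/8 of the utility survives. Finally the edges of value 1
without neighbours of value 1 are matched.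

The defective colourings come from polynomials over a prime field (`hashStep_spec`,
`sum_monochromatic_iterColour_le`). They need a proper colouring with `2 ^ ℓ` colours, `ℓ = O(log
Δ)`, which `colourReduction_out` obtains in `log* n` steps although `n` is unknown. A phase takes
`O(ℓ²)` rounds.

For `ε ≤ 1`, unit weights and `O(log (Δ/ε))` phases leave at most `ε/(4Δ) |E| ≤ ε/2 |D*|` edges, by
`|E| ≤ 2Δ|D*|`. For `ε > 1` the estimate `L` says little about `log (Δ/ε)`. There each edge uses its
own scale `s`, about `log (8d/ε)` with `d` the larger degree of its endpoints: it gets weight `2⁻ˢ`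
and `384 s` phases, and `card_uncovered_le_of_scale` sums over the scales. Edges then stop at
different times, which the invariant in `matchSeq_spec` handles. -/

/-! ### Protocols on an abstract graph -/

/-- A synchronous protocol on an anonymous graph: in each step every vertex updates its state from
its own state and the multiset of the states of its neighbours, until it has an output. -/
structure Protocol (S O : Type) where
  /-- the new state, from the old one and the states of the neighbours -/
  step : S → Multiset S → S
  /-- the output, once it is determined -/
  out : S → Option O

section Protocols

variable {E : Type*} [Fintype E] {S S₁ S₂ O O₁ O₂ : Type}

open Classical in
/-- The values at the neighbours of `e`. -/
noncomputable def nbrs (H : SimpleGraph E) (y : E → S) (e : E) : Multiset S :=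
  (Finset.univ.filter (H.Adj e)).val.map y

namespace Protocol

/-- One step of a protocol; vertices with an output are frozen. -/
noncomputable def next (P : Protocol S O) (H : SimpleGraph E) (z : E → S) : E → S :=
  fun e => if (P.out (z e)).isSome then z e else P.step (z e) (nbrs H z e)

/-- The states after `t` steps. -/
noncomputable def run (P : Protocol S O) (H : SimpleGraph E) (z : E → S) (t : ℕ) : E → S :=
  (P.next H)^[t] z

theorem run_succ (P : Protocol S O) (H : SimpleGraph E) (z : E → S) (t : ℕ) (e : E) :
    P.run H z (t + 1) e = if (P.out (P.run H z t e)).isSome then P.run H z t e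
      else P.step (P.run H z t e) (nbrs H (P.run H z t) e) := by
  simp only [run, Function.iterate_succ_apply']
  rfl

theorem run_eq_of_isSome (P : Protocol S O) (H : SimpleGraph E) (z : E → S) {t t' : ℕ} {e : E}
    (h : (P.out (P.run H z t e)).isSome) (htt' : t ≤ t') : P.run H z t' e = P.run H z t e := by
  induction t', htt' using Nat.le_induction with
  | base => rfl
  | succ n _ ih => rw [run_succ, ih, if_pos h]

theorem out_run_of_le (P : Protocol S O) (H : SimpleGraph E) (z : E → S) {t t' : ℕ} {e : E} {o : O}
    (h : P.out (P.run H z t e) = some o) (htt' : t ≤ t') : P.out (P.run H z t' e) = some o := by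
  rw [run_eq_of_isSome P H z (by simp [h]) htt', h]

end Protocol

/-! ### Sequential composition of protocols whose vertices finish at different times. -/

open Classical in
/-- The sequence of labellings in which the label of `e` is updated in the first `K` steps, from the
labels of those neighbours that are still updated. -/
noncomputable def labelSeq (H : SimpleGraph E) (step : ℕ → S → Multiset S → S) (K : S → ℕ)
    (y : E → S) : ℕ → E → S
  | 0 => y
  | m + 1 => fun e => if K (y e) ≤ m then labelSeq H step K y m e
      else step m (labelSeq H step K y m e)
        ((Finset.univ.filter fun f => H.Adj e f ∧ m < K (y f)).val.map (labelSeq H step K y m))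

open Classical in
theorem labelSeq_succ (H : SimpleGraph E) (step : ℕ → S → Multiset S → S) (K : S → ℕ)
    (y : E → S) (m : ℕ) (e : E) :
    labelSeq H step K y (m + 1) e = if K (y e) ≤ m then labelSeq H step K y m e
      else step m (labelSeq H step K y m e)
        ((Finset.univ.filter fun f => H.Adj e f ∧ m < K (y f)).val.map
          (labelSeq H step K y m)) := rfl

open Classical in
/-- Sequential composition of a protocol with a label sequence. Vertices may get their output of the
first protocol at different times; they store the history of their labels, and a vertex waits
until its neighbours have reached the same step. -/
noncomputable def Protocol.comp (P : Protocol S₁ O₁) (init : O₁ → S₂)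
    (step : ℕ → S₂ → Multiset S₂ → S₂) (K : S₂ → ℕ) (fin : S₂ → O₂) :
    Protocol (S₁ × Option (ℕ × (ℕ → S₂))) O₂ where
  step z N :=
    (if (P.out z.1).isSome then z.1 else P.step z.1 (N.map Prod.fst),
      match z.2 with
      | none => (P.out z.1).map fun o => (0, fun _ => init o)
      | some h =>
        if ∀ z' ∈ N, ∃ h', z'.2 = some h' ∧ (K (h'.2 0) ≤ h.1 ∨ h.1 ≤ h'.1) then
          some (h.1 + 1, Function.update h.2 (h.1 + 1) (step h.1 (h.2 h.1)
            (N.filterMap fun z' => z'.2.bind fun h' =>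
              if K (h'.2 0) ≤ h.1 then none else some (h'.2 h.1))))
        else some h)
  out z := z.2.bind fun h => if K (h.2 0) ≤ h.1 then some (fin (h.2 h.1)) else none

namespace Protocol

variable (P : Protocol S₁ O₁) (init : O₁ → S₂) (step : ℕ → S₂ → Multiset S₂ → S₂) (K : S₂ → ℕ)
  (fin : S₂ → O₂) (H : SimpleGraph E)

theorem comp_out (z : S₁ × Option (ℕ × (ℕ → S₂))) : (P.comp init step K fin).out z =
    z.2.bind fun h => if K (h.2 0) ≤ h.1 then some (fin (h.2 h.1)) else none := rfl

/-- A vertex performs step `h.1` only when every neighbour still taking part has reached it. The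
stored history of such a neighbour contains the label needed, even if the neighbour is further
ahead, so the histories agree with the synchronous sequence. -/
theorem comp_run_invariant {z : E → S₁} {R : ℕ} {o : E → O₁}
    (hR : ∀ e, P.out (P.run H z R e) = some (o e)) (t : ℕ) (e : E) :
    ((P.comp init step K fin).run H (fun e => (z e, none)) t e).1 = P.run H z t e ∧
    ∀ h, ((P.comp init step K fin).run H (fun e => (z e, none)) t e).2 = some h →
      (P.out (P.run H z t e)).isSome ∧ h.1 ≤ K (init (o e)) ∧
      ∀ j ≤ h.1, h.2 j = labelSeq H step K (fun e => init (o e)) j e := by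
  classical
  induction t generalizing e with
  | zero => simp [run]
  | succ t ih =>
    have huniq : ∀ e o', P.out (P.run H z t e) = some o' → o' = o e := by
      intro e o' h
      have h1 := P.out_run_of_le H z h (le_max_left t R)
      have h2 := P.out_run_of_le H z (hR e) (le_max_right t R)
      exact Option.some_injective _ (h1.symm.trans h2)
    rw [run_succ, run_succ]
    set Z := (P.comp init step K fin).run H (fun e => (z e, none)) t with hZ
    obtain ⟨ih1, ih2⟩ := ih e
    by_cases hout : ((P.comp init step K fin).out (Z e)).isSome
    · rw [if_pos hout]
      cases hh : (Z e).2 with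
      | none => simp [comp, hh] at hout
      | some h =>
        obtain ⟨h1, h2⟩ := ih2 h hh
        rw [if_pos h1]
        refine ⟨ih1, ?_⟩
        intro h' hh'
        rw [← Option.some_injective _ hh']
        exact ⟨h1, h2⟩
    · rw [if_neg hout]
      have hfst : (nbrs H Z e).map Prod.fst = nbrs H (P.run H z t) e := by
        simp only [nbrs, Multiset.map_map]
        exact Multiset.map_congr rfl fun f _ => (ih f).1
      constructor
      · simp only [comp, ih1, hfst]
      intro h' hh'
      cases hh : (Z e).2 with
      | none =>
        simp only [comp, hh, ih1, Option.map_eq_some_iff] at hh'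
        obtain ⟨o', ho', rfl⟩ := hh'
        refine ⟨?_, by simp, ?_⟩
        · simp [ho']
        · intro j hj
          have : j = 0 := by simpa using hj
          subst this
          simp [labelSeq, huniq e o' ho']
      | some h =>
        obtain ⟨h1, h2, h3⟩ := ih2 h hh
        have hlt : h.1 < K (init (o e)) := by
          have h30 := h3 0 (Nat.zero_le _)
          simp only [labelSeq] at h30
          by_contra hle
          apply hout
          simp [comp, hh, h30, not_lt.1 hle]
        simp only [comp, hh] at hh'
        rw [if_pos h1]
        refine ⟨h1, ?_⟩
        split_ifs at hh' with hall
        swap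
        · rw [← Option.some_injective _ hh']
          exact ⟨h2, h3⟩
        rw [← Option.some_injective _ hh']
        refine ⟨hlt, ?_⟩
        intro j hj
        dsimp only at hj ⊢
        rcases Nat.lt_or_ge h.1 j with hj' | hj'
        swap
        · rw [Function.update_of_ne (by omega)]
          exact h3 j hj'
        have : j = h.1 + 1 := le_antisymm hj hj'
        subst this
        rw [Function.update_self, labelSeq_succ, if_neg (by omega), h3 _ le_rfl]
        congr 1
        have key : ∀ f, H.Adj e f → ∃ h', (Z f).2 = some h' ∧
            h'.2 0 = init (o f) ∧ (h.1 < K (init (o f)) →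
              h'.2 h.1 = labelSeq H step K (fun e => init (o e)) h.1 f) := by
          intro f hf
          obtain ⟨h', hh', hcase⟩ := hall (Z f)
            (Multiset.mem_map_of_mem Z (by simpa using hf))
          obtain ⟨-, h5, h6⟩ := (ih f).2 h' hh'
          have h60 := h6 0 (Nat.zero_le _)
          simp only [labelSeq] at h60
          refine ⟨h', hh', h60, fun hk => h6 _ ?_⟩
          rw [h60] at hcase
          omega
        simp only [nbrs, Multiset.filterMap_map]
        have : ∀ s : Multiset E, (∀ f ∈ s, H.Adj e f) →
            s.filterMap ((fun z' : S₁ × Option (ℕ × (ℕ → S₂)) => z'.2.bind fun h' =>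
              if K (h'.2 0) ≤ h.1 then none else some (h'.2 h.1)) ∘ Z) =
            (s.filter fun f => h.1 < K (init (o f))).map
              (labelSeq H step K (fun e => init (o e)) h.1) := by
          intro s
          induction s using Multiset.induction with
          | empty => simp
          | cons f s ihs =>
            intro hs
            have ihs := ihs fun f hf => hs f (Multiset.mem_cons_of_mem hf)
            obtain ⟨h', e1, e2, e3⟩ := key f (hs f (Multiset.mem_cons_self f s))
            by_cases hk : h.1 < K (init (o f))
            · rw [Multiset.filterMap_cons_some (b := h'.2 h.1), ihs, Multiset.filter_cons_of_pos (p := fun f => h.1 < K (init (o f))) _ hk,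
                Multiset.map_cons, e3 hk]
              simp [e1, e2, hk]
            · rw [Multiset.filterMap_cons_none, ihs, 
                Multiset.filter_cons_of_neg (p := fun f => h.1 < K (init (o f))) _ hk]
              simp [e1, e2, not_lt.1 hk]
        rw [this _ (by simp), ← Finset.filter_val, Finset.filter_filter]

/-- Waiting does not accumulate. All first outputs exist after `R` rounds, one more round starts the
counters, and from then on the vertices that are furthest behind are blocked by nobody. -/
theorem comp_run_progress {z : E → S₁} {R : ℕ} {o : E → O₁}
    (hR : ∀ e, P.out (P.run H z R e) = some (o e)) (j t : ℕ) (ht : R + 1 + j ≤ t) (e : E) :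
    ∃ h, ((P.comp init step K fin).run H (fun e => (z e, none)) t e).2 = some h ∧
      (j ≤ h.1 ∨ K (init (o e)) ≤ h.1) := by
  classical
  induction t generalizing e j with
  | zero => omega
  | succ t ih =>
    have hinv := P.comp_run_invariant init step K fin H hR t
    rw [run_succ]
    set Z := (P.comp init step K fin).run H (fun e => (z e, none)) t with hZ
    have hzero : ∀ e h, (Z e).2 = some h → h.2 0 = init (o e) := fun e h hh => by
      simpa [labelSeq] using ((hinv e).2 h hh).2.2 0 (Nat.zero_le _)
    by_cases hout : ((P.comp init step K fin).out (Z e)).isSome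
    · rw [if_pos hout]
      cases hh : (Z e).2 with
      | none => simp [comp, hh] at hout
      | some h =>
        refine ⟨h, rfl, Or.inr ?_⟩
        by_contra hK
        simp [comp, hh, hzero e h hh, hK] at hout
    · rw [if_neg hout]
      cases hh : (Z e).2 with
      | none =>
        have ho : P.out (P.run H z t e) = some (o e) := P.out_run_of_le H z (hR e) (by omega)
        cases j with
        | zero => simp [comp, hh, (hinv e).1, ho]
        | succ j =>
          obtain ⟨h, hh', -⟩ := ih j (by omega) e
          rw [hh] at hh'
          simp at hh'
      | some h =>
        simp only [comp, hh]
        cases j with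
        | zero =>
          split_ifs
          · exact ⟨_, rfl, Or.inl (Nat.zero_le _)⟩
          · exact ⟨_, rfl, Or.inl (Nat.zero_le _)⟩
        | succ j =>
          obtain ⟨h', hh', hj⟩ := ih j (by omega) e
          rw [hh, Option.some_inj] at hh'
          subst hh'
          by_cases hK : K (init (o e)) ≤ h.1
          · exact absurd (by simp [comp, hh, hzero e h hh, hK]) hout
          · have hj := hj.resolve_right hK
            by_cases hjl : j + 1 ≤ h.1
            · split_ifs
              · exact ⟨_, rfl, Or.inl (by simp; omega)⟩
              · exact ⟨_, rfl, Or.inl hjl⟩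
            have hj' : j = h.1 := by omega
            rw [if_pos]
            · exact ⟨_, rfl, Or.inl (by simp; omega)⟩
            intro z' hz'
            obtain ⟨f, -, rfl⟩ := Multiset.mem_map.1 hz'
            obtain ⟨h', hh', hf⟩ := ih j (by omega) f
            refine ⟨h', hh', ?_⟩
            rw [hzero f h' hh']
            omega

theorem out_comp_run {z : E → S₁} {R B : ℕ} {o : E → O₁}
    (hR : ∀ e, P.out (P.run H z R e) = some (o e)) (hB : ∀ e, K (init (o e)) ≤ B) (e : E) :
    (P.comp init step K fin).out
        ((P.comp init step K fin).run H (fun e => (z e, none)) (R + 1 + B) e) =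
      some (fin (labelSeq H step K (fun e => init (o e)) (K (init (o e))) e)) := by
  obtain ⟨h, hh, hj⟩ := P.comp_run_progress init step K fin H hR B (R + 1 + B) le_rfl e
  obtain ⟨-, h2, h3⟩ := (P.comp_run_invariant init step K fin H hR (R + 1 + B) e).2 h hh
  have hB := hB e
  have h0 := h3 0 (Nat.zero_le _)
  have h1 : h.1 = K (init (o e)) := by omega
  simp only [labelSeq] at h0
  have h4 := h3 _ le_rfl
  rw [comp_out, hh, Option.bind_some, h0, if_pos h1.ge, h4, h1]

end Protocol

end Protocols

/-! ### Simulation on the line graph -/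

/-- A protocol on the line graph as an algorithm in the LOCAL model. In the first round the endpoints
of each edge exchange their identifiers and degrees, which determine the initial state of the edge;
after that each node keeps the states of its incident edges. If the parameter is not positive, or
there are no incident edges, the node halts immediately and selects everything. -/
noncomputable def Protocol.toLocal {S : Type} (P : ℝ → Protocol S Bool)
    (ini : ℝ → ℕ × ℕ → ℕ × ℕ → S) : LocalAlgorithm where
  State := ℕ × ℝ × Option (ℕ → S)
  Msg := (ℕ × ℕ) × Multiset S
  init i L _ := (i, L, none)
  send d σ p := ((σ.1, d), match σ.2.2 with
    | none => 0
    | some v => (Finset.univ.erase p).val.map fun q : Fin d => v q)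
  recv d σ msg := (σ.1, σ.2.1, some fun k =>
    if h : k < d then match σ.2.2 with
      | none => ini σ.2.1 (σ.1, d) (msg ⟨k, h⟩).1
      | some v => if ((P σ.2.1).out (v k)).isSome then v k else
          (P σ.2.1).step (v k) ((Finset.univ.erase ⟨k, h⟩).val.map (fun q : Fin d => v q) +
            (msg ⟨k, h⟩).2)
    else ini σ.2.1 (0, 0) (0, 0))
  output d σ :=
    if d = 0 ∨ σ.2.1 ≤ 0 then some fun _ => true else
      match σ.2.2 with
      | none => none
      | some v => if ∀ p : Fin d, ((P σ.2.1).out (v p)).isSome then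
          some fun p => ((P σ.2.1).out (v p)).getD false else none

theorem Protocol.toLocal_send {S : Type} (P : ℝ → Protocol S Bool) (ini : ℝ → ℕ × ℕ → ℕ × ℕ → S)
    (d i : ℕ) (L : ℝ) (x : ℕ → S) (p : Fin d) :
    ((toLocal P ini).send d (i, L, some x) p).2 = 
      (Finset.univ.erase p).val.map fun q : Fin d => x q := rfl

section Simulation

variable {V : Type*} [Fintype V] {G : SimpleGraph V} [DecidableRel G.Adj]

/-- The edge at a port. -/
def portEdge (ports : PortNumbering G) (v : V) (p : Fin (G.degree v)) : G.edgeSet :=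
  ⟨s(v, (ports v p : V)), (G.mem_neighborSet v _).1 (ports v p).2⟩

/-- The port at the other end of the edge at port `p` of `v`. -/
def backPort (ports : PortNumbering G) (v : V) (p : Fin (G.degree v)) :
    Fin (G.degree (ports v p : V)) :=
  (ports (ports v p : V)).symm ⟨v, SimpleGraph.Adj.symm (G.mem_neighborSet v _ |>.1 (ports v p).2)⟩

theorem portEdge_backPort (ports : PortNumbering G) (v : V) (p : Fin (G.degree v)) :
    portEdge ports (ports v p : V) (backPort ports v p) = portEdge ports v p := by
  simp [portEdge, backPort, Sym2.eq_swap]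

theorem portEdge_injective (ports : PortNumbering G) (v : V) :
    Function.Injective (portEdge ports v) := by
  intro p q h
  exact (ports v).injective (Subtype.ext (Sym2.congr_right.1 (congrArg Subtype.val h)))

theorem exists_portEdge_eq (ports : PortNumbering G) {v : V} {e : G.edgeSet} (h : v ∈ (e : Sym2 V)) :
    ∃ p, portEdge ports v p = e := by
  obtain ⟨e, he⟩ := e
  obtain ⟨u, rfl⟩ := h
  refine ⟨(ports v).symm ⟨u, he⟩, ?_⟩
  simp [portEdge]

/-- A nonpositive estimate forces `Δ ≤ 1`; then all edges together form a matching and no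
communication is needed. -/
theorem Protocol.toLocal_computesIn_of_nonpos {S : Type} (P : ℝ → Protocol S Bool)
    (ini : ℝ → ℕ × ℕ → ℕ × ℕ → S)
    (ports : PortNumbering G) (ident : V → ℕ) {L : ℝ} (hL : L ≤ 0) (D : Finset (Sym2 V))
    (hD : ∀ e : G.edgeSet, (e : Sym2 V) ∈ D) :
    (toLocal P ini).ComputesIn ports ident L 0 D := fun v =>
  ⟨fun _ => true, by simp [toLocal, LocalAlgorithm.run, hL],
    fun p => iff_of_true rfl (hD (portEdge ports v p))⟩

variable [Fintype G.edgeSet]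

/-- Two distinct edges of a simple graph share at most one endpoint, so the neighbours of an edge
split without repetition into the other edges at its two ends. One part is known to the node, the
other arrives in a single message. -/
theorem nbrs_lineGraph_portEdge {S : Type} (ports : PortNumbering G) (z : G.edgeSet → S) (v : V)
    (p : Fin (G.degree v)) :
    nbrs G.lineGraph z (portEdge ports v p) =
      (Finset.univ.erase p).val.map (fun q => z (portEdge ports v q)) +
      (Finset.univ.erase (backPort ports v p)).val.map
        (fun q => z (portEdge ports (ports v p : V) q)) := by
  classical
  have himg : ∀ (w : V) (r : Fin (G.degree w)),
      (Finset.univ.erase r).val.map (fun q => z (portEdge ports w q)) =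
        (((Finset.univ.erase r).map ⟨portEdge ports w, portEdge_injective ports w⟩).val.map z) := by
    intro w r
    rw [Finset.map_val, Multiset.map_map]
    rfl
  rw [himg, himg, ← Multiset.map_add, nbrs]
  congr 1
  have hne : v ≠ (ports v p : V) := G.ne_of_adj ((G.mem_neighborSet v _).1 (ports v p).2)
  have hdis : Disjoint ((Finset.univ.erase p).map ⟨portEdge ports v, portEdge_injective ports v⟩)
      ((Finset.univ.erase (backPort ports v p)).map
        ⟨portEdge ports (ports v p : V), portEdge_injective ports (ports v p : V)⟩) := by
    rw [Finset.disjoint_left]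
    intro e he he'
    simp only [Finset.mem_map, Finset.mem_erase, Finset.mem_univ, and_true,
      Function.Embedding.coeFn_mk] at he he'
    obtain ⟨q, hq, rfl⟩ := he
    obtain ⟨r, hr, hr'⟩ := he'
    apply hq
    apply portEdge_injective ports v
    apply Subtype.ext
    have h1 : v ∈ (portEdge ports v q : Sym2 V) := by simp [portEdge]
    have h2 : (ports v p : V) ∈ (portEdge ports v q : Sym2 V) := by rw [← hr']; simp [portEdge]
    exact (Sym2.mem_and_mem_iff hne).1 ⟨h1, h2⟩
  rw [← Finset.disjUnion_val _ _ hdis]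
  congr 1
  ext e
  simp only [Finset.mem_filter, Finset.mem_univ, true_and, Finset.disjUnion_eq_union,
    Finset.mem_union, Finset.mem_map, Finset.mem_erase, and_true, Function.Embedding.coeFn_mk,
    SimpleGraph.lineGraph_adj_iff_exists]
  constructor
  · rintro ⟨hne', w, hw, hw'⟩
    have hw2 : w = v ∨ w = (ports v p : V) := by simpa [portEdge] using hw
    rcases hw2 with rfl | rfl
    · obtain ⟨q, rfl⟩ := exists_portEdge_eq ports hw'
      exact Or.inl ⟨q, fun h => hne' (by rw [h]), rfl⟩
    · obtain ⟨q, rfl⟩ := exists_portEdge_eq ports hw'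
      refine Or.inr ⟨q, fun h => hne' ?_, rfl⟩
      rw [h, portEdge_backPort]
  · rintro (⟨q, hq, rfl⟩ | ⟨q, hq, rfl⟩)
    · exact ⟨fun h => hq (portEdge_injective ports v h).symm, v, by simp [portEdge],
        by simp [portEdge]⟩
    · refine ⟨fun h => hq ?_, (ports v p : V), by simp [portEdge], by simp [portEdge]⟩
      rw [← portEdge_backPort] at h
      exact (portEdge_injective ports _ h).symm

/-- Both endpoints simulate an edge on the same data. A node halts only when all its edges have
outputs, and such edges are frozen in the protocol too, so the memory of a halted node stays
correct. The extra round is the exchange of identifiers and degrees. -/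
theorem Protocol.toLocal_run {S : Type} (P : ℝ → Protocol S Bool) (ini : ℝ → ℕ × ℕ → ℕ × ℕ → S)
    (ports : PortNumbering G) (ident : V → ℕ) {L : ℝ} (hL : 0 < L) (z : G.edgeSet → S)
    (hz : ∀ v p, z (portEdge ports v p) =
      ini L (ident v, G.degree v) (ident (ports v p), G.degree (ports v p : V))) (t : ℕ) (v : V)
    (hv : G.degree v ≠ 0) :
    ∃ x : ℕ → S, (toLocal P ini).run ports ident L (t + 1) v = (ident v, L, some x) ∧
      ∀ p : Fin (G.degree v), x p = (P L).run G.lineGraph z t (portEdge ports v p) := by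
  have hdeg : ∀ (v : V) (p : Fin (G.degree v)), G.degree (ports v p : V) ≠ 0 := by
    intro v p h
    have := (G.mem_neighborSet v _).1 (ports v p).2
    rw [← Nat.pos_iff_ne_zero.not_left, not_lt] at h
    exact absurd ((G.degree_pos_iff_exists_adj _).2 ⟨v, this.symm⟩) (by omega)
  induction t generalizing v with
  | zero =>
    simp only [LocalAlgorithm.run, zero_add, Function.iterate_one, LocalAlgorithm.round]
    rw [if_neg (by simp [toLocal, hv, hL])]
    refine ⟨_, rfl, fun p => ?_⟩
    simp only [toLocal, LocalAlgorithm.inbox, Fin.is_lt, dite_true, Fin.eta]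
    rw [Protocol.run, Function.iterate_zero, id, hz]
  | succ t ih =>
    have hrun : (toLocal P ini).run ports ident L (t + 1 + 1) v =
        (toLocal P ini).round ports ((toLocal P ini).run ports ident L (t + 1)) v := by
      simp only [LocalAlgorithm.run, Function.iterate_succ_apply']
    obtain ⟨x, hx, hx'⟩ := ih v hv
    rw [hrun, LocalAlgorithm.round, hx]
    by_cases hout : ((toLocal P ini).output (G.degree v) (ident v, L, some x)).isSome
    · refine ⟨x, if_pos hout, fun p => ?_⟩
      rw [hx' p, Protocol.run_succ, if_pos]
      by_contra hcon
      have : ¬ ∀ p : Fin (G.degree v), ((P L).out (x p)).isSome := fun h => hcon (hx' p ▸ h p)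
      simp only [toLocal, hv, hL.not_ge, this] at hout
      simp at hout
    · refine ⟨_, (if_neg hout).trans rfl, fun p => ?_⟩
      simp only [Fin.is_lt, dite_true, Fin.eta]
      rw [Protocol.run_succ, hx' p]
      split_ifs with h
      · rfl
      congr 1
      rw [nbrs_lineGraph_portEdge]
      congr 1
      · exact Multiset.map_congr rfl fun q _ => hx' q
      · obtain ⟨x', hx1, hx2⟩ := ih (ports v p : V) (hdeg v p)
        simp only [LocalAlgorithm.inbox]
        erw [hx1]
        refine (toLocal_send P ini _ _ _ _ _).trans ?_
        exact Multiset.map_congr rfl fun q _ => hx2 q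

theorem Protocol.toLocal_computesIn {S : Type} (P : ℝ → Protocol S Bool)
    (ini : ℝ → ℕ × ℕ → ℕ × ℕ → S)
    (ports : PortNumbering G) (ident : V → ℕ) {L : ℝ} (hL : 0 < L) (z : G.edgeSet → S)
    (hz : ∀ v p, z (portEdge ports v p) =
      ini L (ident v, G.degree v) (ident (ports v p), G.degree (ports v p : V))) (T : ℕ)
    (D : Finset (Sym2 V)) (b : G.edgeSet → Bool)
    (hb : ∀ e, (P L).out ((P L).run G.lineGraph z T e) = some (b e))
    (hD : ∀ e : G.edgeSet, b e = true ↔ (e : Sym2 V) ∈ D) :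
    (toLocal P ini).ComputesIn ports ident L (T + 1) D := by
  intro v
  by_cases hv : G.degree v = 0
  · refine ⟨fun _ => true, by simp [toLocal, hv], fun p => ?_⟩
    exact absurd p.2 (by omega)
  · obtain ⟨x, hx, hx'⟩ := toLocal_run P ini ports ident hL z hz T v hv
    refine ⟨fun p => b (portEdge ports v p), ?_, fun p => hD (portEdge ports v p)⟩
    rw [hx]
    simp [toLocal, hv, hL, hx', hb]

end Simulation

/-! ### Polynomial hashing of colours -/

/-- A prime in `(m, 2 m]` (for `m ≠ 0`). -/
noncomputable def primeAbove (m : ℕ) : ℕ :=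
  if h : m ≠ 0 then (Nat.exists_prime_lt_and_le_two_mul m h).choose else 2

theorem prime_primeAbove (m : ℕ) : (primeAbove m).Prime := by
  unfold primeAbove
  split_ifs with h
  · exact (Nat.exists_prime_lt_and_le_two_mul m h).choose_spec.1
  · exact Nat.prime_two

theorem lt_primeAbove (m : ℕ) : m < primeAbove m := by
  unfold primeAbove
  split_ifs with h
  · exact (Nat.exists_prime_lt_and_le_two_mul m h).choose_spec.2.1
  · omega

theorem primeAbove_le {m : ℕ} (h : m ≠ 0) : primeAbove m ≤ 2 * m := by
  rw [primeAbove, dif_pos h]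
  exact (Nat.exists_prime_lt_and_le_two_mul m h).choose_spec.2.2

/-- The value at `t` modulo `q` of the monic polynomial of degree `d` whose lower coefficients are the
digits of `c` in base `b`. -/
def polyVal (b d q c t : ℕ) : ℕ :=
  (t ^ d + ∑ i ∈ Finset.range d, (c / b ^ i % b) * t ^ i) % q

theorem polyVal_lt {b d q c t : ℕ} (hq : q.Prime) : polyVal b d q c t < q :=
  Nat.mod_lt _ hq.pos

theorem eq_of_digits_eq {b d c c' : ℕ} (hc : c < b ^ d) (hc' : c' < b ^ d)
    (h : ∀ i < d, c / b ^ i % b = c' / b ^ i % b) : c = c' := by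
  induction d generalizing c c' with
  | zero => simp at hc hc'; omega
  | succ d ih =>
    have h0 := h 0 (Nat.succ_pos d)
    simp only [pow_zero, Nat.div_one] at h0
    have hd : c / b = c' / b := by
      apply ih
      · rw [Nat.div_lt_iff_lt_mul (Nat.pos_of_ne_zero (by rintro rfl; simp at hc))]
        rwa [pow_succ] at hc
      · rw [Nat.div_lt_iff_lt_mul (Nat.pos_of_ne_zero (by rintro rfl; simp at hc))]
        rwa [pow_succ] at hc'
      · intro i hi
        have := h (i + 1) (by omega)
        rwa [pow_succ', ← Nat.div_div_eq_div_mul, ← Nat.div_div_eq_div_mul] at this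
    rw [← Nat.div_add_mod c b, ← Nat.div_add_mod c' b, hd, h0]

open Polynomial in
theorem card_filter_eval_eq_zero_le {q d : ℕ} (hq : q.Prime) {p : (ZMod q)[X]} (hp : p ≠ 0)
    (hd : p.natDegree ≤ d) (Q : ℕ → Prop) [DecidablePred Q]
    (hQ : ∀ t, Q t → p.eval (t : ZMod q) = 0) :
    ((Finset.range q).filter Q).card ≤ d := by
  have := Fact.mk hq
  classical
  calc ((Finset.range q).filter Q).card
      = (((Finset.range q).filter Q).image (fun t : ℕ => (t : ZMod q))).card := by
        rw [Finset.card_image_of_injOn]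
        intro s hs t ht hst
        simp only [Finset.coe_filter, Finset.mem_range, Set.mem_ofPred_eq] at hs ht
        have := (ZMod.natCast_eq_natCast_iff' _ _ _).1 hst
        rwa [Nat.mod_eq_of_lt hs.1, Nat.mod_eq_of_lt ht.1] at this
    _ ≤ p.roots.toFinset.card := by
        apply Finset.card_le_card
        intro x hx
        simp only [Finset.mem_image, Finset.mem_filter] at hx
        obtain ⟨t, ⟨-, ht⟩, rfl⟩ := hx
        simpa [hp] using hQ t ht
    _ ≤ Multiset.card p.roots := Multiset.toFinset_card_le _
    _ ≤ d := (Polynomial.card_roots' p).trans hd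

-- The leading terms cancel, and since `b ≤ q` different digits stay different modulo `q`. Hence the
-- difference of the two polynomials is nonzero, of degree at most `d`.
open Polynomial in
theorem card_polyVal_eq_polyVal_le {b d q c c' : ℕ} (hq : q.Prime) (hb : b ≤ q) (hc : c < b ^ d)
    (hc' : c' < b ^ d) (hne : c ≠ c') :
    ((Finset.range q).filter fun t => polyVal b d q c t = polyVal b d q c' t).card ≤ d := by
  have := Fact.mk hq
  have hcoeff : ∀ j < d, (∑ i ∈ Finset.range d,
      C (((c / b ^ i % b : ℕ) : ZMod q) - ((c' / b ^ i % b : ℕ) : ZMod q)) * X ^ i).coeff j =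
      ((c / b ^ j % b : ℕ) : ZMod q) - ((c' / b ^ j % b : ℕ) : ZMod q) := by
    intro j hj
    rw [finsetSum_coeff, Finset.sum_eq_single j]
    · rw [coeff_C_mul_X_pow, if_pos rfl]
    · intro i _ hij
      rw [coeff_C_mul_X_pow, if_neg hij.symm]
    · intro h
      exact absurd (Finset.mem_range.2 hj) h
  apply card_filter_eval_eq_zero_le hq (p := ∑ i ∈ Finset.range d,
    C (((c / b ^ i % b : ℕ) : ZMod q) - ((c' / b ^ i % b : ℕ) : ZMod q)) * X ^ i)
  · intro h0
    apply hne
    have hbpos : 0 < b ∨ d = 0 := by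
      rcases Nat.eq_zero_or_pos b with rfl | h
      · right
        by_contra hd
        rw [zero_pow hd] at hc
        omega
      · exact Or.inl h
    apply eq_of_digits_eq hc hc'
    intro j hj
    have h1 := hcoeff j hj
    rw [h0, coeff_zero, eq_comm, sub_eq_zero, ZMod.natCast_eq_natCast_iff'] at h1
    have hb0 : 0 < b := hbpos.resolve_right (by omega)
    rwa [Nat.mod_eq_of_lt ((Nat.mod_lt _ hb0).trans_le hb),
      Nat.mod_eq_of_lt ((Nat.mod_lt _ hb0).trans_le hb)] at h1
  · apply natDegree_sum_le_of_forall_le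
    intro i hi
    exact (natDegree_C_mul_X_pow_le _ _).trans (Finset.mem_range.1 hi).le
  · intro t ht
    have h1 := (ZMod.natCast_eq_natCast_iff' _ _ _).2 ht
    push_cast at h1
    have h2 := add_left_cancel h1
    simp only [eval_finsetSum, eval_mul, eval_C, eval_pow, eval_X, sub_mul, Finset.sum_sub_distrib]
    rw [sub_eq_zero]
    exact h2

-- This is the purpose of the leading term `t ^ d`: after subtracting a constant the polynomial is
-- still monic of positive degree, hence nonzero, even if all digits of `c` vanish.
open Polynomial in
theorem card_polyVal_eq_le {b d q c v : ℕ} (hq : q.Prime) (hd : d ≠ 0) :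
    ((Finset.range q).filter fun t => polyVal b d q c t = v).card ≤ d := by
  have := Fact.mk hq
  have hlow : (∑ i ∈ Finset.range d, C ((c / b ^ i % b : ℕ) : ZMod q) * X ^ i -
      C (v : ZMod q)).degree < d := by
    refine (degree_sub_le _ _).trans_lt (max_lt ?_ ?_)
    · refine mem_degreeLT.1 (Submodule.sum_mem _ fun i hi => mem_degreeLT.2 ?_)
      exact (degree_C_mul_X_pow_le _ _).trans_lt (by exact_mod_cast Finset.mem_range.1 hi)
    · exact degree_C_le.trans_lt (by exact_mod_cast Nat.pos_of_ne_zero hd)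
  have hmonic := monic_X_pow_add (n := d) hlow
  apply card_filter_eval_eq_zero_le hq hmonic.ne_zero
  · refine natDegree_le_of_degree_le ((degree_add_le _ _).trans (max_le ?_ hlow.le))
    exact degree_X_pow_le d
  · intro t ht
    have h1 : ((t ^ d + ∑ i ∈ Finset.range d, (c / b ^ i % b) * t ^ i : ℕ) : ZMod q) = (v : ℕ) := by
      rw [ZMod.natCast_eq_natCast_iff', ← ht]
      exact (Nat.mod_mod _ _).symm
    push_cast at h1
    simp only [eval_add, eval_sub, eval_pow, eval_X, eval_finsetSum, eval_mul, eval_C]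
    linear_combination h1

/-! ### The iterated logarithm -/

/-- The tower function, `tower 0 = 1` and `tower (i + 1) = 2 ^ tower i`. -/
def tower : ℕ → ℕ
  | 0 => 1
  | i + 1 => 2 ^ tower i

theorem lt_tower (n : ℕ) : n < tower n := by
  induction n with
  | zero => simp [tower]
  | succ n ih =>
    have := Nat.lt_two_pow_self (n := tower n)
    simp only [tower]
    omega

theorem le_tower_of_logb_iterate_le {k : ℕ} {x : ℝ} (h : (Real.logb 2)^[k] x ≤ 1) :
    x ≤ tower k := by
  induction k generalizing x with
  | zero => simpa [tower] using h
  | succ k ih =>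
    rw [Function.iterate_succ_apply] at h
    have h1 := ih h
    rcases le_or_gt x 0 with hx | hx
    · exact hx.trans (Nat.cast_nonneg _)
    · rw [Real.logb_le_iff_le_rpow (by norm_num) hx, Real.rpow_natCast] at h1
      simpa [tower] using h1

theorem exists_logb_iterate_le {k : ℕ} {x : ℝ} (h : x ≤ tower k) :
    ∃ j, (Real.logb 2)^[j] x ≤ 1 := by
  induction k generalizing x with
  | zero => exact ⟨0, by simpa [tower] using h⟩
  | succ k ih =>
    rcases le_or_gt x 1 with hx | hx
    · exact ⟨0, by simpa using hx⟩
    · have : Real.logb 2 x ≤ tower k := by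
        rw [Real.logb_le_iff_le_rpow (by norm_num) (by linarith), Real.rpow_natCast]
        simpa [tower] using h
      obtain ⟨j, hj⟩ := ih this
      exact ⟨j + 1, by rwa [Function.iterate_succ_apply]⟩

theorem le_tower_logStar (n : ℕ) : n ≤ tower (logStar n) := by
  -- The infimum of the empty set would be `0`, so nonemptiness is needed before `logStar n` can be
  -- used as a witness.
  have hne : {k : ℕ | (Real.logb 2)^[k] (n : ℝ) ≤ 1}.Nonempty :=
    exists_logb_iterate_le (k := n) (by exact_mod_cast (lt_tower n).le)
  exact_mod_cast le_tower_of_logb_iterate_le (Nat.sInf_mem hne)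

/-! ### Colour reduction without knowledge of the number of vertices -/

/-- The number of bits of a colour at level `i`. -/
def levelBits (ℓ : ℕ) : ℕ → ℕ
  | 0 => ℓ
  | i + 1 => 2 ^ (levelBits ℓ i / 4)

theorem le_two_pow_div_four {m : ℕ} (h : 20 ≤ m) : m < 2 ^ (m / 4) := by
  have key : ∀ s, 5 ≤ s → 4 * s + 4 ≤ 2 ^ s := by
    intro s hs
    induction s, hs using Nat.le_induction with
    | base => norm_num
    | succ s hs ih => rw [pow_succ]; omega
  have := key (m / 4) (by omega)
  omega

theorem levelBits_lt_succ {ℓ : ℕ} (hℓ : 20 ≤ ℓ) (i : ℕ) :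
    20 ≤ levelBits ℓ i ∧ levelBits ℓ i < levelBits ℓ (i + 1) := by
  induction i with
  | zero => exact ⟨hℓ, le_two_pow_div_four hℓ⟩
  | succ i ih => exact ⟨by omega, le_two_pow_div_four (by omega)⟩

theorem le_levelBits {ℓ : ℕ} (hℓ : 20 ≤ ℓ) (i : ℕ) : ℓ ≤ levelBits ℓ i := by
  induction i with
  | zero => rfl
  | succ i ih => exact ih.trans (levelBits_lt_succ hℓ i).2.le

theorem index_le_levelBits {ℓ : ℕ} (hℓ : 20 ≤ ℓ) (i : ℕ) : i ≤ levelBits ℓ i := by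
  induction i with
  | zero => exact Nat.zero_le _
  | succ i ih => have := (levelBits_lt_succ hℓ i).2; omega

/-- Shows that the levels grow like a tower. The factor `k` is for identifiers up to `n ^ k`; the
factor 4 and the summand 16 make up for the quarter in the recursion of `levelBits`, leaving an
exponent of at least `k * tower i + 4`. -/
theorem mul_tower_le_levelBits {ℓ k : ℕ} (hk : 1 ≤ k) (hℓ : 4 * k + 16 ≤ ℓ) (i : ℕ) :
    4 * (k * tower i) + 16 ≤ levelBits ℓ i := by
  induction i with
  | zero => simpa [tower, levelBits] using hℓ
  | succ i ih =>
    have h1 : 2 ^ (k * tower i + 4) ≤ levelBits ℓ (i + 1) :=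
      Nat.pow_le_pow_right (by norm_num) (by omega)
    refine le_trans ?_ h1
    rw [pow_add, mul_comm k (tower i), pow_mul]
    change 4 * (k * tower (i + 1)) + 16 ≤ tower (i + 1) ^ k * 2 ^ 4
    have hT : 2 ≤ tower (i + 1) := by have := lt_tower (i + 1); omega
    have h2 : k * tower (i + 1) ≤ tower (i + 1) ^ k := by
      obtain ⟨k, rfl⟩ : ∃ k', k = k' + 1 := ⟨k - 1, by omega⟩
      rw [pow_succ]
      exact Nat.mul_le_mul_right _ (le_trans Nat.lt_two_pow_self (Nat.pow_le_pow_left hT k))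
    nlinarith

open Classical in
/-- The least level at which the number `a` is a colour. -/
noncomputable def levelOf (ℓ a : ℕ) : ℕ := sInf {i | a < 2 ^ levelBits ℓ i}

theorem lt_two_pow_levelBits_levelOf {ℓ : ℕ} (hℓ : 20 ≤ ℓ) (a : ℕ) :
    a < 2 ^ levelBits ℓ (levelOf ℓ a) :=
  Nat.sInf_mem (s := {i | a < 2 ^ levelBits ℓ i}) ⟨a, lt_of_lt_of_le Nat.lt_two_pow_self
    (Nat.pow_le_pow_right (by norm_num) (index_le_levelBits hℓ a))⟩

theorem levelOf_le_logStar {ℓ k n a : ℕ} (hk : 1 ≤ k) (hℓ : 4 * k + 16 ≤ ℓ) (ha : a ≤ n ^ k) :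
    levelOf ℓ a ≤ logStar n := by
  apply Nat.sInf_le
  rw [Set.mem_ofPred_eq]
  calc a ≤ n ^ k := ha
    _ ≤ (2 ^ tower (logStar n)) ^ k :=
      Nat.pow_le_pow_left ((le_tower_logStar n).trans Nat.lt_two_pow_self.le) k
    _ = 2 ^ (k * tower (logStar n)) := by rw [← pow_mul, mul_comm]
    _ < 2 ^ levelBits ℓ (logStar n) := by
      apply Nat.pow_lt_pow_right (by norm_num)
      have := mul_tower_le_levelBits hk hℓ (logStar n)
      omega

/-- The points at which a vertex of level `lev` and colour `col` has no conflict with its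
neighbours, whose levels and colours are given. -/
def IsGoodPoint (q d lev col : ℕ) (N : Multiset (ℕ × ℕ)) (a : ℕ) : Prop :=
  a < q ∧ ∀ z ∈ N, (z.1 = lev → z.2 ≠ col → polyVal 2 d q z.2 a ≠ polyVal 2 d q col a) ∧
    (z.1 = 0 → a * q + polyVal 2 d q col a ≠ z.2)

open Classical in
/-- The new colour of a vertex, with `q` a prime above `D * d`. -/
noncomputable def recolour (D d lev col : ℕ) (N : Multiset (ℕ × ℕ)) : ℕ :=
  if h : ∃ a, IsGoodPoint (primeAbove (D * d)) d lev col N a then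
    h.choose * primeAbove (D * d) + polyVal 2 d (primeAbove (D * d)) col h.choose
  else 0

/-- Each neighbour excludes at most `d` points. On the same level two different polynomials agree at
no more than `d` points; a colour of level 0 excludes only its quotient by `q`. As `D * d < q`, a
point remains. -/
theorem exists_isGoodPoint {ι : Type*} (F : Finset ι) (z : ι → ℕ × ℕ) {D d lev col q : ℕ}
    (hF : F.card ≤ D) (hd : d ≠ 0) (hq : q.Prime) (hDq : D * d < q) (hlev : lev ≠ 0)
    (hcol : col < 2 ^ d) (hz : ∀ f ∈ F, (z f).1 = lev → (z f).2 < 2 ^ d) :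
    ∃ a, IsGoodPoint q d lev col (F.val.map z) a := by
  classical
  let bad : ι → Finset ℕ := fun f => (Finset.range q).filter fun a =>
    ((z f).1 = lev ∧ (z f).2 ≠ col ∧ polyVal 2 d q (z f).2 a = polyVal 2 d q col a) ∨
    ((z f).1 = 0 ∧ a * q + polyVal 2 d q col a = (z f).2)
  have hbad : ∀ f ∈ F, (bad f).card ≤ d := by
    intro f hf
    by_cases h0 : (z f).1 = lev
    · by_cases hc : (z f).2 = col
      · have : bad f = ∅ := by
          apply Finset.filter_false_of_mem
          intro a _
          simp [hc, h0, hlev]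
        simp [this]
      · refine le_trans (Finset.card_le_card ?_)
          (card_polyVal_eq_polyVal_le hq hq.two_le (hz f hf h0) hcol hc)
        intro a ha
        simp only [bad, Finset.mem_filter] at ha ⊢
        refine ⟨ha.1, ?_⟩
        rcases ha.2 with h | h
        · exact h.2.2
        · exact absurd (h0.symm.trans h.1) hlev
    · refine le_trans (Finset.card_le_one.2 ?_) (Nat.one_le_iff_ne_zero.2 hd)
      have : ∀ a ∈ bad f, a = (z f).2 / q := by
        intro a ha
        simp only [bad, Finset.mem_filter, h0, false_and, false_or] at ha
        rw [← ha.2.2, mul_comm, Nat.mul_add_div hq.pos, Nat.div_eq_of_lt (polyVal_lt hq), add_zero]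
      intro a ha b hb
      rw [this a ha, this b hb]
  have hcard : (F.biUnion bad).card < (Finset.range q).card := by
    rw [Finset.card_range]
    exact (Finset.card_biUnion_le_card_mul _ _ _ hbad).trans_lt
      ((Nat.mul_le_mul_right d hF).trans_lt hDq)
  obtain ⟨a, ha, hab⟩ := Finset.exists_mem_notMem_of_card_lt_card hcard
  refine ⟨a, Finset.mem_range.1 ha, ?_⟩
  intro w hw
  obtain ⟨f, hf, rfl⟩ := Multiset.mem_map.1 hw
  have hnot : a ∉ bad f := fun h => hab (Finset.mem_biUnion.2 ⟨f, hf, h⟩)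
  simp only [bad, Finset.mem_filter, ha, true_and, not_or, not_and] at hnot
  exact ⟨fun h1 h2 => hnot.1 h1 h2, fun h1 => hnot.2 h1⟩

theorem recolour_spec {D d lev col : ℕ} {N : Multiset (ℕ × ℕ)}
    (h : ∃ a, IsGoodPoint (primeAbove (D * d)) d lev col N a) :
    ∃ a, IsGoodPoint (primeAbove (D * d)) d lev col N a ∧
      recolour D d lev col N =
        a * primeAbove (D * d) + polyVal 2 d (primeAbove (D * d)) col a :=
  ⟨h.choose, h.choose_spec, by rw [recolour, dif_pos h]⟩

/-- Colour reduction: in each step a vertex of positive level moves to the next lower level and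
chooses a colour of that level. -/
noncomputable def colourReduction (X : Type) (ℓ D : ℕ) : Protocol (X × ℕ × ℕ) (X × ℕ) where
  step z N := (z.1, z.2.1 - 1, recolour D (levelBits ℓ z.2.1) z.2.1 z.2.2 (N.map Prod.snd))
  out z := if z.2.1 = 0 then some (z.1, z.2.2) else none

theorem colourReduction_out_eq {X : Type} {ℓ D : ℕ} (z : X × ℕ × ℕ) :
    (colourReduction X ℓ D).out z = if z.2.1 = 0 then some (z.1, z.2.2) else none := rfl

section ColourReduction

variable {E : Type*} [Fintype E] {X : Type}

/-- This is where the quarter in `levelBits` is used. If level `j` has `B` bits, then `q ≤ 2 * D * 2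
^ (B / 4)` is at most the square of `2 ^ (B / 4)`, so pairs of residues modulo `q` fit into `B`
bits. -/
theorem colourReduction_step_lt {ℓ D j a q : ℕ} (hℓ : 20 ≤ ℓ) (hD : 2 * D ≤ 2 ^ (ℓ / 4))
    (hD0 : D ≠ 0) (hq : q = primeAbove (D * levelBits ℓ (j + 1))) (ha : a < q) {v : ℕ} (hv : v < q) :
    a * q + v < 2 ^ levelBits ℓ j := by
  have h1 : q ≤ 2 ^ (levelBits ℓ j / 4) * 2 ^ (levelBits ℓ j / 4) := by
    have h2 : q ≤ 2 * (D * levelBits ℓ (j + 1)) := by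
      rw [hq]
      exact primeAbove_le (mul_ne_zero hD0 (by simp [levelBits]))
    refine h2.trans ?_
    rw [← mul_assoc]
    refine Nat.mul_le_mul (hD.trans (Nat.pow_le_pow_right (by norm_num) ?_)) le_rfl
    exact Nat.div_le_div_right (le_levelBits hℓ j)
  calc a * q + v < a * q + q := by omega
    _ = (a + 1) * q := by ring
    _ ≤ q * q := Nat.mul_le_mul_right _ ha
    _ ≤ _ := Nat.mul_le_mul h1 h1
    _ = 2 ^ (4 * (levelBits ℓ j / 4)) := by rw [← pow_add, ← pow_add]; congr 1; ring
    _ ≤ 2 ^ levelBits ℓ j := Nat.pow_le_pow_right (by norm_num) (by omega)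

-- The moving vertices descend together, so vertices that meet on a positive level have always
-- shared their level. Only at level 0 does an arriving vertex meet frozen ones, and a good point
-- avoids their colours.
open Classical in
theorem colourReduction_invariant (H : SimpleGraph E) {ℓ D : ℕ} (hℓ : 20 ≤ ℓ)
    (hD : 2 * D ≤ 2 ^ (ℓ / 4)) (hD0 : D ≠ 0)
    (hdeg : ∀ e, (Finset.univ.filter (H.Adj e)).card ≤ D) (x : E → X) (a : E → ℕ)
    (ha : ∀ e f, H.Adj e f → a e ≠ a f) (t : ℕ) :
    (∀ e, ((colourReduction X ℓ D).run H (fun e => (x e, levelOf ℓ (a e), a e)) t e).1 = x e ∧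
      ((colourReduction X ℓ D).run H (fun e => (x e, levelOf ℓ (a e), a e)) t e).2.1 =
        levelOf ℓ (a e) - t ∧
      ((colourReduction X ℓ D).run H (fun e => (x e, levelOf ℓ (a e), a e)) t e).2.2 <
        2 ^ levelBits ℓ (levelOf ℓ (a e) - t)) ∧
    ∀ e f, H.Adj e f → levelOf ℓ (a e) - t = levelOf ℓ (a f) - t →
      ((colourReduction X ℓ D).run H (fun e => (x e, levelOf ℓ (a e), a e)) t e).2.2 ≠
      ((colourReduction X ℓ D).run H (fun e => (x e, levelOf ℓ (a e), a e)) t f).2.2 := by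
  induction t with
  | zero =>
    simp only [Protocol.run, Function.iterate_zero, id, Nat.sub_zero, true_and]
    exact ⟨fun e => lt_two_pow_levelBits_levelOf hℓ _, fun e f hef _ => ha e f hef⟩
  | succ t ih =>
    set Z := (colourReduction X ℓ D).run H (fun e => (x e, levelOf ℓ (a e), a e)) t with hZ
    have hfix : ∀ e, levelOf ℓ (a e) - t = 0 →
        (colourReduction X ℓ D).run H (fun e => (x e, levelOf ℓ (a e), a e)) (t + 1) e = Z e := by
      intro e he
      rw [Protocol.run_succ, if_pos]
      rw [colourReduction_out_eq, ← hZ, (ih.1 e).2.1]; simp [he]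
    have hmove : ∀ e, levelOf ℓ (a e) - t ≠ 0 → ∃ b q,
        q = primeAbove (D * levelBits ℓ (levelOf ℓ (a e) - t)) ∧
        IsGoodPoint q (levelBits ℓ (levelOf ℓ (a e) - t)) (levelOf ℓ (a e) - t) (Z e).2.2
          ((Finset.univ.filter (H.Adj e)).val.map fun f => (Z f).2) b ∧
        (colourReduction X ℓ D).run H (fun e => (x e, levelOf ℓ (a e), a e)) (t + 1) e =
          (x e, levelOf ℓ (a e) - t - 1,
            b * q + polyVal 2 (levelBits ℓ (levelOf ℓ (a e) - t)) q (Z e).2.2 b) := by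
      intro e he
      have hex : ∃ b, IsGoodPoint (primeAbove (D * levelBits ℓ (levelOf ℓ (a e) - t)))
          (levelBits ℓ (levelOf ℓ (a e) - t)) (levelOf ℓ (a e) - t) (Z e).2.2
          ((Finset.univ.filter (H.Adj e)).val.map fun f => (Z f).2) b := by
        apply exists_isGoodPoint _ _ (hdeg e) _ (prime_primeAbove _) (lt_primeAbove _) he
          (ih.1 e).2.2
        · intro f _ hf
          rw [← hf, (ih.1 f).2.1]
          exact (ih.1 f).2.2
        · have := (levelBits_lt_succ hℓ (levelOf ℓ (a e) - t)).1
          omega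
      obtain ⟨b, hb, hb'⟩ := recolour_spec hex
      refine ⟨b, _, rfl, hb, ?_⟩
      rw [Protocol.run_succ, if_neg (by rw [colourReduction_out_eq, ← hZ, (ih.1 e).2.1]; simp [he]), ← hZ]
      simp only [colourReduction, nbrs, Multiset.map_map, Function.comp_def, (ih.1 e).1,
        (ih.1 e).2.1]
      rw [hb']
    refine ⟨fun e => ?_, fun e f hef hlev => ?_⟩
    · by_cases he : levelOf ℓ (a e) - t = 0
      · rw [hfix e he]
        have : levelOf ℓ (a e) - (t + 1) = levelOf ℓ (a e) - t := by omega
        rw [this]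
        exact ih.1 e
      · obtain ⟨b, q, hq, hb, heq⟩ := hmove e he
        rw [heq]
        refine ⟨rfl, by simp only; omega, ?_⟩
        obtain ⟨j, hj⟩ : ∃ j, levelOf ℓ (a e) - t = j + 1 := ⟨levelOf ℓ (a e) - t - 1, by omega⟩
        have hj' : levelOf ℓ (a e) - (t + 1) = j := by omega
        rw [hj] at hq
        rw [hj']
        exact colourReduction_step_lt hℓ hD hD0 hq hb.1 (polyVal_lt (hq ▸ prime_primeAbove _))
    · by_cases he : levelOf ℓ (a e) - t = 0 <;> by_cases hf : levelOf ℓ (a f) - t = 0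
      · rw [hfix e he, hfix f hf]
        exact ih.2 e f hef (by omega)
      · obtain ⟨b, q, hq, hb, heq⟩ := hmove f hf
        rw [hfix e he, heq]
        exact ((hb.2 _ (Multiset.mem_map_of_mem (fun f => (Z f).2) (a := e)
          (by simpa using hef.symm))).2 (by rw [(ih.1 e).2.1, he])).symm
      · obtain ⟨b, q, hq, hb, heq⟩ := hmove e he
        rw [hfix f hf, heq]
        exact (hb.2 _ (Multiset.mem_map_of_mem (fun f => (Z f).2) (a := f)
          (by simpa using hef))).2 (by rw [(ih.1 f).2.1, hf])
      · obtain ⟨b, q, hq, hb, heq⟩ := hmove e he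
        obtain ⟨b', q', hq', hb', heq'⟩ := hmove f hf
        have hl : levelOf ℓ (a f) - t = levelOf ℓ (a e) - t := by omega
        rw [hl, ← hq] at hq'
        subst hq'
        rw [heq, heq', hl]
        intro hcon
        have hqp : q'.Prime := hq ▸ prime_primeAbove _
        simp only at hcon
        -- The quotient by `q'` recovers the point and the remainder the value, so equal new colours
        -- would mean agreement at a common point.
        have hbb : b = b' := by
          have := congrArg (· / q') hcon
          simpa [mul_comm _ q', Nat.mul_add_div hqp.pos, Nat.div_eq_of_lt (polyVal_lt hqp)] using this
        subst hbb
        refine (hb.2 _ (Multiset.mem_map_of_mem (fun f => (Z f).2) (a := f)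
          (by simpa using hef))).1 (by rw [(ih.1 f).2.1, hl]) (ih.2 e f hef hl.symm).symm ?_
        exact (Nat.add_left_cancel hcon).symm

open Classical in
theorem colourReduction_out (H : SimpleGraph E) {ℓ D : ℕ} (hℓ : 20 ≤ ℓ)
    (hD : 2 * D ≤ 2 ^ (ℓ / 4)) (hD0 : D ≠ 0)
    (hdeg : ∀ e, (Finset.univ.filter (H.Adj e)).card ≤ D) (x : E → X) (a : E → ℕ)
    (ha : ∀ e f, H.Adj e f → a e ≠ a f) {R : ℕ} (hR : ∀ e, levelOf ℓ (a e) ≤ R) :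
    ∃ col : E → ℕ, (∀ e, (colourReduction X ℓ D).out
        ((colourReduction X ℓ D).run H (fun e => (x e, levelOf ℓ (a e), a e)) R e) =
          some (x e, col e)) ∧ (∀ e, col e < 2 ^ ℓ) ∧ ∀ e f, H.Adj e f → col e ≠ col f := by
  obtain ⟨h1, h2⟩ := colourReduction_invariant H hℓ hD hD0 hdeg x a ha R
  have h0 : ∀ e, levelOf ℓ (a e) - R = 0 := fun e => Nat.sub_eq_zero_of_le (hR e)
  refine ⟨fun e => ((colourReduction X ℓ D).run H (fun e => (x e, levelOf ℓ (a e), a e)) R e).2.2,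
    fun e => ?_, fun e => ?_, fun e f hef => ?_⟩
  · rw [colourReduction_out_eq, if_pos ((h1 e).2.1.trans (h0 e)), (h1 e).1]
  · have := (h1 e).2.2
    rwa [h0 e] at this
  · exact h2 e f hef (by rw [h0, h0])

end ColourReduction

/-! ### Defective colourings -/

section Defective

variable {E : Type*} [Fintype E]

/-- Summed over all `t < q`, each `f` is counted at most `k` times, so some `t` is no worse than the
average. -/
theorem exists_average_conflict_le {q k : ℕ} (hq : 0 < q) (s : E → ℝ) (hs : ∀ f, 0 ≤ s f)
    (Q : ℕ → E → Prop) [∀ t f, Decidable (Q t f)]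
    (hQ : ∀ f, s f ≠ 0 → ((Finset.range q).filter fun t => Q t f).card ≤ k) :
    ∃ t < q, ∑ f, (if Q t f then s f else 0) ≤ (k / q : ℝ) * ∑ f, s f := by
  have hsum : ∑ t ∈ Finset.range q, ∑ f, (if Q t f then s f else 0) ≤
      ∑ _t ∈ Finset.range q, (k / q : ℝ) * ∑ f, s f := by
    rw [Finset.sum_comm, Finset.sum_const, Finset.card_range, nsmul_eq_mul, ← mul_assoc,
      mul_div_cancel₀ _ (by positivity), Finset.mul_sum]
    refine Finset.sum_le_sum fun f _ => ?_
    rw [← Finset.sum_filter, Finset.sum_const, nsmul_eq_mul]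
    by_cases hf : s f = 0
    · simp [hf]
    · exact mul_le_mul_of_nonneg_right (by exact_mod_cast hQ f hf) (hs f)
  obtain ⟨t, ht, h⟩ := Finset.exists_le_of_sum_le (Finset.nonempty_range_iff.2 hq.ne') hsum
  exact ⟨t, Finset.mem_range.1 ht, h⟩

/-- `e` is in conflict with `f` if it takes the colour `p e t` at time `t`, where `b` are the colours
taken before. Vertices with the same initial colour `c` do not count. -/
def Conflict (c : E → ℕ) (p : E → ℕ → ℕ) (b : E → Option ℕ) (t : ℕ) (e f : E) : Prop :=
  c f ≠ c e ∧ ((b f = none ∧ p f t = p e t) ∨ b f = some (p e t))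

open Classical in
/-- The locally iterative colouring: at time `t` an uncoloured vertex takes the colour `p e t` if the
weight of its conflicts is at most `θ` times its total weight. -/
noncomputable def iterColour (c : E → ℕ) (p : E → ℕ → ℕ) (s : E → E → ℝ) (θ : ℝ) :
    ℕ → E → Option ℕ
  | 0 => fun _ => none
  | t + 1 => fun e =>
    if iterColour c p s θ t e = none ∧
        ∑ f, (if Conflict c p (iterColour c p s θ t) t e f then s e f else 0) ≤ θ * ∑ f, s e f
      then some (p e t) else iterColour c p s θ t e

variable {c : E → ℕ} {p : E → ℕ → ℕ} {s : E → E → ℝ} {θ : ℝ}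

open Classical in
theorem iterColour_succ (t : ℕ) (e : E) : iterColour c p s θ (t + 1) e =
    if iterColour c p s θ t e = none ∧
        ∑ f, (if Conflict c p (iterColour c p s θ t) t e f then s e f else 0) ≤ θ * ∑ f, s e f
      then some (p e t) else iterColour c p s θ t e := rfl

theorem iterColour_mono {t t' : ℕ} {e : E} {v : ℕ} (h : iterColour c p s θ t e = some v)
    (htt' : t ≤ t') : iterColour c p s θ t' e = some v := by
  induction t', htt' using Nat.le_induction with
  | base => exact h
  | succ n _ ih => rw [iterColour_succ, if_neg (by simp [ih]), ih]

theorem iterColour_eq_none_of_le {t t' : ℕ} {e : E} (h : iterColour c p s θ t' e = none)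
    (htt' : t ≤ t') : iterColour c p s θ t e = none := by
  cases hb : iterColour c p s θ t e with
  | none => rfl
  | some v => rw [iterColour_mono hb htt'] at h; simp at h

open Classical in
theorem exists_iterColour_time {t : ℕ} {e : E} {v : ℕ} (h : iterColour c p s θ t e = some v) :
    ∃ τ < t, iterColour c p s θ τ e = none ∧ v = p e τ ∧
      ∑ f, (if Conflict c p (iterColour c p s θ τ) τ e f then s e f else 0) ≤ θ * ∑ f, s e f := by
  induction t with
  | zero => simp [iterColour] at h
  | succ t ih =>
    rw [iterColour_succ] at h
    split_ifs at h with hc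
    · exact ⟨t, t.lt_succ_self, hc.1, (Option.some_injective _ h).symm, hc.2⟩
    · obtain ⟨τ, hτ, h'⟩ := ih h
      exact ⟨τ, by omega, h'⟩

-- While `f` is uncoloured it conflicts with `e` at most `d` times, since the two polynomials
-- differ. Once `f` has a colour, `p e` hits that colour at most `d` times. By averaging, some time
-- has conflict weight at most `2d/q` of the total, and a vertex still uncoloured then takes its
-- colour.
open Classical in
theorem iterColour_ne_none {q d : ℕ} (hq : 0 < q) (hs : ∀ e f, 0 ≤ s e f)
    (hp : ∀ e f, c f ≠ c e → ((Finset.range q).filter fun t => p f t = p e t).card ≤ d)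
    (hv : ∀ e v, ((Finset.range q).filter fun t => p e t = v).card ≤ d)
    (hθ : θ = (d + d : ℕ) / q) (e : E) : iterColour c p s θ q e ≠ none := by
  intro hnone
  obtain ⟨t, ht, hle⟩ := exists_average_conflict_le (k := d + d) hq (s e) (hs e)
    (fun t f => Conflict c p (iterColour c p s θ t) t e f) (by
      intro f _
      have hsub : (Finset.range q).filter
            (fun t => Conflict c p (iterColour c p s θ t) t e f) ⊆
          (Finset.range q).filter (fun t => c f ≠ c e ∧ p f t = p e t) ∪
          (Finset.range q).filter (fun t => iterColour c p s θ t f = some (p e t)) := by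
        intro t ht
        obtain ⟨h1, h2, h3⟩ := Finset.mem_filter.1 ht
        rw [Finset.mem_union, Finset.mem_filter, Finset.mem_filter]
        exact h3.imp (fun h => ⟨h1, h2, h.2⟩) fun h => ⟨h1, h⟩
      refine (Finset.card_le_card hsub).trans ((Finset.card_union_le _ _).trans (add_le_add ?_ ?_))
      · by_cases hcf : c f = c e
        · simp [hcf]
        · simpa [hcf] using hp e f hcf
      · cases hb : iterColour c p s θ q f with
        | none =>
          rw [Finset.filter_false_of_mem]
          · simp
          · intro t ht
            rw [iterColour_eq_none_of_le hb (Finset.mem_range.1 ht).le]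
            simp
        | some v =>
          refine le_trans (Finset.card_le_card ?_) (hv e v)
          intro t ht
          simp only [Finset.mem_filter, Finset.mem_range] at ht ⊢
          refine ⟨ht.1, ?_⟩
          have := iterColour_mono ht.2 ht.1.le
          rw [hb] at this
          exact (Option.some_injective _ this).symm)
  have h1 : iterColour c p s θ (t + 1) e = some (p e t) := by
    rw [iterColour_succ, if_pos ⟨iterColour_eq_none_of_le hnone ht.le, hle.trans_eq (by rw [hθ])⟩]
  rw [iterColour_mono h1 ht] at hnone
  simp at hnone

-- Of two vertices with the same final colour, the one coloured later counted the conflict when it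
-- took the colour; in a tie both did. Charging each pair to that vertex gives `θ` times the total
-- weight for each of the two orders.
open Classical in
theorem sum_monochromatic_iterColour_le {q d : ℕ} (hq : 0 < q) (hs : ∀ e f, 0 ≤ s e f)
    (hsymm : ∀ e f, s e f = s f e)
    (hp : ∀ e f, c f ≠ c e → ((Finset.range q).filter fun t => p f t = p e t).card ≤ d)
    (hv : ∀ e v, ((Finset.range q).filter fun t => p e t = v).card ≤ d)
    (hθ : θ = (d + d : ℕ) / q) :
    ∑ e, ∑ f, (if c f ≠ c e ∧ iterColour c p s θ q e = iterColour c p s θ q f then s e f else 0) ≤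
      2 * θ * ∑ e, ∑ f, s e f := by
  have hsome : ∀ e, ∃ v, iterColour c p s θ q e = some v := fun e =>
    Option.ne_none_iff_exists'.1 (iterColour_ne_none hq hs hp hv hθ e)
  choose v hvv using hsome
  choose τ hτq hτn hτv hτ using fun e => exists_iterColour_time (hvv e)
  have hτafter : ∀ e t, τ e < t → iterColour c p s θ t e = some (v e) := by
    intro e t ht
    refine iterColour_mono (t := τ e + 1) ?_ ht
    rw [iterColour_succ, if_pos ⟨hτn e, hτ e⟩, hτv e]
  have hpair : ∀ e f, (if c f ≠ c e ∧ iterColour c p s θ q e = iterColour c p s θ q f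
        then s e f else 0) ≤
      (if Conflict c p (iterColour c p s θ (τ e)) (τ e) e f then s e f else 0) +
      (if Conflict c p (iterColour c p s θ (τ f)) (τ f) f e then s f e else 0) := by
    intro e f
    have hmain : ∀ e f, c f ≠ c e → v e = v f → τ f ≤ τ e →
        Conflict c p (iterColour c p s θ (τ e)) (τ e) e f := by
      intro e f hcf hvef hle
      refine ⟨hcf, ?_⟩
      rcases hle.lt_or_eq with hlt | heq
      · right
        rw [hτafter f _ hlt, ← hτv e, hvef]
      · left
        rw [← heq]
        exact ⟨hτn f, by rw [← hτv f, heq, ← hτv e, hvef]⟩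
    split_ifs with h1 h2 h3 h3 h4
    · have := hs f e; linarith
    · linarith [hs e f]
    · linarith [hsymm e f]
    · exfalso
      rw [hvv, hvv, Option.some_inj] at h1
      rcases le_total (τ f) (τ e) with h | h
      · exact h2 (hmain e f h1.1 h1.2 h)
      · exact h3 (hmain f e h1.1.symm h1.2.symm h)
    · linarith [hs e f, hs f e]
    · linarith [hs e f]
    · linarith [hs f e]
    · simp
  calc _ ≤ ∑ e, ∑ f, ((if Conflict c p (iterColour c p s θ (τ e)) (τ e) e f then s e f else 0) +
      (if Conflict c p (iterColour c p s θ (τ f)) (τ f) f e then s f e else 0)) :=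
        Finset.sum_le_sum fun e _ => Finset.sum_le_sum fun f _ => hpair e f
    _ = 2 * ∑ e, ∑ f, (if Conflict c p (iterColour c p s θ (τ e)) (τ e) e f then s e f else 0) := by
        simp only [Finset.sum_add_distrib]
        rw [two_mul]
        congr 1
        exact Finset.sum_comm
    _ ≤ 2 * ∑ e, θ * ∑ f, s e f := by
        gcongr with e
        exact hτ e
    _ = _ := by rw [← Finset.mul_sum]; ring

end Defective

/-! ### Rounding of fractional solutions -/

section Rounding

variable {E : Type*} [Fintype E]

open Classical in
/-- The total weight of the conflicts, `∑ W e * x e * x f` over all ordered pairs of adjacent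
elements. -/
noncomputable def conflictCost (H : SimpleGraph E) (W x : E → ℝ) : ℝ :=
  ∑ e, ∑ f, if H.Adj e f then W e * x e * x f else 0

open Classical in
/-- The coefficient of `x e` in `∑ W e * x e - r * conflictCost H W x`. -/
noncomputable def marginal (H : SimpleGraph E) (W : E → ℝ) (r : ℝ) (x : E → ℝ) (e : E) : ℝ :=
  W e - r * ∑ f, if H.Adj e f then (W e + W f) * x f else 0

-- The exact second-order expansion of a quadratic function. `marginal` is its partial derivative;
-- both `W e` and `W f` occur there because the cost runs over ordered pairs.
open Classical in
theorem utility_sub_cost_update (H : SimpleGraph E) (W : E → ℝ) (r : ℝ) (x δ : E → ℝ) :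
    ∑ e, W e * (x e + δ e) - r * conflictCost H W (fun e => x e + δ e) =
      (∑ e, W e * x e - r * conflictCost H W x) + ∑ e, δ e * marginal H W r x e -
        r * conflictCost H W δ := by
  have h1 : conflictCost H W (fun e => x e + δ e) = conflictCost H W x + conflictCost H W δ +
      (∑ e, ∑ f, if H.Adj e f then W e * δ e * x f else 0) +
      ∑ e, ∑ f, if H.Adj e f then W e * x e * δ f else 0 := by
    simp only [conflictCost, ← Finset.sum_add_distrib]
    refine Finset.sum_congr rfl fun e _ => Finset.sum_congr rfl fun f _ => ?_
    split_ifs <;> ring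
  have h2 : (∑ e, ∑ f, if H.Adj e f then W e * x e * δ f else 0) =
      ∑ e, ∑ f, if H.Adj e f then W f * x f * δ e else 0 := by
    rw [Finset.sum_comm]
    simp only [H.adj_comm]
  have h3 : ∑ e, δ e * marginal H W r x e = ∑ e, W e * δ e -
      r * ((∑ e, ∑ f, if H.Adj e f then W e * δ e * x f else 0) +
        ∑ e, ∑ f, if H.Adj e f then W f * x f * δ e else 0) := by
    rw [← Finset.sum_add_distrib, Finset.mul_sum, ← Finset.sum_sub_distrib]
    refine Finset.sum_congr rfl fun e _ => ?_
    rw [marginal, mul_sub, mul_comm (δ e), ← Finset.sum_add_distrib, ← mul_assoc, mul_comm (δ e),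
      mul_assoc, Finset.mul_sum]
    congr 2
    refine Finset.sum_congr rfl fun f _ => ?_
    split_ifs <;> ring
  rw [h1, h2, h3]
  simp only [mul_add, Finset.sum_add_distrib]
  ring

-- Each move goes in the direction of its own derivative, so the linear term only helps. What can be
-- lost is the quadratic term between adjacent elements that move simultaneously.
open Classical in
theorem utility_sub_cost_le_of_move (H : SimpleGraph E) {W : E → ℝ} (hW : ∀ e, 0 ≤ W e) {r a : ℝ}
    (hr : 0 ≤ r) (C : E → Prop) [DecidablePred C] (x y : E → ℝ) (hC : ∀ e, ¬ C e → y e = x e)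
    (ha : ∀ e, C e → |y e - x e| ≤ a) (hg : ∀ e, C e → 0 ≤ (y e - x e) * marginal H W r x e) :
    ∑ e, W e * x e - r * conflictCost H W x -
      r * (∑ e, ∑ f, if H.Adj e f ∧ C e ∧ C f then W e * (a * a) else 0) ≤
      ∑ e, W e * y e - r * conflictCost H W y := by
  have h := utility_sub_cost_update H W r x (fun e => y e - x e)
  simp only [add_sub_cancel] at h
  rw [h]
  have h1 : 0 ≤ ∑ e, (y e - x e) * marginal H W r x e := by
    refine Finset.sum_nonneg fun e _ => ?_
    by_cases he : C e
    · exact hg e he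
    · simp [hC e he]
  have h2 : conflictCost H W (fun e => y e - x e) ≤
      ∑ e, ∑ f, if H.Adj e f ∧ C e ∧ C f then W e * (a * a) else 0 := by
    refine Finset.sum_le_sum fun e _ => Finset.sum_le_sum fun f _ => ?_
    by_cases hef : H.Adj e f
    · by_cases he : C e
      · by_cases hf : C f
        · simp only [hef, he, hf, and_self, if_true]
          rw [mul_assoc]
          refine mul_le_mul_of_nonneg_left ?_ (hW e)
          refine (le_abs_self _).trans ?_
          rw [abs_mul]
          exact mul_le_mul (ha e he) (ha f hf) (abs_nonneg _) ((abs_nonneg _).trans (ha e he))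
        · simp [hC f hf, hf]
      · simp [hC e he, he]
    · simp [hef]
  have h3 := mul_le_mul_of_nonneg_left h2 hr
  linarith

end Rounding

/-! ### Rounding the values `2⁻ⁱ` colour class by colour class. -/

open Classical in
/-- The weight of a conflict between two elements of value `2⁻ⁱ`. -/
noncomputable def levelConflict {E : Type*} (H : SimpleGraph E) (W : E → ℝ) (i : ℕ)
    (x : E → Option ℕ) (e f : E) : ℝ :=
  if H.Adj e f ∧ x e = some i ∧ x f = some i then W e + W f else 0

theorem levelConflict_nonneg {E : Type*} {H : SimpleGraph E} {W : E → ℝ} {i : ℕ}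
    {x : E → Option ℕ} (hW : ∀ e, 0 ≤ W e) (e f : E) : 0 ≤ levelConflict H W i x e f := by
  unfold levelConflict
  split_ifs
  · exact add_nonneg (hW e) (hW f)
  · exact le_rfl

theorem levelConflict_comm {E : Type*} {H : SimpleGraph E} {W : E → ℝ} {i : ℕ}
    {x : E → Option ℕ} (e f : E) : levelConflict H W i x e f = levelConflict H W i x f e := by
  classical
  unfold levelConflict
  exact if_congr ⟨fun h => ⟨h.1.symm, h.2.2, h.2.1⟩, fun h => ⟨h.1.symm, h.2.2, h.2.1⟩⟩
    (add_comm _ _) rfl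

section RoundingLevel

variable {E : Type*} [Fintype E]

/-- The value encoded by an exponent: `some j` stands for `2⁻ʲ` and `none` for `0`. -/
noncomputable def expoVal : Option ℕ → ℝ
  | none => 0
  | some j => (1 / 2) ^ j

theorem expoVal_nonneg (x : Option ℕ) : 0 ≤ expoVal x := by
  cases x with
  | none => exact le_rfl
  | some j => exact pow_nonneg (by norm_num) j

open Classical in
/-- The values while the elements of value `2⁻ⁱ` decide, colour by colour, whether to double their
value or to drop it. -/
noncomputable def decideSeq (H : SimpleGraph E) (W : E → ℝ) (r : ℝ) (i : ℕ) (b : E → Option ℕ)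
    (x : E → Option ℕ) : ℕ → E → Option ℕ
  | 0 => x
  | t + 1 => fun e =>
    if decideSeq H W r i b x t e = some i ∧ b e = some t then
      if 0 ≤ marginal H W r (fun f => expoVal (decideSeq H W r i b x t f)) e then some (i - 1)
      else none
    else decideSeq H W r i b x t e

variable {H : SimpleGraph E} {W : E → ℝ} {r : ℝ} {i : ℕ} {b : E → Option ℕ} {x : E → Option ℕ}

open Classical in
theorem decideSeq_succ (t : ℕ) (e : E) : decideSeq H W r i b x (t + 1) e =
    if decideSeq H W r i b x t e = some i ∧ b e = some t then
      if 0 ≤ marginal H W r (fun f => expoVal (decideSeq H W r i b x t f)) e then some (i - 1)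
      else none
    else decideSeq H W r i b x t e := rfl

theorem eq_some_of_decideSeq (hi : 1 ≤ i) {t : ℕ} {e : E}
    (h : decideSeq H W r i b x t e = some i) {t' : ℕ} (htt' : t' ≤ t) :
    decideSeq H W r i b x t' e = some i := by
  classical
  induction t, htt' using Nat.le_induction with
  | base => exact h
  | succ t _ ih =>
    apply ih
    rw [decideSeq_succ] at h
    split_ifs at h with h1 h2
    · rw [Option.some_inj] at h; omega
    · exact h

theorem decideSeq_le (hx : ∀ e j, x e = some j → j ≤ i) (t : ℕ) (e : E) (j : ℕ)
    (h : decideSeq H W r i b x t e = some j) : j ≤ i := by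
  classical
  induction t generalizing j with
  | zero => exact hx e j h
  | succ t ih =>
    rw [decideSeq_succ] at h
    split_ifs at h with h1 h2
    · rw [Option.some_inj] at h; omega
    · exact ih j h

theorem decideSeq_lt (hi : 1 ≤ i) (hx : ∀ e j, x e = some j → j ≤ i) {q : ℕ}
    (hb : ∀ e, ∃ v < q, b e = some v) (e : E) (j : ℕ)
    (h : decideSeq H W r i b x q e = some j) : j ≤ i - 1 := by
  classical
  have h1 := decideSeq_le hx q e j h
  rcases h1.lt_or_eq with h2 | rfl
  · omega
  obtain ⟨v, hv, hbv⟩ := hb e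
  have h3 := eq_some_of_decideSeq hi h (t' := v + 1) hv
  have h4 := eq_some_of_decideSeq hi h (t' := v) hv.le
  rw [decideSeq_succ, if_pos ⟨h4, hbv⟩] at h3
  split_ifs at h3
  rw [Option.some_inj] at h3
  omega

-- The losses of the successive colour classes add up. They can be measured with the initial values
-- `x`, because no element enters the value `2⁻ⁱ` later.
open Classical in
theorem decideSeq_utility (hW : ∀ e, 0 ≤ W e) (hr : 0 ≤ r) (hi : 1 ≤ i) (T : ℕ) :
    ∑ e, W e * expoVal (x e) - r * conflictCost H W (fun e => expoVal (x e)) -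
      r * ∑ t ∈ Finset.range T, (∑ e, ∑ f, if H.Adj e f ∧ (x e = some i ∧ b e = some t) ∧
        (x f = some i ∧ b f = some t) then W e * ((1 / 2) ^ i * (1 / 2) ^ i) else 0) ≤
      ∑ e, W e * expoVal (decideSeq H W r i b x T e) -
        r * conflictCost H W (fun e => expoVal (decideSeq H W r i b x T e)) := by
  induction T with
  | zero => simp [decideSeq]
  | succ T ih =>
    rw [Finset.sum_range_succ, mul_add]
    have hstep := utility_sub_cost_le_of_move H hW (a := (1 / 2) ^ i) hr
      (fun e => decideSeq H W r i b x T e = some i ∧ b e = some T)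
      (fun e => expoVal (decideSeq H W r i b x T e))
      (fun e => expoVal (decideSeq H W r i b x (T + 1) e))
      (fun e he => by rw [decideSeq_succ, if_neg he]) (by
        intro e he
        rw [decideSeq_succ, if_pos he, he.1]
        obtain ⟨j, rfl⟩ : ∃ j, i = j + 1 := ⟨i - 1, by omega⟩
        have hp : (0 : ℝ) < (1 / 2) ^ j := by positivity
        split_ifs
        · simp only [expoVal, Nat.add_sub_cancel, pow_succ]
          rw [abs_le]; constructor <;> linarith
        · simp only [expoVal, pow_succ]
          rw [abs_le]; constructor <;> linarith) (by
        intro e he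
        rw [decideSeq_succ, if_pos he, he.1]
        obtain ⟨j, rfl⟩ : ∃ j, i = j + 1 := ⟨i - 1, by omega⟩
        have hp : (0 : ℝ) < (1 / 2) ^ j := by positivity
        split_ifs with hg
        · simp only [expoVal, Nat.add_sub_cancel, pow_succ]
          exact mul_nonneg (by linarith) hg
        · simp only [expoVal, pow_succ]
          exact mul_nonneg_of_nonpos_of_nonpos (by linarith) (not_le.1 hg).le)
    have hle : (∑ e, ∑ f, if H.Adj e f ∧ (decideSeq H W r i b x T e = some i ∧ b e = some T) ∧
        (decideSeq H W r i b x T f = some i ∧ b f = some T)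
          then W e * ((1 / 2) ^ i * (1 / 2) ^ i) else 0) ≤
        ∑ e, ∑ f, if H.Adj e f ∧ (x e = some i ∧ b e = some T) ∧
        (x f = some i ∧ b f = some T) then W e * ((1 / 2) ^ i * (1 / 2) ^ i) else 0 := by
      refine Finset.sum_le_sum fun e _ => Finset.sum_le_sum fun f _ => ?_
      have hnn : 0 ≤ W e * ((1 / 2) ^ i * (1 / 2) ^ i) := mul_nonneg (hW e) (by positivity)
      split_ifs with h1 h2
      · rfl
      · exact absurd ⟨h1.1, ⟨eq_some_of_decideSeq hi h1.2.1.1 (Nat.zero_le _), h1.2.1.2⟩,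
          ⟨eq_some_of_decideSeq hi h1.2.2.1 (Nat.zero_le _), h1.2.2.2⟩⟩ h2
      · exact hnn
      · exact le_rfl
    have := mul_le_mul_of_nonneg_left hle hr
    linarith

-- The total loss is `r` times the conflict weight inside the colour classes of level `i`. This is
-- at most a fraction `η` of all conflicts of that level, which in turn are part of the cost of `x`.
open Classical in
theorem utility_rounding_level (hW : ∀ e, 0 ≤ W e) (hr : 0 ≤ r) (hi : 1 ≤ i) {η : ℝ} {q : ℕ}
    (hη : ∑ e, ∑ f, (if b e = b f then levelConflict H W i x e f else 0) ≤
      η * ∑ e, ∑ f, levelConflict H W i x e f) (hη0 : 0 ≤ η) :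
    ∑ e, W e * expoVal (x e) - r * (1 + η) * conflictCost H W (fun e => expoVal (x e)) ≤
      ∑ e, W e * expoVal (decideSeq H W r i b x q e) -
        r * conflictCost H W (fun e => expoVal (decideSeq H W r i b x q e)) := by
  have h := decideSeq_utility (H := H) (W := W) (r := r) (b := b) (x := x) hW hr hi q
  -- The colouring is bounded for the symmetric weights `W e + W f`, while the cost uses `W e` over
  -- ordered pairs; for a symmetric relation the sums differ by the factor 2, which cancels.
  have hsym : ∀ (Q : E → E → Prop) [∀ e f, Decidable (Q e f)], (∀ e f, Q e f → Q f e) →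
      (∑ e, ∑ f, if Q e f then levelConflict H W i x e f else 0) =
      2 * ∑ e, ∑ f, if Q e f ∧ H.Adj e f ∧ x e = some i ∧ x f = some i then W e else 0 := by
    intro Q _ hQ
    have h1 : (∑ e, ∑ f, if Q e f then levelConflict H W i x e f else 0) =
        (∑ e, ∑ f, if Q e f ∧ H.Adj e f ∧ x e = some i ∧ x f = some i then W e else 0) +
        ∑ e, ∑ f, if Q e f ∧ H.Adj e f ∧ x e = some i ∧ x f = some i then W f else 0 := by
      simp only [← Finset.sum_add_distrib, levelConflict, ← ite_and]
      refine Finset.sum_congr rfl fun e _ => Finset.sum_congr rfl fun f _ => ?_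
      split_ifs <;> simp
    rw [h1, two_mul]
    congr 1
    rw [Finset.sum_comm]
    refine Finset.sum_congr rfl fun e _ => Finset.sum_congr rfl fun f _ => ?_
    refine if_congr ?_ rfl rfl
    constructor
    · rintro ⟨h1, h2, h3, h4⟩
      exact ⟨hQ _ _ h1, h2.symm, h4, h3⟩
    · rintro ⟨h1, h2, h3, h4⟩
      exact ⟨hQ _ _ h1, h2.symm, h4, h3⟩
  have e1 := hsym (fun e f => b e = b f) (fun e f h => h.symm)
  have e2 := hsym (fun _ _ => True) (fun _ _ _ => trivial)
  simp only [if_true, true_and] at e2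
  rw [e1, e2] at hη
  set A := (1 / 2 : ℝ) ^ i * (1 / 2) ^ i with hA
  have hA0 : 0 ≤ A := by positivity
  have h2 : ∑ t ∈ Finset.range q, (∑ e, ∑ f, if H.Adj e f ∧ (x e = some i ∧ b e = some t) ∧
        (x f = some i ∧ b f = some t) then W e * A else 0) ≤
      A * ∑ e, ∑ f, if b e = b f ∧ H.Adj e f ∧ x e = some i ∧ x f = some i then W e else 0 := by
    rw [Finset.sum_comm, Finset.mul_sum]
    refine Finset.sum_le_sum fun e _ => ?_
    rw [Finset.sum_comm, Finset.mul_sum]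
    refine Finset.sum_le_sum fun f _ => ?_
    have hnn : 0 ≤ W e * A := mul_nonneg (hW e) hA0
    cases hbe : b e with
    | none =>
      simp only [reduceCtorEq, and_false, false_and, if_false, Finset.sum_const_zero]
      refine mul_nonneg hA0 ?_
      split_ifs
      exacts [hW e, le_rfl]
    | some v =>
      refine (Finset.sum_le_sum (g := fun t => if t = v then (A * if some v = b f ∧ H.Adj e f ∧
        x e = some i ∧ x f = some i then W e else 0) else 0) ?_).trans ?_
      · intro t _
        by_cases ht : t = v
        · subst ht
          rw [if_pos rfl]
          by_cases hc : H.Adj e f ∧ (x e = some i ∧ some t = some t) ∧ x f = some i ∧ b f = some t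
          · rw [if_pos hc, if_pos ⟨hc.2.2.2.symm, hc.1, hc.2.1.1, hc.2.2.1⟩, mul_comm]
          · rw [if_neg hc]
            refine mul_nonneg hA0 ?_
            split_ifs
            exacts [hW e, le_rfl]
        · rw [if_neg ht, if_neg]
          rintro ⟨-, ⟨-, h⟩, -⟩
          exact ht (Option.some_injective _ h).symm
      · rw [Finset.sum_ite_eq']
        split_ifs <;> first | exact le_rfl | (simp only [mul_zero]; exact le_rfl) |
          exact mul_nonneg hA0 (hW e)
  have h3 : A * ∑ e, ∑ f, (if H.Adj e f ∧ x e = some i ∧ x f = some i then W e else 0) ≤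
      conflictCost H W (fun e => expoVal (x e)) := by
    rw [conflictCost, Finset.mul_sum]
    refine Finset.sum_le_sum fun e _ => ?_
    rw [Finset.mul_sum]
    refine Finset.sum_le_sum fun f _ => ?_
    split_ifs with h1 h2 h2
    · rw [h1.2.1, h1.2.2, hA]
      simp only [expoVal]
      exact le_of_eq (by ring)
    · exact absurd h1.1 h2
    · rw [mul_zero]
      exact mul_nonneg (mul_nonneg (hW e) (expoVal_nonneg _)) (expoVal_nonneg _)
    · simp
  have h4 : ∑ t ∈ Finset.range q, (∑ e, ∑ f, if H.Adj e f ∧ (x e = some i ∧ b e = some t) ∧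
        (x f = some i ∧ b f = some t) then W e * A else 0) ≤
      η * conflictCost H W (fun e => expoVal (x e)) := by
    refine h2.trans ?_
    refine le_trans ?_ (mul_le_mul_of_nonneg_left h3 hη0)
    have := mul_le_mul_of_nonneg_left hη hA0
    linarith
  have h5 := mul_le_mul_of_nonneg_left h4 hr
  calc _ = ∑ e, W e * expoVal (x e) - r * conflictCost H W (fun e => expoVal (x e)) -
        r * (η * conflictCost H W (fun e => expoVal (x e))) := by ring
    _ ≤ _ := by linarith

end RoundingLevel

/-! ### The labels and the steps of the matching algorithm -/

section Relaxation

variable {E : Type*} [Fintype E] {S : Type}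

/-- One synchronous update of all labels. -/
noncomputable def relax (H : SimpleGraph E) (g : S → Multiset S → S) (y : E → S) : E → S :=
  fun e => g (y e) (nbrs H y e)

/-- A list of synchronous updates. -/
noncomputable def runList (H : SimpleGraph E) (l : List (S → Multiset S → S)) (y : E → S) : E → S :=
  l.foldl (fun y g => relax H g y) y

theorem runList_append (H : SimpleGraph E) (l l' : List (S → Multiset S → S)) (y : E → S) :
    runList H (l ++ l') y = runList H l' (runList H l y) := List.foldl_append

theorem runList_singleton (H : SimpleGraph E) (g : S → Multiset S → S) (y : E → S) :
    runList H [g] y = relax H g y := rfl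

theorem runList_map_range (H : SimpleGraph E) (g : ℕ → S → Multiset S → S) (Y : ℕ → E → S) (n : ℕ)
    (h : ∀ t < n, relax H (g t) (Y t) = Y (t + 1)) :
    runList H ((List.range n).map g) (Y 0) = Y n := by
  induction n with
  | zero => rfl
  | succ n ih =>
    rw [List.range_succ, List.map_append, runList_append, ih fun t ht => h t (by omega)]
    exact h n (Nat.lt_succ_self n)

open Classical in
theorem nbrs_map_sum (H : SimpleGraph E) (y : E → S) (w : S → ℝ) (e : E) :
    ((nbrs H y e).map w).sum = ∑ f, if H.Adj e f then w (y f) else 0 := by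
  rw [nbrs, Multiset.map_map, ← Finset.sum_filter]
  rfl

theorem mem_nbrs {H : SimpleGraph E} {y : E → S} {e : E} {z : S} :
    z ∈ nbrs H y e ↔ ∃ f, H.Adj e f ∧ y f = z := by
  simp [nbrs]

end Relaxation

/-- The label of an edge. -/
structure Label where
  /-- the colour in a proper colouring -/
  col : ℕ
  /-- the weight -/
  wt : ℝ
  /-- the number of phases in which the edge takes part -/
  phases : ℕ
  /-- membership in the matching -/
  inM : Prop
  /-- not covered by the matching -/
  alive : Prop
  /-- the weight that is covered if the edge is matched -/
  gain : ℝ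
  /-- the exponent of the fractional value -/
  expo : Option ℕ
  /-- the first defective colour -/
  colA : ℕ
  /-- the second defective colour -/
  colB : Option ℕ

open Classical in
/-- Computes the gain and the initial fractional value. -/
noncomputable def startStep (s : Label) (N : Multiset Label) : Label :=
  { s with
    gain := if s.alive then s.wt + (N.map fun z => if z.alive then z.wt else 0).sum else 0
    expo := if s.alive then some (sInf {j : ℕ | 16 * (s.wt + (N.map fun z =>
      if z.alive then z.wt else 0).sum) ≤ s.wt * 2 ^ j}) else none }

/-- The weight of the conflict between two labels in the `i`-th rounding level. -/
noncomputable def labelConflict (i : ℕ) (s z : Label) : ℝ :=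
  if s.expo = some i ∧ z.expo = some i then s.gain + z.gain else 0

open Classical in
/-- A point where the polynomial of the colour has few conflicts. -/
noncomputable def hashPoint (ℓ q i : ℕ) (s : Label) (N : Multiset Label) : ℕ :=
  if h : ∃ t < q, (N.map fun z => if polyVal 2 ℓ q z.col t = polyVal 2 ℓ q s.col t then
      labelConflict i s z else 0).sum ≤ (ℓ / q : ℝ) * (N.map (labelConflict i s)).sum
  then h.choose else 0

/-- Chooses the first defective colour. -/
noncomputable def hashStep (ℓ q i : ℕ) (s : Label) (N : Multiset Label) : Label :=
  { s with
    colA := hashPoint ℓ q i s N * q + polyVal 2 ℓ q s.col (hashPoint ℓ q i s N)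
    colB := none }

open Classical in
/-- Step `t` of the locally iterative second defective colouring. -/
noncomputable def iterStep (q i t : ℕ) (s : Label) (N : Multiset Label) : Label :=
  { s with
    colB := if s.colB = none ∧
        (N.map fun z => if z.colA ≠ s.colA ∧
            ((z.colB = none ∧ polyVal q 4 q z.colA t = polyVal q 4 q s.colA t) ∨
              z.colB = some (polyVal q 4 q s.colA t)) then
          labelConflict i s z else 0).sum ≤
          (((4 + 4 : ℕ) : ℝ) / q) * (N.map (labelConflict i s)).sum
      then some (polyVal q 4 q s.colA t) else s.colB }

open Classical in
/-- The elements of value `2⁻ⁱ` and colour `t` double their value or drop it. -/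
noncomputable def decideStep (r : ℝ) (i t : ℕ) (s : Label) (N : Multiset Label) : Label :=
  { s with
    expo := if s.expo = some i ∧ s.colB = some t then
        if 0 ≤ s.gain - r * (N.map fun z => (s.gain + z.gain) * expoVal z.expo).sum then
          some (i - 1) else none
      else s.expo }

/-- The edges of value `1` without adjacent edges of value `1` are matched. -/
def selectStep (s : Label) (N : Multiset Label) : Label :=
  { s with inM := s.inM ∨ (s.alive ∧ s.expo = some 0 ∧ ∀ z ∈ N, z.expo ≠ some 0) }

/-- The covered edges are removed. -/
def coverStep (s : Label) (N : Multiset Label) : Label :=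
  { s with alive := s.alive ∧ ¬ s.inM ∧ ∀ z ∈ N, ¬ z.inM }

/-- The primes used for the two defective colourings. -/
noncomputable def hashPrime (ℓ : ℕ) : ℕ := primeAbove (2 * ℓ * ℓ)

/-- The primes used for the two defective colourings. -/
noncomputable def iterPrime (ℓ : ℕ) : ℕ := primeAbove (32 * ℓ)

/-- The rounding of the values `2⁻ⁱ`. -/
noncomputable def levelSteps (ℓ i : ℕ) : List (Label → Multiset Label → Label) :=
  [hashStep ℓ (hashPrime ℓ) i] ++ (List.range (iterPrime ℓ)).map (iterStep (iterPrime ℓ) i) ++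
    (List.range (iterPrime ℓ)).map (decideStep ((1 + 1 / (ℓ : ℝ)) ^ (i - 1)) i)

/-- The rounding levels `n, …, 1`. -/
noncomputable def roundingSteps (ℓ : ℕ) : ℕ → List (Label → Multiset Label → Label)
  | 0 => []
  | n + 1 => levelSteps ℓ (n + 1) ++ roundingSteps ℓ n

/-- One phase: a matching that covers a constant fraction of the remaining weight. -/
noncomputable def phaseSteps (ℓ : ℕ) : List (Label → Multiset Label → Label) :=
  [startStep] ++ roundingSteps ℓ ℓ ++ [selectStep, coverStep]

/-! ### The effect of the label updates in one rounding level. -/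

section Level

variable {E : Type*} [Fintype E] {H : SimpleGraph E}

open Classical in
theorem nbrs_conflict_sum (y : E → Label) (i : ℕ) (Q : Label → Prop) [DecidablePred Q] (e : E) :
    ((nbrs H y e).map fun z => if Q z then labelConflict i (y e) z else 0).sum =
      ∑ f, if Q (y f) then
        levelConflict H (fun e => (y e).gain) i (fun e => (y e).expo) e f else 0 := by
  rw [nbrs_map_sum]
  refine Finset.sum_congr rfl fun f _ => ?_
  simp only [labelConflict, levelConflict]
  by_cases h : H.Adj e f <;> simp [h]

theorem nbrs_labelConflict_sum (y : E → Label) (i : ℕ) (e : E) :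
    ((nbrs H y e).map (labelConflict i (y e))).sum =
      ∑ f, levelConflict H (fun e => (y e).gain) i (fun e => (y e).expo) e f := by
  simpa using nbrs_conflict_sum (H := H) y i (fun _ => True) e

-- Adjacent edges have different colours, so their polynomials agree at no more than `ℓ` of the `q`
-- points, and an average point is good. The new colour encodes both the point and the value, so `f`
-- can share the colour of `e` only if it agrees with `e` at the point chosen by `e`.
open Classical in
theorem hashStep_spec {ℓ i : ℕ} {q : ℕ} (hq : q.Prime) (y : E → Label)
    (hcol : ∀ e, (y e).col < 2 ^ ℓ) (hproper : ∀ e f, H.Adj e f → (y e).col ≠ (y f).col)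
    (hgain : ∀ e, 0 ≤ (y e).gain) :
    ∃ a : E → ℕ, relax H (hashStep ℓ q i) y =
        (fun e => { y e with colA := a e, colB := none }) ∧ (∀ e, a e < q * q) ∧
      ∀ e, ∑ f, (if a f = a e then
          levelConflict H (fun e => (y e).gain) i (fun e => (y e).expo) e f else 0) ≤
        (ℓ / q : ℝ) *
          ∑ f, levelConflict H (fun e => (y e).gain) i (fun e => (y e).expo) e f := by
  have hex : ∀ e, ∃ t < q, ((nbrs H y e).map fun z =>
      if polyVal 2 ℓ q z.col t = polyVal 2 ℓ q (y e).col t then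
        labelConflict i (y e) z else 0).sum ≤
      (ℓ / q : ℝ) * ((nbrs H y e).map (labelConflict i (y e))).sum := by
    intro e
    obtain ⟨t, ht, hle⟩ := exists_average_conflict_le (k := ℓ) hq.pos
      (levelConflict H (fun e => (y e).gain) i (fun e => (y e).expo) e)
      (levelConflict_nonneg hgain e)
      (fun t f => polyVal 2 ℓ q (y f).col t = polyVal 2 ℓ q (y e).col t) (by
        intro f hf
        have hadj : H.Adj e f := by
          by_contra h
          exact hf (by simp [levelConflict, h])
        simpa using
          card_polyVal_eq_polyVal_le hq hq.two_le (hcol f) (hcol e) (hproper e f hadj).symm)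
    refine ⟨t, ht, ?_⟩
    rw [nbrs_labelConflict_sum,
      nbrs_conflict_sum y i (fun z => polyVal 2 ℓ q z.col t = polyVal 2 ℓ q (y e).col t)]
    exact hle
  have hpoint : ∀ e, hashPoint ℓ q i (y e) (nbrs H y e) < q ∧ ((nbrs H y e).map fun z =>
      if polyVal 2 ℓ q z.col (hashPoint ℓ q i (y e) (nbrs H y e)) =
        polyVal 2 ℓ q (y e).col (hashPoint ℓ q i (y e) (nbrs H y e)) then
        labelConflict i (y e) z else 0).sum ≤
      (ℓ / q : ℝ) * ((nbrs H y e).map (labelConflict i (y e))).sum := by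
    intro e
    have h := (hex e).choose_spec
    have h' : hashPoint ℓ q i (y e) (nbrs H y e) = (hex e).choose := by
      rw [hashPoint, dif_pos (hex e)]
    rw [h']
    exact h
  set τ : E → ℕ := fun e => hashPoint ℓ q i (y e) (nbrs H y e) with hτ
  refine ⟨fun e => τ e * q + polyVal 2 ℓ q (y e).col (τ e), rfl, ?_, ?_⟩
  · intro e
    calc τ e * q + polyVal 2 ℓ q (y e).col (τ e) < τ e * q + q :=
          Nat.add_lt_add_left (polyVal_lt hq) _
      _ = (τ e + 1) * q := by ring
      _ ≤ q * q := Nat.mul_le_mul_right _ (hpoint e).1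
  · intro e
    have h := (hpoint e).2
    rw [nbrs_labelConflict_sum, nbrs_conflict_sum y i
      (fun z => polyVal 2 ℓ q z.col (τ e) = polyVal 2 ℓ q (y e).col (τ e))] at h
    refine le_trans (Finset.sum_le_sum fun f _ => ?_) h
    have hnn := levelConflict_nonneg (H := H) (i := i) (x := fun e => (y e).expo) hgain e f
    by_cases hf : τ f * q + polyVal 2 ℓ q (y f).col (τ f) =
        τ e * q + polyVal 2 ℓ q (y e).col (τ e)
    · have h1 : τ f = τ e := by
        have := congrArg (· / q) hf
        simpa [mul_comm _ q, Nat.mul_add_div hq.pos, Nat.div_eq_of_lt (polyVal_lt hq)] using this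
      rw [h1] at hf
      rw [if_pos (Nat.add_left_cancel hf)]
      split_ifs
      exacts [le_rfl, hnn]
    · rw [if_neg hf]
      split_ifs
      exacts [hnn, le_rfl]

theorem iterSteps_spec {i q : ℕ} (y : E → Label) (hy : ∀ e, (y e).colB = none) :
    runList H ((List.range q).map (iterStep q i)) y = fun e => { y e with
      colB := iterColour (fun e => (y e).colA) (fun e t => polyVal q 4 q (y e).colA t)
        (levelConflict H (fun e => (y e).gain) i (fun e => (y e).expo))
        (((4 + 4 : ℕ) : ℝ) / q) q e } := by
  classical
  have h := runList_map_range H (iterStep q i) (fun t e => { y e with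
      colB := iterColour (fun e => (y e).colA) (fun e t => polyVal q 4 q (y e).colA t)
        (levelConflict H (fun e => (y e).gain) i (fun e => (y e).expo))
        (((4 + 4 : ℕ) : ℝ) / q) t e }) q (by
    intro t _
    funext e
    simp only [relax, iterStep, Label.mk.injEq, true_and]
    rw [nbrs_labelConflict_sum (y := fun e => ({ y e with
      colB := iterColour (fun e => (y e).colA) (fun e t => polyVal q 4 q (y e).colA t)
        (levelConflict H (fun e => (y e).gain) i (fun e => (y e).expo))
        (((4 + 4 : ℕ) : ℝ) / q) t e } : Label))]
    rw [nbrs_conflict_sum (y := fun e => ({ y e with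
      colB := iterColour (fun e => (y e).colA) (fun e t => polyVal q 4 q (y e).colA t)
        (levelConflict H (fun e => (y e).gain) i (fun e => (y e).expo))
        (((4 + 4 : ℕ) : ℝ) / q) t e } : Label)) (Q := fun z => z.colA ≠ (y e).colA ∧
            ((z.colB = none ∧ polyVal q 4 q z.colA t = polyVal q 4 q (y e).colA t) ∨
              z.colB = some (polyVal q 4 q (y e).colA t)))]
    rw [iterColour_succ]
    exact if_congr (and_congr Iff.rfl (iff_of_eq (congrArg₂ (· ≤ ·)
      (Finset.sum_congr rfl fun f _ => if_congr Iff.rfl rfl rfl) rfl))) rfl rfl)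
  rw [← h]
  congr 1
  funext e
  simp only [iterColour]
  rw [← hy e]

theorem decideSteps_spec {i n : ℕ} {r : ℝ} (y : E → Label) :
    runList H ((List.range n).map (decideStep r i)) y = fun e => { y e with
      expo := decideSeq H (fun e => (y e).gain) r i (fun e => (y e).colB)
        (fun e => (y e).expo) n e } := by
  classical
  refine runList_map_range H (decideStep r i) (fun t e => { y e with
      expo := decideSeq H (fun e => (y e).gain) r i (fun e => (y e).colB)
        (fun e => (y e).expo) t e }) n ?_
  intro t _
  funext e
  simp only [relax, decideStep, Label.mk.injEq, true_and, and_true]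
  rw [decideSeq_succ, nbrs_map_sum]
  rfl

end Level

/-! ### All rounding levels together. -/

section Phase

variable {E : Type*} [Fintype E] {H : SimpleGraph E}

/-- The utility of the fractional values. -/
noncomputable def utility (W : E → ℝ) (x : E → Option ℕ) : ℝ := ∑ e, W e * expoVal (x e)

/-- Each defective colouring contributes at most `1/(2ℓ)`; this determines the primes. The factor 2
comes from `sum_monochromatic_iterColour_le`, and `4 + 4` from polynomials of degree 4. -/
theorem hash_add_iter_le {ℓ : ℕ} (hℓ : 1 ≤ ℓ) :
    (ℓ / hashPrime ℓ : ℝ) + 2 * (((4 + 4 : ℕ) : ℝ) / iterPrime ℓ) ≤ 1 / ℓ := by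
  have h1 : ((2 * ℓ * ℓ : ℕ) : ℝ) ≤ hashPrime ℓ := by exact_mod_cast (lt_primeAbove _).le
  have h2 : ((32 * ℓ : ℕ) : ℝ) ≤ iterPrime ℓ := by exact_mod_cast (lt_primeAbove _).le
  have hl : (0 : ℝ) < ℓ := by exact_mod_cast hℓ
  push_cast at h1 h2
  have e1 : (ℓ / hashPrime ℓ : ℝ) ≤ ℓ / (2 * ℓ * ℓ) := by gcongr
  have e2 : (((4 + 4 : ℕ) : ℝ) / iterPrime ℓ) ≤ ((4 + 4 : ℕ) : ℝ) / (32 * ℓ) := by gcongr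
  have e3 : (ℓ : ℝ) / (2 * ℓ * ℓ) + 2 * (((4 + 4 : ℕ) : ℝ) / (32 * ℓ)) = 1 / ℓ := by
    push_cast
    field_simp
    norm_num
  linarith

/-- The colours of the first colouring have four digits in base `iterPrime ℓ`, so degree 4 suffices
in `iterStep`. -/
theorem hashPrime_le {ℓ : ℕ} (hℓ : 1 ≤ ℓ) :
    hashPrime ℓ * hashPrime ℓ ≤ iterPrime ℓ ^ 4 := by
  have h1 : hashPrime ℓ ≤ 2 * (2 * ℓ * ℓ) := primeAbove_le (by positivity)
  have h2 : 32 * ℓ ≤ iterPrime ℓ := (lt_primeAbove _).le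
  have h3 : hashPrime ℓ ≤ iterPrime ℓ ^ 2 := by
    refine h1.trans (le_trans ?_ (Nat.pow_le_pow_left h2 2))
    nlinarith
  calc hashPrime ℓ * hashPrime ℓ ≤ iterPrime ℓ ^ 2 * iterPrime ℓ ^ 2 := Nat.mul_le_mul h3 h3
    _ = _ := by ring

/-- The coefficient of the cost falls by a factor `1 + 1/ℓ`, which pays for the conflicts inside the
colour classes; the levels then telescope. -/
theorem levelSteps_spec {ℓ i : ℕ} (hℓ : 1 ≤ ℓ) (hi : 1 ≤ i) (y : E → Label)
    (hcol : ∀ e, (y e).col < 2 ^ ℓ) (hproper : ∀ e f, H.Adj e f → (y e).col ≠ (y f).col)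
    (hgain : ∀ e, 0 ≤ (y e).gain) (hexpo : ∀ e j, (y e).expo = some j → j ≤ i) :
    ∃ (x : E → Option ℕ) (a : E → ℕ) (b : E → Option ℕ),
      runList H (levelSteps ℓ i) y =
        (fun e => { y e with expo := x e, colA := a e, colB := b e }) ∧
      (∀ e j, x e = some j → j ≤ i - 1) ∧
      utility (fun e => (y e).gain) (fun e => (y e).expo) -
        (1 + 1 / (ℓ : ℝ)) ^ i *
          conflictCost H (fun e => (y e).gain) (fun e => expoVal (y e).expo) ≤
      utility (fun e => (y e).gain) x - (1 + 1 / (ℓ : ℝ)) ^ (i - 1) *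
        conflictCost H (fun e => (y e).gain) (fun e => expoVal (x e)) := by
  classical
  obtain ⟨a, ha1, ha2, ha3⟩ := hashStep_spec (H := H) (i := i) (prime_primeAbove (2 * ℓ * ℓ)) y hcol
    hproper hgain
  change relax H (hashStep ℓ (hashPrime ℓ) i) y = _ at ha1
  change ∀ e, a e < hashPrime ℓ * hashPrime ℓ at ha2
  set q := iterPrime ℓ with hq
  have hqp : q.Prime := prime_primeAbove _
  set W : E → ℝ := fun e => (y e).gain with hW
  set x₀ : E → Option ℕ := fun e => (y e).expo with hx₀
  set s := levelConflict H W i x₀ with hs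
  set p : E → ℕ → ℕ := fun e t => polyVal q 4 q (a e) t with hp
  set θ : ℝ := ((4 + 4 : ℕ) : ℝ) / q with hθ
  set b := iterColour a p s θ q with hb
  have hiter := iterSteps_spec (H := H) (i := i) (q := q)
    (fun e => { y e with colA := a e, colB := none }) (fun _ => rfl)
  have hdec := decideSteps_spec (H := H) (i := i) (n := q) (r := (1 + 1 / (ℓ : ℝ)) ^ (i - 1))
    (fun e => { y e with colA := a e, colB := b e })
  refine ⟨decideSeq H W ((1 + 1 / (ℓ : ℝ)) ^ (i - 1)) i b x₀ q, a, b, ?_, ?_, ?_⟩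
  · rw [levelSteps, runList_append, runList_append, runList_singleton, ha1, ← hq, hiter]
    exact hdec
  all_goals
    have hpp : ∀ e f, a f ≠ a e → ((Finset.range q).filter fun t => p f t = p e t).card ≤ 4 :=
      fun e f hne => card_polyVal_eq_polyVal_le hqp le_rfl
        ((ha2 f).trans_le (hashPrime_le hℓ)) ((ha2 e).trans_le (hashPrime_le hℓ)) hne
    have hpv : ∀ e v, ((Finset.range q).filter fun t => p e t = v).card ≤ 4 := fun e v =>
      card_polyVal_eq_le hqp (by norm_num)
    have hs0 : ∀ e f, 0 ≤ s e f := levelConflict_nonneg hgain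
  · refine decideSeq_lt hi hexpo fun e => ?_
    obtain ⟨v, hv⟩ := Option.ne_none_iff_exists'.1
      (iterColour_ne_none hqp.pos hs0 hpp hpv hθ e)
    obtain ⟨τ, -, -, rfl, -⟩ := exists_iterColour_time hv
    exact ⟨_, polyVal_lt hqp, hv⟩
  · have hmono := sum_monochromatic_iterColour_le hqp.pos hs0
      (fun e f => levelConflict_comm e f) hpp hpv hθ
    have hr : (0 : ℝ) ≤ 1 / ℓ := by positivity
    have hη : ∑ e, ∑ f, (if b e = b f then levelConflict H W i x₀ e f else 0) ≤
        (1 / (ℓ : ℝ)) * ∑ e, ∑ f, levelConflict H W i x₀ e f := by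
      have h1 : ∑ e, ∑ f, (if a f = a e then s e f else 0) ≤
          (ℓ / hashPrime ℓ : ℝ) * ∑ e, ∑ f, s e f := by
        rw [Finset.mul_sum]
        exact Finset.sum_le_sum fun e _ => ha3 e
      have h2 : ∑ e, ∑ f, (if b e = b f then s e f else 0) ≤
          ∑ e, ∑ f, (if a f = a e then s e f else 0) +
          ∑ e, ∑ f, (if a f ≠ a e ∧ b e = b f then s e f else 0) := by
        simp only [← Finset.sum_add_distrib]
        refine Finset.sum_le_sum fun e _ => Finset.sum_le_sum fun f _ => ?_
        have := hs0 e f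
        by_cases h1 : a f = a e <;> by_cases h2 : b e = b f <;> simp [h1, h2, this]
      have h3 : 0 ≤ ∑ e, ∑ f, s e f :=
        Finset.sum_nonneg fun e _ => Finset.sum_nonneg fun f _ => hs0 e f
      have h4 := mul_le_mul_of_nonneg_right (hash_add_iter_le hℓ) h3
      rw [add_mul, ← hq, ← hθ] at h4
      linarith
    have h := utility_rounding_level (H := H) (q := q) (r := (1 + 1 / (ℓ : ℝ)) ^ (i - 1)) hgain
      (by positivity) hi hη hr
    rw [← pow_succ, Nat.sub_add_cancel hi] at h
    exact h

theorem roundingSteps_spec {ℓ : ℕ} (hℓ : 1 ≤ ℓ) (n : ℕ) (y : E → Label)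
    (hcol : ∀ e, (y e).col < 2 ^ ℓ) (hproper : ∀ e f, H.Adj e f → (y e).col ≠ (y f).col)
    (hgain : ∀ e, 0 ≤ (y e).gain) (hexpo : ∀ e j, (y e).expo = some j → j ≤ n) :
    ∃ (x : E → Option ℕ) (a : E → ℕ) (b : E → Option ℕ),
      runList H (roundingSteps ℓ n) y =
        (fun e => { y e with expo := x e, colA := a e, colB := b e }) ∧
      (∀ e j, x e = some j → j = 0) ∧
      utility (fun e => (y e).gain) (fun e => (y e).expo) -
        (1 + 1 / (ℓ : ℝ)) ^ n *
          conflictCost H (fun e => (y e).gain) (fun e => expoVal (y e).expo) ≤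
      utility (fun e => (y e).gain) x -
        conflictCost H (fun e => (y e).gain) (fun e => expoVal (x e)) := by
  induction n generalizing y with
  | zero =>
    exact ⟨fun e => (y e).expo, fun e => (y e).colA, fun e => (y e).colB, rfl,
      fun e j h => Nat.le_zero.1 (hexpo e j h), by simp⟩
  | succ n ih =>
    obtain ⟨x, a, b, h1, h2, h3⟩ := levelSteps_spec (i := n + 1) hℓ (by omega) y hcol hproper hgain
      hexpo
    obtain ⟨x', a', b', h1', h2', h3'⟩ := ih
      (fun e => { y e with expo := x e, colA := a e, colB := b e }) hcol hproper hgain h2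
    refine ⟨x', a', b', ?_, h2', h3.trans h3'⟩
    rw [roundingSteps, runList_append, h1, h1']

theorem one_add_inv_pow_le {ℓ : ℕ} (hℓ : 1 ≤ ℓ) : (1 + 1 / (ℓ : ℝ)) ^ ℓ ≤ 3 := by
  have hl : (0 : ℝ) < ℓ := by exact_mod_cast hℓ
  calc (1 + 1 / (ℓ : ℝ)) ^ ℓ ≤ Real.exp (1 / ℓ) ^ ℓ := by
        refine pow_le_pow_left₀ (by positivity) ?_ ℓ
        rw [add_comm]
        exact Real.add_one_le_exp _
    _ = Real.exp 1 := by
        rw [← Real.exp_nat_mul]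
        congr 1
        field_simp
    _ ≤ 3 := by linarith [Real.exp_one_lt_d9]

/-! ### Utility, cost and covered weight when neighbourhoods are covered by two cliques. -/

/-- Every neighbourhood is covered by two cliques. -/
def CoveredByTwoCliques {E : Type*} (H : SimpleGraph E) : Prop :=
  ∀ e, ∃ A B : Set E, H.IsClique A ∧ H.IsClique B ∧ ∀ f, H.Adj e f → f ∈ A ∨ f ∈ B

open Classical in
/-- The weight of the closed neighbourhood. -/
noncomputable def closedWeight (H : SimpleGraph E) (w : E → ℝ) (e : E) : ℝ :=
  w e + ∑ f, if H.Adj e f then w f else 0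

open Classical in
theorem sum_clique_le_closedWeight {w : E → ℝ} (hw : ∀ e, 0 ≤ w e) {A : Set E} (hA : H.IsClique A)
    {e : E} (he : e ∈ A) : ∑ f, (if f ∈ A then w f else 0) ≤ closedWeight H w e := by
  have h1 : w e = ∑ f, if f = e then w f else 0 := by simp
  rw [closedWeight, h1, ← Finset.sum_add_distrib]
  refine Finset.sum_le_sum fun f _ => ?_
  have := hw f
  by_cases hf : f ∈ A
  · by_cases hfe : f = e
    · simp only [hfe, if_true]
      split_ifs <;> linarith [hw e]
    · simp [hf, hfe, hA he hf (Ne.symm hfe)]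
  · rw [if_neg hf]
    split_ifs <;> linarith

-- The closed neighbourhood of each element of a clique `A` contains `A`, so `x e ≤ w e / (16
-- w(A))`, and these bounds sum to 1/16. If `w(A) = 0`, the values vanish by `hx0`.
open Classical in
theorem sum_clique_value_le {w x : E → ℝ} (hw : ∀ e, 0 ≤ w e) (hx : ∀ e, 0 ≤ x e)
    (hx0 : ∀ e, w e = 0 → x e = 0) (hxw : ∀ e, x e * (16 * closedWeight H w e) ≤ w e)
    {A : Set E} (hA : H.IsClique A) : ∑ f, (if f ∈ A then x f else 0) ≤ 1 / 16 := by
  have hS0 : 0 ≤ ∑ f, (if f ∈ A then w f else 0) :=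
    Finset.sum_nonneg fun f _ => by split_ifs; exacts [hw f, le_rfl]
  rcases hS0.eq_or_lt with h0 | hpos
  · have h1 : ∀ f, (if f ∈ A then x f else 0) = 0 := by
      intro f
      by_cases hf : f ∈ A
      · have := (Finset.sum_eq_zero_iff_of_nonneg (s := Finset.univ)
          (f := fun f => if f ∈ A then w f else 0)
          (fun f _ => by split_ifs; exacts [hw f, le_rfl])).1 h0.symm f (Finset.mem_univ f)
        simp only [hf, if_true] at this ⊢
        exact hx0 f this
      · simp [hf]
    simp [h1]
  · have h1 : (∑ f, (if f ∈ A then x f else 0)) * (16 * ∑ f, (if f ∈ A then w f else 0)) ≤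
        ∑ f, (if f ∈ A then w f else 0) := by
      rw [Finset.sum_mul]
      refine Finset.sum_le_sum fun f _ => ?_
      by_cases hf : f ∈ A
      · simp only [if_pos hf]
        refine le_trans (mul_le_mul_of_nonneg_left ?_ (hx f)) (hxw f)
        linarith [sum_clique_le_closedWeight hw hA hf]
      · simp [hf]
    by_contra hcon
    rw [not_le] at hcon
    nlinarith

open Classical in
theorem conflictCost_le {w x : E → ℝ} (hH : CoveredByTwoCliques H) (hw : ∀ e, 0 ≤ w e)
    (hx : ∀ e, 0 ≤ x e)
    (hx0 : ∀ e, w e = 0 → x e = 0) (hxw : ∀ e, x e * (16 * closedWeight H w e) ≤ w e)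
    {W : E → ℝ} (hW : ∀ e, 0 ≤ W e) :
    conflictCost H W x ≤ 1 / 8 * ∑ e, W e * x e := by
  rw [conflictCost, Finset.mul_sum]
  refine Finset.sum_le_sum fun e _ => ?_
  have h1 : ∑ f, (if H.Adj e f then x f else 0) ≤ 1 / 8 := by
    obtain ⟨A, B, hA, hB, hAB⟩ := hH e
    have h2 := sum_clique_value_le hw hx hx0 hxw hA
    have h3 := sum_clique_value_le hw hx hx0 hxw hB
    have h4 : ∑ f, (if H.Adj e f then x f else 0) ≤
        ∑ f, (if f ∈ A then x f else 0) + ∑ f, (if f ∈ B then x f else 0) := by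
      rw [← Finset.sum_add_distrib]
      refine Finset.sum_le_sum fun f _ => ?_
      have := hx f
      by_cases hf : H.Adj e f
      · rcases hAB f hf with h | h
        · simp only [hf, h, if_true]
          split_ifs <;> linarith
        · simp only [hf, h, if_true]
          split_ifs <;> linarith
      · rw [if_neg hf]
        split_ifs <;> linarith
    linarith
  calc ∑ f, (if H.Adj e f then W e * x e * x f else 0)
      = W e * x e * ∑ f, (if H.Adj e f then x f else 0) := by
        rw [Finset.mul_sum]
        refine Finset.sum_congr rfl fun f _ => ?_
        split_ifs <;> simp
    _ ≤ W e * x e * (1 / 8) := mul_le_mul_of_nonneg_left h1 (mul_nonneg (hW e) (hx e))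
    _ = _ := by ring

-- Double counting: `w f` is counted once for each element of `M` in the closed neighbourhood of
-- `f`. That is at most once if `f` is in `M`, and otherwise at most once for each of the two
-- cliques around `f`.
open Classical in
theorem sum_gain_le_two_mul_covered (hH : CoveredByTwoCliques H) {w : E → ℝ} (hw : ∀ e, 0 ≤ w e)
    (M : E → Prop) (hM : ∀ e f, M e → H.Adj e f → ¬ M f) :
    ∑ e, (if M e then closedWeight H w e else 0) ≤
      2 * ∑ f, (if M f ∨ ∃ e, H.Adj f e ∧ M e then w f else 0) := by
  have h1 : ∑ e, (if M e then closedWeight H w e else 0) =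
      ∑ f, ((if M f then w f else 0) + ∑ e, if H.Adj f e ∧ M e then w f else 0) := by
    rw [Finset.sum_add_distrib, Finset.sum_comm, ← Finset.sum_add_distrib]
    refine Finset.sum_congr rfl fun e _ => ?_
    by_cases he : M e
    · simp only [he, if_true, closedWeight, and_true, H.adj_comm e]
    · simp [he]
  rw [h1, Finset.mul_sum]
  refine Finset.sum_le_sum fun f _ => ?_
  have hwf := hw f
  by_cases hf : M f
  · have h2 : ∑ e, (if H.Adj f e ∧ M e then w f else 0) = 0 := by
      refine Finset.sum_eq_zero fun e _ => if_neg ?_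
      rintro ⟨h, h'⟩
      exact hM f e hf h h'
    rw [h2, if_pos hf, if_pos (Or.inl hf)]
    linarith
  · rw [if_neg hf, zero_add, ← Finset.sum_filter, Finset.sum_const, nsmul_eq_mul]
    by_cases hex : ∃ e, H.Adj f e ∧ M e
    · rw [if_pos (Or.inr hex)]
      refine mul_le_mul_of_nonneg_right ?_ hwf
      obtain ⟨A, B, hA, hB, hAB⟩ := hH f
      have hone : ∀ C : Set E, H.IsClique C →
          (Finset.univ.filter fun e => e ∈ C ∧ M e).card ≤ 1 := by
        intro C hC
        refine Finset.card_le_one.2 fun a ha b hb => ?_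
        simp only [Finset.mem_filter, Finset.mem_univ, true_and] at ha hb
        by_contra hab
        exact hM a b ha.2 (hC ha.1 hb.1 hab) hb.2
      have hsub : (Finset.univ.filter fun e => H.Adj f e ∧ M e) ⊆
          (Finset.univ.filter fun e => e ∈ A ∧ M e) ∪
          (Finset.univ.filter fun e => e ∈ B ∧ M e) := by
        intro e he
        simp only [Finset.mem_filter, Finset.mem_univ, true_and, Finset.mem_union] at he ⊢
        exact (hAB e he.1).imp (fun h => ⟨h, he.2⟩) fun h => ⟨h, he.2⟩
      have := (Finset.card_le_card hsub).trans (Finset.card_union_le _ _)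
      have h2 := hone A hA
      have h3 := hone B hB
      exact_mod_cast (by omega : (Finset.univ.filter fun e => H.Adj f e ∧ M e).card ≤ 2)
    · rw [if_neg (fun h => h.elim hf hex), Finset.filter_false_of_mem]
      · simp
      · intro e _ h
        exact hex ⟨e, h⟩

-- An element of value 1 with a neighbour of value 1 pays at least `W e` in cost, so its net
-- contribution is not positive.
open Classical in
theorem utility_sub_conflictCost_le {W : E → ℝ} (hW : ∀ e, 0 ≤ W e) {x : E → Option ℕ}
    (hx : ∀ e j, x e = some j → j = 0) :
    utility W x - conflictCost H W (fun e => expoVal (x e)) ≤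
      ∑ e, if x e = some 0 ∧ ∀ f, H.Adj e f → x f ≠ some 0 then W e else 0 := by
  rw [utility, conflictCost, ← Finset.sum_sub_distrib]
  refine Finset.sum_le_sum fun e _ => ?_
  have hval : ∀ e, x e ≠ some 0 → expoVal (x e) = 0 := by
    intro e he
    cases h : x e with
    | none => rfl
    | some j => rw [h, hx e j h] at he; exact absurd rfl he
  by_cases he : x e = some 0
  · have hnn : ∀ f, 0 ≤ if H.Adj e f then W e * expoVal (x e) * expoVal (x f) else 0 := by
      intro f
      split_ifs
      · exact mul_nonneg (mul_nonneg (hW e) (expoVal_nonneg _)) (expoVal_nonneg _)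
      · exact le_rfl
    by_cases hall : ∀ f, H.Adj e f → x f ≠ some 0
    · rw [if_pos ⟨he, hall⟩, he]
      have := Finset.sum_nonneg (s := Finset.univ) fun f _ => hnn f
      rw [he] at this
      simp only [expoVal, pow_zero, mul_one] at this ⊢
      linarith
    · rw [if_neg (fun h => hall h.2)]
      push Not at hall
      obtain ⟨f, hf, hxf⟩ := hall
      have := Finset.single_le_sum (fun f _ => hnn f) (Finset.mem_univ f)
      rw [if_pos hf, hxf] at this
      simp only [expoVal, pow_zero, mul_one] at this ⊢
      linarith
  · rw [hval e he, if_neg (fun h => he h.1)]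
    simp

end Phase

/-! ### One phase covers a constant fraction of the remaining weight. -/

section PhaseSpec

variable {E : Type*} [Fintype E] {H : SimpleGraph E}

theorem closedWeight_nonneg {w : E → ℝ} (hw : ∀ e, 0 ≤ w e) (e : E) : 0 ≤ closedWeight H w e := by
  classical
  refine add_nonneg (hw e) (Finset.sum_nonneg fun f _ => ?_)
  split_ifs
  exacts [hw f, le_rfl]

theorem le_closedWeight {w : E → ℝ} (hw : ∀ e, 0 ≤ w e) (e : E) : w e ≤ closedWeight H w e := by
  classical
  refine le_add_of_nonneg_right (Finset.sum_nonneg fun f _ => ?_)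
  split_ifs
  exacts [hw f, le_rfl]

theorem closedWeight_mono {w w' : E → ℝ} (h : ∀ e, w e ≤ w' e) (e : E) :
    closedWeight H w e ≤ closedWeight H w' e := by
  classical
  refine add_le_add (h e) (Finset.sum_le_sum fun f _ => ?_)
  split_ifs
  exacts [h f, le_rfl]

/-- The least exponent `j` with `r ≤ v * 2 ^ j`. -/
theorem exponent_spec {r v : ℝ} (hv : 0 < v) (hvr : v < r) :
    r ≤ v * 2 ^ sInf {j : ℕ | r ≤ v * 2 ^ j} ∧ v * 2 ^ sInf {j : ℕ | r ≤ v * 2 ^ j} < 2 * r := by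
  have hne : {j : ℕ | r ≤ v * 2 ^ j}.Nonempty := by
    obtain ⟨j, hj⟩ := pow_unbounded_of_one_lt (r / v) (one_lt_two (α := ℝ))
    refine ⟨j, ?_⟩
    rw [div_lt_iff₀ hv] at hj
    rw [Set.mem_ofPred_eq]
    linarith
  have h1 := Nat.sInf_mem hne
  refine ⟨h1, ?_⟩
  cases hs : sInf {j : ℕ | r ≤ v * 2 ^ j} with
  | zero => simp; linarith
  | succ k =>
    have : k ∉ {j : ℕ | r ≤ v * 2 ^ j} := Nat.notMem_of_lt_sInf (by omega)
    rw [Set.mem_ofPred_eq, not_le] at this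
    rw [pow_succ]
    linarith

open Classical in
/-- The weights of the remaining edges. -/
noncomputable def aliveWeight (y : E → Label) (e : E) : ℝ := if (y e).alive then (y e).wt else 0

theorem relax_startStep (y : E → Label) :
    ∃ (W : E → ℝ) (x : E → Option ℕ),
      relax H startStep y = (fun e => { y e with gain := W e, expo := x e }) ∧
      ∀ e, (¬ (y e).alive → W e = 0 ∧ x e = none) ∧
        ((y e).alive → W e = closedWeight H (aliveWeight y) e ∧
          x e = some (sInf {j : ℕ | 16 * W e ≤ (y e).wt * 2 ^ j})) := by
  classical
  refine ⟨_, _, rfl, fun e => ⟨fun h => ?_, fun h => ?_⟩⟩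
  · simp [h]
  · have : (y e).wt + ((nbrs H y e).map fun z => if z.alive then z.wt else 0).sum =
        closedWeight H (aliveWeight y) e := by
      rw [nbrs_map_sum, closedWeight, aliveWeight, if_pos h]
      congr 1
    simp only [if_pos h, this, and_self]

theorem phaseSteps_spec {ℓ : ℕ} (hℓ : 1 ≤ ℓ) (hH : CoveredByTwoCliques H) (y : E → Label)
    (hcol : ∀ e, (y e).col < 2 ^ ℓ) (hproper : ∀ e f, H.Adj e f → (y e).col ≠ (y f).col)
    (hwt : ∀ e, 0 < (y e).wt)
    (hbound : ∀ e, 16 * closedWeight H (fun e => (y e).wt) e ≤ (y e).wt * 2 ^ ℓ) :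
    ∃ M : E → Prop, (∀ e, M e → (y e).alive) ∧ (∀ e f, M e → H.Adj e f → ¬ M f) ∧
      (∀ e, (runList H (phaseSteps ℓ) y e).col = (y e).col ∧
        (runList H (phaseSteps ℓ) y e).wt = (y e).wt ∧
        (runList H (phaseSteps ℓ) y e).phases = (y e).phases ∧
        ((runList H (phaseSteps ℓ) y e).inM ↔ (y e).inM ∨ M e) ∧
        ((runList H (phaseSteps ℓ) y e).alive ↔ (y e).alive ∧ ¬ ((y e).inM ∨ M e) ∧
          ∀ f, H.Adj e f → ¬ ((y f).inM ∨ M f))) ∧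
      ∑ e, aliveWeight (runList H (phaseSteps ℓ) y) e ≤ 127 / 128 * ∑ e, aliveWeight y e := by
  classical
  set w := aliveWeight y with hw
  have hw0 : ∀ e, 0 ≤ w e := fun e => by
    rw [hw, aliveWeight]; split_ifs; exacts [(hwt e).le, le_rfl]
  have hww : ∀ e, w e ≤ (y e).wt := fun e => by
    rw [hw, aliveWeight]; split_ifs; exacts [le_rfl, (hwt e).le]
  obtain ⟨W, x₀, hstart, hWx⟩ := relax_startStep (H := H) y
  have hW0 : ∀ e, 0 ≤ W e := by
    intro e
    by_cases he : (y e).alive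
    · rw [((hWx e).2 he).1]; exact closedWeight_nonneg hw0 e
    · rw [((hWx e).1 he).1]
  have hspec : ∀ e, (y e).alive → w e = (y e).wt ∧ 0 < W e ∧
      expoVal (x₀ e) * (16 * W e) ≤ w e ∧ w e ≤ expoVal (x₀ e) * (32 * W e) := by
    intro e he
    obtain ⟨h1, h2⟩ := (hWx e).2 he
    have hwe : w e = (y e).wt := by rw [hw, aliveWeight, if_pos he]
    have h3 := le_closedWeight (H := H) hw0 e
    rw [← h1, hwe] at h3
    have h4 := hwt e
    obtain ⟨h5, h6⟩ := exponent_spec h4 (r := 16 * W e) (by linarith)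
    rw [h2, hwe]
    simp only [expoVal, one_div, inv_pow]
    set k := sInf {j : ℕ | 16 * W e ≤ (y e).wt * 2 ^ j}
    have hk : (0 : ℝ) < 2 ^ k := by positivity
    refine ⟨trivial, by linarith, ?_, ?_⟩
    · rw [inv_mul_le_iff₀ hk]; linarith
    · rw [le_inv_mul_iff₀ hk]; linarith
  have hexpo : ∀ e j, x₀ e = some j → j ≤ ℓ := by
    intro e j hj
    by_cases he : (y e).alive
    · obtain ⟨h1, h2⟩ := (hWx e).2 he
      rw [h2, Option.some_inj] at hj
      rw [← hj]
      apply Nat.sInf_le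
      rw [Set.mem_ofPred_eq, h1]
      refine le_trans ?_ (hbound e)
      have := closedWeight_mono (H := H) hww e
      linarith
    · rw [((hWx e).1 he).2] at hj
      simp at hj
  obtain ⟨x, a, b, hround, hx01, hutil⟩ := roundingSteps_spec (H := H) hℓ ℓ
    (fun e => { y e with gain := W e, expo := x₀ e }) hcol hproper hW0 hexpo
  change utility W x₀ - _ * conflictCost H W (fun e => expoVal (x₀ e)) ≤
    utility W x - conflictCost H W (fun e => expoVal (x e)) at hutil
  obtain ⟨M, hM⟩ : ∃ M : E → Prop, ∀ e, M e ↔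
      (y e).alive ∧ x e = some 0 ∧ ∀ f, H.Adj e f → x f ≠ some 0 := ⟨_, fun _ => Iff.rfl⟩
  have hMind : ∀ e f, M e → H.Adj e f → ¬ M f := fun e f he hef hf =>
    ((hM e).1 he).2.2 f hef ((hM f).1 hf).2.1
  have hrun : runList H (phaseSteps ℓ) y = fun e =>
      { y e with
        gain := W e, expo := x e, colA := a e, colB := b e, inM := (y e).inM ∨ M e,
        alive := (y e).alive ∧ ¬ ((y e).inM ∨ M e) ∧ ∀ f, H.Adj e f → ¬ ((y f).inM ∨ M f) } := by
    have hsel : relax H selectStep (fun e => { y e with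
        gain := W e, expo := x e, colA := a e, colB := b e }) = fun e => { y e with
        gain := W e, expo := x e, colA := a e, colB := b e, inM := (y e).inM ∨ M e } := by
      funext e
      simp only [relax, selectStep, mem_nbrs, hM, Label.mk.injEq, true_and, and_true]
      simp only [forall_exists_index, and_imp, forall_apply_eq_imp_iff₂]
    rw [phaseSteps, runList_append, runList_append, runList_singleton, hstart, hround]
    change relax H coverStep (relax H selectStep (fun e => { y e with
        gain := W e, expo := x e, colA := a e, colB := b e })) = _
    rw [hsel]
    funext e
    simp only [relax, coverStep, mem_nbrs, Label.mk.injEq, true_and, and_true]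
    simp only [forall_exists_index, and_imp, forall_apply_eq_imp_iff₂]
  refine ⟨M, fun e he => ((hM e).1 he).1, hMind, ?_, ?_⟩
  · intro e
    rw [hrun]
    exact ⟨rfl, rfl, rfl, Iff.rfl, Iff.rfl⟩
  have hcost : conflictCost H W (fun e => expoVal (x₀ e)) ≤ 1 / 8 * utility W x₀ := by
    refine conflictCost_le hH hw0 (fun e => expoVal_nonneg _) ?_ ?_ hW0
    · intro e he
      by_cases hal : (y e).alive
      · have := hwt e
        rw [← (hspec e hal).1, he] at this
        exact absurd this (lt_irrefl _)
      · rw [((hWx e).1 hal).2]; rfl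
    · intro e
      by_cases hal : (y e).alive
      · rw [← ((hWx e).2 hal).1]; exact (hspec e hal).2.2.1
      · rw [((hWx e).1 hal).2]; simpa [expoVal] using hw0 e
  have hU0 : ∑ e, w e ≤ 32 * utility W x₀ := by
    rw [utility, Finset.mul_sum]
    refine Finset.sum_le_sum fun e _ => ?_
    by_cases hal : (y e).alive
    · linarith [(hspec e hal).2.2.2]
    · rw [hw, aliveWeight, if_neg hal, ((hWx e).1 hal).1]; simp
  have hsel : utility W x - conflictCost H W (fun e => expoVal (x e)) ≤
      ∑ e, if M e then closedWeight H w e else 0 := by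
    refine (utility_sub_conflictCost_le hW0 hx01).trans (Finset.sum_le_sum fun e _ => ?_)
    by_cases hal : (y e).alive
    · refine le_of_eq ?_
      rw [((hWx e).2 hal).1]
      exact if_congr ⟨fun h => (hM e).2 ⟨hal, h⟩, fun h => ((hM e).1 h).2⟩ rfl rfl
    · rw [((hWx e).1 hal).1, ite_self]
      split_ifs
      exacts [closedWeight_nonneg hw0 e, le_rfl]
  have hcov := sum_gain_le_two_mul_covered hH hw0 M hMind
  have hpow : (1 + 1 / (ℓ : ℝ)) ^ ℓ * conflictCost H W (fun e => expoVal (x₀ e)) ≤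
      3 * (1 / 8 * utility W x₀) := by
    refine mul_le_mul (one_add_inv_pow_le hℓ) hcost ?_ (by norm_num)
    exact Finset.sum_nonneg fun e _ => Finset.sum_nonneg fun f _ => by
      split_ifs
      exacts [mul_nonneg (mul_nonneg (hW0 e) (expoVal_nonneg _)) (expoVal_nonneg _), le_rfl]
  have hleft : ∑ e, aliveWeight (runList H (phaseSteps ℓ) y) e ≤
      ∑ e, w e - ∑ f, (if M f ∨ ∃ e, H.Adj f e ∧ M e then w f else 0) := by
    rw [← Finset.sum_sub_distrib]
    refine Finset.sum_le_sum fun e _ => ?_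
    rw [hrun, aliveWeight]
    by_cases hc : M e ∨ ∃ f, H.Adj e f ∧ M f
    · rw [if_pos hc, sub_self, if_neg]
      rintro ⟨-, h1, h2⟩
      rcases hc with hc | ⟨f, hf, hc⟩
      · exact h1 (Or.inr hc)
      · exact h2 f hf (Or.inr hc)
    · rw [if_neg hc, sub_zero]
      by_cases hal : (y e).alive
      · rw [(hspec e hal).1]
        split_ifs
        exacts [le_rfl, (hwt e).le]
      · rw [if_neg (fun h => hal h.1)]
        exact hw0 e
  have hwpos : 0 ≤ ∑ e, w e := Finset.sum_nonneg fun e _ => hw0 e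
  -- At least `1 - 3/8` of the initial utility survives, that utility is at least 1/32 of the
  -- weight, and covered weight is counted at most twice. So the covered fraction is at least
  -- `5/512`, which exceeds `1/128`.
  linarith

end PhaseSpec

/-! ### Iteration of the phases -/

/-- The steps of all phases. -/
noncomputable def matchStep (ℓ m : ℕ) : Label → Multiset Label → Label :=
  (phaseSteps ℓ).getD (m % (phaseSteps ℓ).length) fun s _ => s

/-- The number of steps in which an edge takes part. -/
noncomputable def matchLength (ℓ : ℕ) (s : Label) : ℕ := s.phases * (phaseSteps ℓ).length

section Iteration

variable {E : Type*} [Fintype E]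

/-- The subgraph induced by the edges that take part in phase `p`. -/
def activeGraph {E : Type*} (H : SimpleGraph E) (N : E → ℕ) (p : ℕ) : SimpleGraph E where
  Adj e f := H.Adj e f ∧ p < N e ∧ p < N f
  symm.symm _ _ h := ⟨h.1.symm, h.2.2, h.2.1⟩
  loopless.irrefl _ h := h.1.ne rfl

theorem CoveredByTwoCliques.activeGraph {E : Type*} {H : SimpleGraph E}
    (hH : CoveredByTwoCliques H) (N : E → ℕ) (p : ℕ) :
    CoveredByTwoCliques (activeGraph H N p) := by
  intro e
  obtain ⟨A, B, hA, hB, hAB⟩ := hH e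
  refine ⟨A ∩ {f | p < N f}, B ∩ {f | p < N f}, ?_, ?_, ?_⟩
  · exact fun f hf g hg hne => ⟨hA hf.1 hg.1 hne, hf.2, hg.2⟩
  · exact fun f hf g hg hne => ⟨hB hf.1 hg.1 hne, hf.2, hg.2⟩
  · exact fun f hf => (hAB f hf.1).imp (fun h => ⟨h, hf.2.2⟩) fun h => ⟨h, hf.2.2⟩

theorem closedWeight_mono_graph {H H' : SimpleGraph E} (h : ∀ e f, H.Adj e f → H'.Adj e f)
    {w : E → ℝ} (hw : ∀ e, 0 ≤ w e) (e : E) : closedWeight H w e ≤ closedWeight H' w e := by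
  classical
  refine add_le_add le_rfl (Finset.sum_le_sum fun f _ => ?_)
  split_ifs with h1 h2 h2
  exacts [le_rfl, absurd (h e f h1) h2, hw f, le_rfl]

variable (H : SimpleGraph E) (ℓ : ℕ) (y₀ : E → Label)

theorem labelSeq_frozen {S : Type} (step : ℕ → S → Multiset S → S) (K : S → ℕ) (y : E → S)
    {m m' : ℕ} {e : E} (hK : K (y e) ≤ m) (hm : m ≤ m') :
    labelSeq H step K y m' e = labelSeq H step K y m e := by
  induction m', hm using Nat.le_induction with
  | base => rfl
  | succ n hn ih => rw [labelSeq_succ, if_pos (hK.trans hn), ih]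

/-- The labels after `p` phases. -/
noncomputable def phaseLabel (p : ℕ) : E → Label :=
  labelSeq H (matchStep ℓ) (matchLength ℓ) y₀ (p * (phaseSteps ℓ).length)

theorem phaseLabel_of_le {p : ℕ} {e : E} (h : (y₀ e).phases ≤ p) :
    phaseLabel H ℓ y₀ p e = phaseLabel H ℓ y₀ (y₀ e).phases e :=
  labelSeq_frozen H _ _ _ (by rfl) (Nat.mul_le_mul_right _ h)

/-- Active edges read only active neighbours, so a phase is an ordinary run on the active subgraph
and the labels `y` of the other edges are free. -/
theorem labelSeq_phase (p : ℕ) (y : E → Label)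
    (hy : ∀ e, p < (y₀ e).phases → y e = phaseLabel H ℓ y₀ p e) (j : ℕ)
    (hj : j ≤ (phaseSteps ℓ).length) (e : E) (he : p < (y₀ e).phases) :
    labelSeq H (matchStep ℓ) (matchLength ℓ) y₀ (p * (phaseSteps ℓ).length + j) e =
      runList (activeGraph H (fun e => (y₀ e).phases) p) ((phaseSteps ℓ).take j) y e := by
  classical
  induction j generalizing e with
  | zero => exact (hy e he).symm
  | succ j ih =>
    have hactive : ∀ f, matchLength ℓ (y₀ f) ≤ p * (phaseSteps ℓ).length + j ↔
        ¬ p < (y₀ f).phases := by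
      intro f
      rw [matchLength, not_lt]
      constructor
      · intro h
        by_contra hlt
        have := Nat.mul_le_mul_right (phaseSteps ℓ).length (not_le.1 hlt)
        rw [Nat.succ_mul] at this
        omega
      · intro h
        exact (Nat.mul_le_mul_right _ h).trans (Nat.le_add_right _ _)
    rw [← add_assoc, labelSeq_succ, if_neg (by rw [hactive]; exact not_not.2 he),
      List.take_succ_eq_append_getElem hj, runList_append, runList_singleton, relax,
      ih (by omega) e he, matchStep,
      show (p * (phaseSteps ℓ).length + j) % (phaseSteps ℓ).length = j by
        rw [Nat.mul_comm, Nat.mul_add_mod, Nat.mod_eq_of_lt hj], List.getD_eq_getElem _ _ hj, nbrs]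
    have hset : (Finset.univ.filter fun f =>
          H.Adj e f ∧ p * (phaseSteps ℓ).length + j < matchLength ℓ (y₀ f)) =
        Finset.univ.filter ((activeGraph H (fun e => (y₀ e).phases) p).Adj e) := by
      refine Finset.filter_congr fun f _ => ?_
      rw [← not_le, hactive, not_not]
      exact ⟨fun h => ⟨h.1, he, h.2⟩, fun h => ⟨h.1, h.2.2⟩⟩
    rw [hset]
    refine congrArg _ (Multiset.map_congr rfl fun f hf => ih (by omega) f ?_)
    have hf' : f ∈ Finset.univ.filter ((activeGraph H (fun e => (y₀ e).phases) p).Adj e) := hf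
    exact (Finset.mem_filter.1 hf').2.2.2

variable {H ℓ y₀}

theorem phaseLabel_succ_spec (hℓ : 1 ≤ ℓ) (hH : CoveredByTwoCliques H)
    (hcol : ∀ e, (y₀ e).col < 2 ^ ℓ) (hproper : ∀ e f, H.Adj e f → (y₀ e).col ≠ (y₀ f).col)
    (hwt : ∀ e, 0 < (y₀ e).wt)
    (hbound : ∀ e, 16 * closedWeight H (fun e => (y₀ e).wt) e ≤ (y₀ e).wt * 2 ^ ℓ) (p : ℕ)
    (hstat : ∀ e, (phaseLabel H ℓ y₀ p e).col = (y₀ e).col ∧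
      (phaseLabel H ℓ y₀ p e).wt = (y₀ e).wt ∧ (phaseLabel H ℓ y₀ p e).phases = (y₀ e).phases) :
    ∃ M : E → Prop, (∀ e, M e → (phaseLabel H ℓ y₀ p e).alive ∧ p < (y₀ e).phases) ∧
      (∀ e f, M e → H.Adj e f → ¬ M f) ∧
      (∀ e, (phaseLabel H ℓ y₀ (p + 1) e).col = (y₀ e).col ∧
        (phaseLabel H ℓ y₀ (p + 1) e).wt = (y₀ e).wt ∧
        (phaseLabel H ℓ y₀ (p + 1) e).phases = (y₀ e).phases ∧
        ((phaseLabel H ℓ y₀ (p + 1) e).inM ↔ (phaseLabel H ℓ y₀ p e).inM ∨ M e) ∧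
        (p < (y₀ e).phases → ((phaseLabel H ℓ y₀ (p + 1) e).alive ↔
          (phaseLabel H ℓ y₀ p e).alive ∧ ¬ (phaseLabel H ℓ y₀ (p + 1) e).inM ∧
          ∀ f, H.Adj e f → p < (y₀ f).phases → ¬ (phaseLabel H ℓ y₀ (p + 1) f).inM)) ∧
        (¬ p < (y₀ e).phases → ((phaseLabel H ℓ y₀ (p + 1) e).alive ↔
          (phaseLabel H ℓ y₀ p e).alive))) ∧
      ∑ e, (if p + 1 ≤ (y₀ e).phases then aliveWeight (phaseLabel H ℓ y₀ (p + 1)) e else 0) ≤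
        127 / 128 *
          ∑ e, (if p ≤ (y₀ e).phases then aliveWeight (phaseLabel H ℓ y₀ p) e else 0) := by
  classical
  set z := phaseLabel H ℓ y₀ p with hz
  -- Using the freedom outside the active graph: stopped edges are declared covered, so the phase
  -- neither matches them nor counts their weight.
  set y : E → Label := fun e => if p < (y₀ e).phases then z e else
    { z e with alive := False } with hy
  have hyact : ∀ e, p < (y₀ e).phases → y e = z e := fun e he => if_pos he
  have hyin : ∀ e, ¬ p < (y₀ e).phases → y e = { z e with alive := False } := fun e he => if_neg he
  have hys : ∀ e, (y e).col = (y₀ e).col ∧ (y e).wt = (y₀ e).wt := by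
    intro e
    by_cases he : p < (y₀ e).phases
    · rw [hyact e he]; exact ⟨(hstat e).1, (hstat e).2.1⟩
    · rw [hyin e he]; exact ⟨(hstat e).1, (hstat e).2.1⟩
  have hnext : ∀ e, p < (y₀ e).phases → phaseLabel H ℓ y₀ (p + 1) e =
      runList (activeGraph H (fun e => (y₀ e).phases) p) (phaseSteps ℓ) y e := by
    intro e he
    have := labelSeq_phase H ℓ y₀ p y hyact _ le_rfl e he
    rw [List.take_length] at this
    rw [← this, phaseLabel, Nat.succ_mul]
  have hfix : ∀ e, ¬ p < (y₀ e).phases → phaseLabel H ℓ y₀ (p + 1) e = z e := by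
    intro e he
    rw [hz, phaseLabel_of_le H ℓ y₀ (by omega), ← phaseLabel_of_le H ℓ y₀ (p := p) (by omega)]
  obtain ⟨M, hM1, hM2, hM3, hM4⟩ := phaseSteps_spec hℓ
    (hH.activeGraph (fun e => (y₀ e).phases) p) y
    (fun e => by rw [(hys e).1]; exact hcol e)
    (fun e f hef => by rw [(hys e).1, (hys f).1]; exact hproper e f hef.1)
    (fun e => by rw [(hys e).2]; exact hwt e)
    (fun e => by
      have h1 : (fun e => (y e).wt) = fun e => (y₀ e).wt := funext fun e => (hys e).2
      rw [h1, (hys e).2]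
      refine le_trans ?_ (hbound e)
      have := closedWeight_mono_graph (H := activeGraph H (fun e => (y₀ e).phases) p) (H' := H)
        (fun e f h => h.1) (fun e => (hwt e).le) e
      linarith)
  have hMact : ∀ e, M e → p < (y₀ e).phases := by
    intro e he
    by_contra hcon
    have := hM1 e he
    rw [hyin e hcon] at this
    exact this
  have hinM : ∀ e, (phaseLabel H ℓ y₀ (p + 1) e).inM ↔ (z e).inM ∨ M e := by
    intro e
    by_cases he : p < (y₀ e).phases
    · rw [hnext e he, (hM3 e).2.2.2.1, hyact e he]
    · rw [hfix e he]
      exact ⟨Or.inl, fun h => h.resolve_right fun h => he (hMact e h)⟩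
  refine ⟨M, fun e he => ⟨?_, hMact e he⟩, fun e f he hef hf =>
    hM2 e f he ⟨hef, hMact e he, hMact f hf⟩ hf, fun e => ?_, ?_⟩
  · have := hM1 e he
    rwa [hyact e (hMact e he)] at this
  · by_cases he : p < (y₀ e).phases
    · obtain ⟨h1, h2, h3, h4, h5⟩ := hM3 e
      rw [← hnext e he, hyact e he] at h1 h2 h3 h4 h5
      refine ⟨h1.trans (hstat e).1, h2.trans (hstat e).2.1, h3.trans (hstat e).2.2, h4,
        fun _ => ?_, fun h => absurd he h⟩
      rw [h5, h4]
      refine and_congr_right fun _ => and_congr_right fun _ => ?_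
      constructor
      · intro h f hf hpf
        rw [hinM, ← hyact f hpf]
        exact h f ⟨hf, he, hpf⟩
      · intro h f hf
        rw [hyact f hf.2.2, ← hinM]
        exact h f hf.1 hf.2.2
    · rw [hinM, hfix e he]
      exact ⟨(hstat e).1, (hstat e).2.1, (hstat e).2.2, Iff.rfl, fun h => absurd h he,
        fun _ => Iff.rfl⟩
  · have hnn : ∀ e, 0 ≤ aliveWeight z e := fun e => by
      rw [aliveWeight]; split_ifs; exacts [by rw [(hstat e).2.1]; exact (hwt e).le, le_rfl]
    have h1 : ∑ e, (if p + 1 ≤ (y₀ e).phases then aliveWeight (phaseLabel H ℓ y₀ (p + 1)) e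
        else 0) ≤ ∑ e, aliveWeight
          (runList (activeGraph H (fun e => (y₀ e).phases) p) (phaseSteps ℓ) y) e := by
      refine Finset.sum_le_sum fun e _ => ?_
      by_cases he : p < (y₀ e).phases
      · rw [if_pos (show p + 1 ≤ _ from he), aliveWeight, aliveWeight, hnext e he]
      · rw [if_neg (show ¬ p + 1 ≤ _ from he), aliveWeight]
        split_ifs
        · rw [(hM3 e).2.1, (hys e).2]; exact (hwt e).le
        · exact le_rfl
    have h2 : ∑ e, aliveWeight y e ≤
        ∑ e, (if p ≤ (y₀ e).phases then aliveWeight z e else 0) := by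
      refine Finset.sum_le_sum fun e _ => ?_
      by_cases he : p < (y₀ e).phases
      · rw [if_pos he.le, aliveWeight, aliveWeight, hyact e he]
      · rw [aliveWeight, hyin e he, if_neg id]
        split_ifs
        exacts [hnn e, le_rfl]
    linarith

open Classical in
/-- The result of all phases: a matching `M` such that only little weight remains uncovered. -/
theorem matchSeq_spec (hℓ : 1 ≤ ℓ) (hH : CoveredByTwoCliques H)
    (hcol : ∀ e, (y₀ e).col < 2 ^ ℓ) (hproper : ∀ e f, H.Adj e f → (y₀ e).col ≠ (y₀ f).col)
    (hwt : ∀ e, 0 < (y₀ e).wt)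
    (hbound : ∀ e, 16 * closedWeight H (fun e => (y₀ e).wt) e ≤ (y₀ e).wt * 2 ^ ℓ)
    (halive : ∀ e, (y₀ e).alive) (hinM : ∀ e, ¬ (y₀ e).inM) :
    ∃ M : E → Prop,
      (∀ e, (labelSeq H (matchStep ℓ) (matchLength ℓ) y₀ (matchLength ℓ (y₀ e)) e).inM ↔ M e) ∧
      (∀ e f, H.Adj e f → M e → ¬ M f) ∧
      ∀ p, ∑ e, (if (y₀ e).phases = p ∧ ¬ M e ∧ ∀ f, H.Adj e f → ¬ M f then (y₀ e).wt else 0) ≤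
        (127 / 128) ^ p * ∑ e, (y₀ e).wt := by
  -- An edge marked alive may have a matched neighbour, but only if the edge stopped before that
  -- neighbour was matched. Newly matched edges are active and alive, so they have no previously
  -- matched neighbours. The potential keeps only the edges that have not stopped before phase `p`.
  have hinv : ∀ p, (∀ e, (phaseLabel H ℓ y₀ p e).col = (y₀ e).col ∧
      (phaseLabel H ℓ y₀ p e).wt = (y₀ e).wt ∧
      (phaseLabel H ℓ y₀ p e).phases = (y₀ e).phases ∧
      ((phaseLabel H ℓ y₀ p e).alive → ¬ (phaseLabel H ℓ y₀ p e).inM ∧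
        ∀ f, H.Adj e f → (phaseLabel H ℓ y₀ p f).inM → (y₀ e).phases < p) ∧
      (¬ (phaseLabel H ℓ y₀ p e).alive → (phaseLabel H ℓ y₀ p e).inM ∨
        ∃ f, H.Adj e f ∧ (phaseLabel H ℓ y₀ p f).inM) ∧
      ∀ f, H.Adj e f → (phaseLabel H ℓ y₀ p e).inM → ¬ (phaseLabel H ℓ y₀ p f).inM) ∧
      ∑ e, (if p ≤ (y₀ e).phases then aliveWeight (phaseLabel H ℓ y₀ p) e else 0) ≤
        (127 / 128) ^ p * ∑ e, (y₀ e).wt := by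
    intro p
    induction p with
    | zero =>
      have h0 : phaseLabel H ℓ y₀ 0 = y₀ := by rw [phaseLabel, Nat.zero_mul]; rfl
      rw [h0]
      refine ⟨fun e => ⟨rfl, rfl, rfl, fun _ => ⟨hinM e, fun f _ h => absurd h (hinM f)⟩,
        fun h => absurd (halive e) h, fun f _ h => absurd h (hinM e)⟩, ?_⟩
      simp [aliveWeight, halive]
    | succ p ih =>
      obtain ⟨ih1, ih2⟩ := ih
      obtain ⟨M, hM1, hM2, hM3, hM4⟩ := phaseLabel_succ_spec hℓ hH hcol hproper hwt hbound p
        (fun e => ⟨(ih1 e).1, (ih1 e).2.1, (ih1 e).2.2.1⟩)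
      have hdecr : ∀ e, (phaseLabel H ℓ y₀ (p + 1) e).alive → (phaseLabel H ℓ y₀ p e).alive := by
        intro e h
        by_cases he : p < (y₀ e).phases
        · exact (((hM3 e).2.2.2.2.1 he).1 h).1
        · exact ((hM3 e).2.2.2.2.2 he).1 h
      have hmono : ∀ e, (phaseLabel H ℓ y₀ p e).inM → (phaseLabel H ℓ y₀ (p + 1) e).inM :=
        fun e h => (hM3 e).2.2.2.1.2 (Or.inl h)
      refine ⟨fun e => ⟨(hM3 e).1, (hM3 e).2.1, (hM3 e).2.2.1, fun hal => ⟨?_, ?_⟩, ?_, ?_⟩, ?_⟩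
      · by_cases he : p < (y₀ e).phases
        · exact (((hM3 e).2.2.2.2.1 he).1 hal).2.1
        · rw [(hM3 e).2.2.2.1]
          rintro (h | h)
          · exact ((ih1 e).2.2.2.1 (hdecr e hal)).1 h
          · exact he (hM1 e h).2
      · intro f hf hin
        by_cases he : p < (y₀ e).phases
        · rcases (hM3 f).2.2.2.1.1 hin with h | h
          · have := ((ih1 e).2.2.2.1 (hdecr e hal)).2 f hf h
            omega
          · exact absurd hin ((((hM3 e).2.2.2.2.1 he).1 hal).2.2 f hf (hM1 f h).2)
        · omega
      · intro hal
        by_cases hal' : (phaseLabel H ℓ y₀ p e).alive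
        · by_cases he : p < (y₀ e).phases
          · rw [(hM3 e).2.2.2.2.1 he] at hal
            by_contra hcon
            push Not at hcon
            exact hal ⟨hal', hcon.1, fun f hf _ => hcon.2 f hf⟩
          · exact absurd (((hM3 e).2.2.2.2.2 he).2 hal') hal
        · exact ((ih1 e).2.2.2.2.1 hal').imp (hmono e)
            fun ⟨f, hf, h⟩ => ⟨f, hf, hmono f h⟩
      · have hnew : ∀ e f, H.Adj e f → M e → ¬ (phaseLabel H ℓ y₀ p f).inM := by
          intro e f hef he hf
          have := ((ih1 e).2.2.2.1 (hM1 e he).1).2 f hef hf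
          have := (hM1 e he).2
          omega
        intro f hf he hfin
        rcases (hM3 e).2.2.2.1.1 he with h | h <;> rcases (hM3 f).2.2.2.1.1 hfin with h' | h'
        · exact (ih1 e).2.2.2.2.2 f hf h h'
        · exact hnew f e hf.symm h' h
        · exact hnew e f hf h h'
        · exact hM2 e f h hf h'
      · refine hM4.trans ?_
        rw [pow_succ, mul_comm (_ ^ p), mul_assoc]
        exact mul_le_mul_of_nonneg_left ih2 (by norm_num)
  obtain ⟨B, hB⟩ : ∃ B, ∀ e, (y₀ e).phases ≤ B :=
    ⟨Finset.univ.sup fun e => (y₀ e).phases, fun e => Finset.le_sup (f := fun e => (y₀ e).phases)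
      (Finset.mem_univ e)⟩
  refine ⟨fun e => (phaseLabel H ℓ y₀ B e).inM, fun e => ?_, fun e f hef he =>
    ((hinv B).1 e).2.2.2.2.2 f hef he, fun p => ?_⟩
  · dsimp only
    rw [phaseLabel_of_le H ℓ y₀ (hB e)]
    rfl
  · refine le_trans (Finset.sum_le_sum fun e _ => ?_) (hinv p).2
    have hnn : 0 ≤ aliveWeight (phaseLabel H ℓ y₀ p) e := by
      rw [aliveWeight]
      split_ifs
      exacts [by rw [((hinv p).1 e).2.1]; exact (hwt e).le, le_rfl]
    split_ifs with h1 h2 h2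
    · obtain ⟨rfl, h3, h4⟩ := h1
      -- The label is frozen once the edge stops, so an edge uncovered at the very end was alive at
      -- its own last phase and is counted in the potential there.
      have hal : (phaseLabel H ℓ y₀ (y₀ e).phases e).alive := by
        rw [← phaseLabel_of_le H ℓ y₀ (hB e)]
        by_contra hcon
        rcases ((hinv B).1 e).2.2.2.2.1 hcon with h | ⟨f, hf, h⟩
        · exact h3 h
        · exact h4 f hf h
      rw [aliveWeight, if_pos hal, ((hinv _).1 e).2.1]
    · exact absurd h1.1.ge h2
    · exact hnn
    · exact le_rfl

end Iteration

/-! ### The complete protocol -/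

/-- The initial label of an edge, from its weight, number of phases and colour. -/
def initLabel (o : (ℝ × ℕ) × ℕ) : Label where
  col := o.2
  wt := o.1.1
  phases := o.1.2
  inM := False
  alive := True
  gain := 0
  expo := none
  colA := 0
  colB := none

/-- The states of the complete protocol. -/
abbrev MatchState : Type :=
  (((ℝ × ℕ) × ℕ × ℕ) × Option (ℕ × (ℕ → Label))) × Option (ℕ × (ℕ → Prop × Prop))

open Classical in
/-- Colour reduction, followed by the phases, and finally a comparison with the neighbours: the
matched and the uncovered elements are selected. -/
noncomputable def matchProtocol (ℓ D : ℕ) : Protocol MatchState Bool :=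
  ((colourReduction (ℝ × ℕ) ℓ D).comp initLabel (matchStep ℓ) (matchLength ℓ) fun s => s.inM).comp
    (fun m => (m, False)) (fun _ s N => (s.1, s.1 ∨ ∀ z ∈ N, ¬ z.1)) (fun _ => 1)
    fun s => decide s.2

/-- The initial states of the complete protocol. -/
noncomputable def matchInit (ℓ : ℕ) (x : ℝ × ℕ) (a : ℕ) : MatchState :=
  (((x, levelOf ℓ a, a), none), none)

theorem phaseSteps_length (ℓ : ℕ) :
    (phaseSteps ℓ).length = 3 + ℓ * (1 + 2 * iterPrime ℓ) := by
  have h : ∀ n, (roundingSteps ℓ n).length = n * (1 + 2 * iterPrime ℓ) := by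
    intro n
    induction n with
    | zero => simp [roundingSteps]
    | succ n ih =>
      simp only [roundingSteps, levelSteps, List.length_append, ih, List.length_map,
        List.length_range, List.length_singleton]
      ring
  simp only [phaseSteps, List.length_append, h, List.length_cons, List.length_nil]
  ring

section MatchProtocol

variable {E : Type*} [Fintype E] {H : SimpleGraph E}

-- The round count is `R` for the colour reduction, one to start the phases, `N` phases, one to
-- start the final stage, and one comparison. That comparison is necessary because edges that
-- stopped early may have been covered afterwards.
open Classical in
theorem matchProtocol_spec {ℓ D : ℕ} (hℓ : 20 ≤ ℓ) (hD : 2 * D ≤ 2 ^ (ℓ / 4)) (hD0 : D ≠ 0)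
    (hdeg : ∀ e, (Finset.univ.filter (H.Adj e)).card ≤ D) (hH : CoveredByTwoCliques H)
    (x : E → ℝ × ℕ) (a : E → ℕ) (ha : ∀ e f, H.Adj e f → a e ≠ a f)
    (hwt : ∀ e, 0 < (x e).1)
    (hbound : ∀ e, 16 * closedWeight H (fun e => (x e).1) e ≤ (x e).1 * 2 ^ ℓ)
    {R N : ℕ} (hR : ∀ e, levelOf ℓ (a e) ≤ R) (hN : ∀ e, (x e).2 ≤ N) :
    ∃ M : E → Prop,
      (∀ e, (matchProtocol ℓ D).out ((matchProtocol ℓ D).run H (fun e => matchInit ℓ (x e) (a e))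
        (R + 1 + N * (phaseSteps ℓ).length + 1 + 1) e) =
          some (decide (M e ∨ ∀ f, H.Adj e f → ¬ M f))) ∧
      (∀ e f, H.Adj e f → M e → ¬ M f) ∧
      ∀ p, ∑ e, (if (x e).2 = p ∧ ¬ M e ∧ ∀ f, H.Adj e f → ¬ M f then (x e).1 else 0) ≤
        (127 / 128) ^ p * ∑ e, (x e).1 := by
  obtain ⟨col, hout, hcol, hproper⟩ := colourReduction_out H hℓ hD hD0 hdeg x a ha hR
  obtain ⟨M, hM1, hM2, hM3⟩ := matchSeq_spec (H := H) (y₀ := fun e => initLabel (x e, col e))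
    (ℓ := ℓ) (by omega) hH hcol hproper hwt hbound (fun _ => trivial) (fun _ h => h)
  refine ⟨M, fun e => ?_, hM2, hM3⟩
  have h2 := (colourReduction (ℝ × ℕ) ℓ D).out_comp_run initLabel (matchStep ℓ) (matchLength ℓ)
    (fun s => s.inM) H (R := R) (B := N * (phaseSteps ℓ).length) hout
    (fun e => Nat.mul_le_mul_right _ (hN e))
  simp only [hM1] at h2
  have h3 := ((colourReduction (ℝ × ℕ) ℓ D).comp initLabel (matchStep ℓ) (matchLength ℓ)
    fun s => s.inM).out_comp_run (fun m => (m, False))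
    (fun _ (s : Prop × Prop) N => (s.1, s.1 ∨ ∀ z ∈ N, ¬ z.1)) (fun _ => 1)
    (fun s => decide s.2) H (B := 1) h2 (fun _ => le_rfl) e
  refine h3.trans ?_
  rw [labelSeq_succ]
  simp [labelSeq]

end MatchProtocol

/-! ### Edge dominating sets -/

theorem coveredByTwoCliques_lineGraph {V : Type*} {G : SimpleGraph V} :
    CoveredByTwoCliques G.lineGraph := by
  rintro ⟨e, he⟩
  induction e with
  | h u v =>
    refine ⟨{f | u ∈ (f : Sym2 V)}, {f | v ∈ (f : Sym2 V)}, ?_, ?_, ?_⟩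
    · intro f hf g hg hne
      exact SimpleGraph.lineGraph_adj_iff_exists.2 ⟨hne, u, hf, hg⟩
    · intro f hf g hg hne
      exact SimpleGraph.lineGraph_adj_iff_exists.2 ⟨hne, v, hf, hg⟩
    · intro f hf
      obtain ⟨-, w, hw, hw'⟩ := SimpleGraph.lineGraph_adj_iff_exists.1 hf
      rcases Sym2.mem_iff.1 hw with rfl | rfl
      exacts [Or.inl hw', Or.inr hw']

section EdgeDominatingSets

variable {V : Type*} [Fintype V] [DecidableEq V] {G : SimpleGraph V} [DecidableRel G.Adj]

/-- Every edge meets one of the at most `2|D|` endpoints of `D`, and the edges at one vertex weigh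
at most `t`. It is used with constant weights, with the indicator of a matching, and with the
weights `2⁻ˢ`. -/
theorem IsEdgeDominatingSet.sum_le {D : Finset (Sym2 V)} (hD : IsEdgeDominatingSet G D)
    (g : Sym2 V → ℝ) (hg : ∀ e, 0 ≤ g e) {t : ℝ}
    (ht : ∀ v, ∑ e ∈ G.edgeFinset.filter (fun e => v ∈ e), g e ≤ t) :
    ∑ e ∈ G.edgeFinset, g e ≤ 2 * t * D.card := by
  classical
  have h1 : ∑ e ∈ G.edgeFinset, g e ≤
      ∑ e ∈ G.edgeFinset, ∑ d ∈ D, if EdgesMeet e d then g e else 0 := by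
    refine Finset.sum_le_sum fun e he => ?_
    obtain ⟨d, hd, hed⟩ := hD.2 e he
    refine le_trans ?_ (Finset.single_le_sum
      (f := fun d => if EdgesMeet e d then g e else 0) (fun d _ => ?_) hd)
    · rw [if_pos hed]
    · split_ifs
      exacts [hg e, le_rfl]
  refine h1.trans ?_
  rw [Finset.sum_comm, mul_comm, ← nsmul_eq_mul, ← Finset.sum_const]
  refine Finset.sum_le_sum fun d _ => ?_
  induction d with
  | h u v =>
    rw [two_mul]
    refine le_trans ?_ (add_le_add (ht u) (ht v))
    rw [Finset.sum_filter, Finset.sum_filter, ← Finset.sum_add_distrib]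
    refine Finset.sum_le_sum fun e _ => ?_
    have := hg e
    by_cases hm : EdgesMeet e s(u, v)
    · rw [if_pos hm]
      obtain ⟨w, hw, hw'⟩ := hm
      rcases Sym2.mem_iff.1 hw' with rfl | rfl
      · rw [if_pos hw]
        split_ifs <;> linarith
      · rw [if_pos hw]
        split_ifs <;> linarith
    · rw [if_neg hm]
      split_ifs <;> linarith

theorem card_filter_mem_edgeFinset (v : V) :
    (G.edgeFinset.filter fun e => v ∈ e).card = G.degree v := by
  rw [← G.card_incidenceFinset_eq_degree v, G.incidenceFinset_eq_filter v]

theorem IsEdgeDominatingSet.card_edgeFinset_le {D : Finset (Sym2 V)}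
    (hD : IsEdgeDominatingSet G D) :
    (G.edgeFinset.card : ℝ) ≤ 2 * G.maxDegree * D.card := by
  have h := hD.sum_le (fun _ => 1) (fun _ => zero_le_one) (t := G.maxDegree) (fun v => by
    rw [Finset.sum_const, card_filter_mem_edgeFinset, nsmul_eq_mul, mul_one]
    exact_mod_cast G.degree_le_maxDegree v)
  simpa using h

theorem IsEdgeDominatingSet.card_matching_le {D M : Finset (Sym2 V)}
    (hD : IsEdgeDominatingSet G D) (hM : IsEdgeMatching G M) : (M.card : ℝ) ≤ 2 * D.card := by
  have h := hD.sum_le (fun e => if e ∈ M then 1 else 0)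
    (fun e => by split_ifs; exacts [zero_le_one, le_rfl]) (t := 1) (fun v => by
      rw [← Finset.sum_filter, Finset.sum_const, nsmul_eq_mul, mul_one]
      refine Nat.cast_le_one.2 (Finset.card_le_one.2 fun e he f hf => ?_)
      simp only [Finset.mem_filter] at he hf
      by_contra hef
      exact hM.2 e he.2 f hf.2 hef ⟨v, he.1.2, hf.1.2⟩)
  rw [← Finset.sum_filter, Finset.filter_mem_eq_inter, Finset.inter_eq_right.2 hM.1,
    Finset.sum_const, nsmul_eq_mul, mul_one, mul_one] at h
  exact h

theorem isEdgeDominatingSet_union {M : Finset (Sym2 V)} (hM : IsEdgeMatching G M) :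
    IsEdgeDominatingSet G (M ∪ (G.edgeFinset \ coveredEdges G M)) := by
  refine ⟨Finset.union_subset hM.1 Finset.sdiff_subset, fun e he => ?_⟩
  by_cases hc : e ∈ coveredEdges G M
  · simp only [coveredEdges, Finset.mem_filter] at hc
    obtain ⟨e', he', hmeet⟩ := hc.2
    exact ⟨e', Finset.mem_union_left _ he', hmeet⟩
  · refine ⟨e, Finset.mem_union_right _ (Finset.mem_sdiff.2 ⟨he, hc⟩), ?_⟩
    induction e with
    | h u v => exact ⟨u, Sym2.mem_mk_left u v, Sym2.mem_mk_left u v⟩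

theorem isApproxMinimumEdgeDominatingSet_union {M : Finset (Sym2 V)} (hM : IsEdgeMatching G M)
    {ε : ℝ} (hU : ∀ D, IsEdgeDominatingSet G D →
      ((G.edgeFinset \ coveredEdges G M).card : ℝ) ≤ ε * D.card) :
    IsApproxMinimumEdgeDominatingSet G (2 + ε) (M ∪ (G.edgeFinset \ coveredEdges G M)) := by
  refine ⟨isEdgeDominatingSet_union hM, fun D' hD' => ?_⟩
  have h1 := hD'.1.card_matching_le hM
  have h2 := hU D' hD'.1
  have h3 : ((M ∪ (G.edgeFinset \ coveredEdges G M)).card : ℝ) ≤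
      M.card + (G.edgeFinset \ coveredEdges G M).card := by
    exact_mod_cast Finset.card_union_le _ _
  linarith

open Classical in
theorem card_lineGraph_adj_le [Fintype G.edgeSet] (e : G.edgeSet) :
    (Finset.univ.filter (G.lineGraph.Adj e)).card ≤ 2 * G.maxDegree := by
  rw [← Finset.card_map (Function.Embedding.subtype _)]
  obtain ⟨e, he⟩ := e
  induction e with
  | h u v =>
    have hsub : (Finset.univ.filter (G.lineGraph.Adj ⟨s(u, v), he⟩)).map
        (Function.Embedding.subtype _) ⊆
        (G.edgeFinset.filter fun e => u ∈ e) ∪ G.edgeFinset.filter fun e => v ∈ e := by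
      intro f hf
      obtain ⟨f, hf', rfl⟩ := Finset.mem_map.1 hf
      obtain ⟨-, w, hw, hw'⟩ :=
        SimpleGraph.lineGraph_adj_iff_exists.1 (Finset.mem_filter.1 hf').2
      have hfe : (f : Sym2 V) ∈ G.edgeFinset := SimpleGraph.mem_edgeFinset.2 f.2
      rw [Finset.mem_union, Finset.mem_filter, Finset.mem_filter]
      rcases Sym2.mem_iff.1 hw with rfl | rfl
      exacts [Or.inl ⟨hfe, hw'⟩, Or.inr ⟨hfe, hw'⟩]
    refine (Finset.card_le_card hsub).trans ((Finset.card_union_le _ _).trans ?_)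
    have h : ∀ v, (G.edgeFinset.filter fun e => v ∈ e).card = G.degree v := fun v => by
      convert card_filter_mem_edgeFinset (G := G) v
    rw [h, h]
    have := G.degree_le_maxDegree u
    have := G.degree_le_maxDegree v
    omega

end EdgeDominatingSets

/-! ### Weights, numbers of phases and identifiers of the edges -/

/-- An identifier of an unordered pair. -/
def pairId (i j : ℕ) : ℕ := Nat.pair (min i j) (max i j)

theorem pairId_comm (i j : ℕ) : pairId i j = pairId j i := by
  rw [pairId, pairId, min_comm, max_comm]

theorem eq_of_pairId_eq {i j i' j' : ℕ} (h : pairId i j = pairId i' j') :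
    i = i' ∧ j = j' ∨ i = j' ∧ j = i' := by
  obtain ⟨h1, h2⟩ := Nat.pair_eq_pair.1 h
  omega

theorem pairId_le {n c i j : ℕ} (hn : 2 ≤ n) (hi : i ≤ n ^ c) (hj : j ≤ n ^ c) :
    pairId i j ≤ n ^ (2 * c + 2) := by
  have h1 := Nat.pair_lt_max_add_one_sq (min i j) (max i j)
  have h2 : max (min i j) (max i j) + 1 ≤ n ^ (c + 1) := by
    have : 1 ≤ n ^ c := Nat.one_le_pow _ _ (by omega)
    rw [pow_succ]
    have : n ^ c * 2 ≤ n ^ c * n := Nat.mul_le_mul_left _ hn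
    omega
  have h3 := Nat.pow_le_pow_left h2 2
  rw [← pow_mul, show (c + 1) * 2 = 2 * c + 2 by ring] at h3
  exact h1.le.trans h3

/-- The exponent `s` for which `2 ^ s` is about `8 * d / ε`. -/
noncomputable def scale (ε : ℝ) (d : ℕ) : ℕ := ⌈Real.logb 2 (8 * d / ε)⌉₊

theorem le_two_pow_ceil_logb {x : ℝ} (hx : 0 ≤ x) : x ≤ 2 ^ ⌈Real.logb 2 x⌉₊ := by
  rcases hx.eq_or_lt with rfl | hx
  · positivity
  · calc x = (2 : ℝ) ^ Real.logb 2 x := (Real.rpow_logb two_pos (by norm_num) hx).symm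
      _ ≤ (2 : ℝ) ^ (⌈Real.logb 2 x⌉₊ : ℝ) :=
        Real.rpow_le_rpow_of_exponent_le one_le_two (Nat.le_ceil _)
      _ = 2 ^ ⌈Real.logb 2 x⌉₊ := Real.rpow_natCast _ _

theorem le_two_pow_scale {ε : ℝ} (hε : 0 < ε) (d : ℕ) : (d : ℝ) ≤ ε / 8 * 2 ^ scale ε d := by
  have h : 8 * (d : ℝ) / ε ≤ 2 ^ scale ε d := le_two_pow_ceil_logb (by positivity)
  rw [div_le_iff₀ hε] at h
  linarith

theorem scale_le_of_le {ε : ℝ} (hε : 0 < ε) {d n : ℕ} (h : 8 * (d : ℝ) / ε ≤ 2 ^ n) :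
    scale ε d ≤ n := by
  rw [scale, Nat.ceil_le]
  rcases Nat.eq_zero_or_pos d with rfl | hd
  · simp
  · rw [Real.logb_le_iff_le_rpow one_lt_two (by positivity), Real.rpow_natCast]
    exact h

theorem scale_le {ε : ℝ} (hε : 0 < ε) {d m : ℕ} (h : d ≤ m) :
    (scale ε d : ℝ) ≤ 5 * max 1 (Real.logb 2 (m / ε)) := by
  have hm := le_max_left 1 (Real.logb 2 (m / ε))
  have hm' := le_max_right 1 (Real.logb 2 (m / ε))
  rcases Nat.eq_zero_or_pos d with rfl | hd
  · simp only [scale, Nat.cast_zero, mul_zero, zero_div, Real.logb_zero, Nat.ceil_zero]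
    linarith
  · have hd' : (0 : ℝ) < d := by exact_mod_cast hd
    have hdm : (d : ℝ) ≤ m := by exact_mod_cast h
    have h1 : Real.logb 2 (8 * d / ε) ≤ 3 + max 1 (Real.logb 2 (m / ε)) := by
      rw [mul_div_assoc, Real.logb_mul (by norm_num) (by positivity)]
      have h8 : Real.logb 2 8 = 3 := by
        rw [show (8 : ℝ) = 2 ^ (3 : ℕ) by norm_num, Real.logb_pow, Real.logb_self_eq_one one_lt_two]
        norm_num
      rw [h8]
      have : Real.logb 2 (d / ε) ≤ Real.logb 2 (m / ε) :=
        Real.logb_le_logb_of_le one_lt_two (by positivity) (by gcongr)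
      linarith
    have h2 : scale ε d ≤ ⌈3 + max 1 (Real.logb 2 (m / ε))⌉₊ := Nat.ceil_mono h1
    have h3 := Nat.ceil_lt_add_one (show 0 ≤ 3 + max 1 (Real.logb 2 (m / ε)) by linarith)
    have h4 : (scale ε d : ℝ) ≤ ⌈3 + max 1 (Real.logb 2 (m / ε))⌉₊ := by exact_mod_cast h2
    linarith

/-- An upper bound on the logarithm of the maximum degree. -/
noncomputable def logBound (κ L : ℝ) : ℕ := ⌈κ * L⌉₊

/-- The weight and the number of phases of an edge whose endpoints have the degrees `d` and `d'`. -/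
noncomputable def edgeData (κ ε L : ℝ) (d d' : ℕ) : ℝ × ℕ :=
  -- 128 phases halve the remaining weight, and the summands in brackets stand for the factors `Δ`,
  -- `4` and `1/ε`.
  if ε ≤ 1 then (1, 128 * (logBound κ L + 2 + ⌈Real.logb 2 (1 / ε)⌉₊))
  -- 384 phases gain a factor 8: a factor 2 per unit of scale offsets the small weight, and 4
  -- remains for the sum over all scales.
  else ((1 / 2) ^ max (scale ε d) (scale ε d'), 384 * max (scale ε d) (scale ε d'))

theorem edgeData_comm (κ ε L : ℝ) (d d' : ℕ) : edgeData κ ε L d d' = edgeData κ ε L d' d := by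
  rw [edgeData, edgeData, max_comm]

theorem edgeData_fst_pos (κ ε L : ℝ) (d d' : ℕ) : 0 < (edgeData κ ε L d d').1 := by
  rw [edgeData]
  split_ifs
  exacts [one_pos, by positivity]

theorem edgeData_fst_le_one (κ ε L : ℝ) (d d' : ℕ) : (edgeData κ ε L d d').1 ≤ 1 := by
  rw [edgeData]
  split_ifs
  exacts [le_rfl, pow_le_one₀ (by norm_num) (by norm_num)]

theorem le_edgeData_fst {κ ε L : ℝ} {d d' : ℕ} (hd : d ≤ 2 ^ logBound κ L)
    (hd' : d' ≤ 2 ^ logBound κ L) : (1 / 2) ^ (logBound κ L + 3) ≤ (edgeData κ ε L d d').1 := by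
  rw [edgeData]
  split_ifs with hε
  · exact pow_le_one₀ (by norm_num) (by norm_num)
  · refine pow_le_pow_of_le_one (by norm_num) (by norm_num) ?_
    have h : ∀ d : ℕ, d ≤ 2 ^ logBound κ L → scale ε d ≤ logBound κ L + 3 := by
      intro d hd
      refine scale_le_of_le (by linarith) ?_
      have hd' : (d : ℝ) ≤ 2 ^ logBound κ L := by exact_mod_cast hd
      rw [div_le_iff₀ (by linarith), pow_add]
      have : (0 : ℝ) < 2 ^ logBound κ L := by positivity
      nlinarith
    exact max_le (h d hd) (h d' hd')

theorem edgeData_snd_le {κ ε L : ℝ} (hε : 0 < ε) {d d' m : ℕ} (hd : d ≤ m) (hd' : d' ≤ m)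
    (hm : 1 ≤ m) {K : ℝ} (hK : 1 ≤ K) (hL : logBound κ L ≤ K * Real.logb 2 m) :
    ((edgeData κ ε L d d').2 : ℝ) ≤ 2000 * (K + 4) * max 1 (Real.logb 2 (m / ε)) := by
  have h1 := le_max_left 1 (Real.logb 2 (m / ε))
  have h2 := le_max_right 1 (Real.logb 2 (m / ε))
  have h3 := scale_le hε hd
  have h4 := scale_le hε hd'
  set μ := max 1 (Real.logb 2 (m / ε))
  have hKμ : μ ≤ K * μ := le_mul_of_one_le_left (by linarith) hK
  have hm' : (1 : ℝ) ≤ m := by exact_mod_cast hm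
  rw [edgeData]
  split_ifs with h
  · have h5 : Real.logb 2 m ≤ μ := by
      refine le_trans (Real.logb_le_logb_of_le one_lt_two (by linarith) ?_) h2
      rw [le_div_iff₀ hε]
      nlinarith
    have h6 : Real.logb 2 (1 / ε) ≤ μ :=
      le_trans (Real.logb_le_logb_of_le one_lt_two (by positivity) (by gcongr)) h2
    have h7 : (⌈Real.logb 2 (1 / ε)⌉₊ : ℝ) ≤ ⌈μ⌉₊ := by exact_mod_cast Nat.ceil_mono h6
    have h8 := Nat.ceil_lt_add_one (show 0 ≤ μ by linarith)
    have h9 : K * Real.logb 2 m ≤ K * μ := by gcongr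
    push_cast
    linarith
  · push_cast
    have := max_le h3 h4
    linarith

theorem pow_mul_le_half_pow (m : ℕ) : (127 / 128 : ℝ) ^ (128 * m) ≤ (1 / 2) ^ m := by
  rw [pow_mul]
  have h : (127 / 128 : ℝ) ^ 128 ≤ 1 / 2 := by norm_num
  exact pow_le_pow_left₀ (by positivity) h m

/-! ### From uncovered weight to the number of uncovered edges. -/

section Uncovered

variable {V : Type*} [Fintype V] [DecidableEq V] {G : SimpleGraph V} [DecidableRel G.Adj]

/-- At each vertex the weights `2⁻ˢ` sum to at most `ε/8`, so the total weight is at most `ε/4 |D|`.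
At scale `p` at most `8⁻ᵖ 2ᵖ = 4⁻ᵖ` times this weight counts the uncovered edges, and summing over
`p` costs less than a factor 2. -/
theorem card_uncovered_le_of_scale {U : Finset (Sym2 V)} (s : Sym2 V → ℕ) {ε : ℝ} (hε : 0 < ε)
    (hs : ∀ e, ∀ v ∈ e, (G.degree v : ℝ) ≤ ε / 8 * 2 ^ s e)
    (hsum : ∀ p, ∑ e ∈ U.filter (fun e => s e = p), (1 / 2 : ℝ) ^ s e ≤
      (1 / 8) ^ p * ∑ e ∈ G.edgeFinset, (1 / 2 : ℝ) ^ s e)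
    {D : Finset (Sym2 V)} (hD : IsEdgeDominatingSet G D) : (U.card : ℝ) ≤ ε / 2 * D.card := by
  have hW : ∑ e ∈ G.edgeFinset, (1 / 2 : ℝ) ^ s e ≤ 2 * (ε / 8) * D.card := by
    refine hD.sum_le _ (fun e => by positivity) fun v => ?_
    rcases Nat.eq_zero_or_pos (G.degree v) with h0 | hpos
    · rw [← card_filter_mem_edgeFinset, Finset.card_eq_zero] at h0
      rw [h0, Finset.sum_empty]
      positivity
    · have hv : (0 : ℝ) < G.degree v := by exact_mod_cast hpos
      calc ∑ e ∈ G.edgeFinset.filter (fun e => v ∈ e), (1 / 2 : ℝ) ^ s e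
          ≤ ∑ e ∈ G.edgeFinset.filter (fun e => v ∈ e), ε / 8 / G.degree v := by
            refine Finset.sum_le_sum fun e he => ?_
            rw [le_div_iff₀ hv, one_div, inv_pow, inv_mul_le_iff₀ (by positivity), mul_comm]
            exact hs e v (Finset.mem_filter.1 he).2
        _ = ε / 8 := by
            rw [Finset.sum_const, card_filter_mem_edgeFinset, nsmul_eq_mul]
            field_simp
  set W := ∑ e ∈ G.edgeFinset, (1 / 2 : ℝ) ^ s e with hWdef
  have hW0 : 0 ≤ W := Finset.sum_nonneg fun e _ => by positivity
  have h1 : ∀ p, ((U.filter fun e => s e = p).card : ℝ) ≤ (1 / 4) ^ p * W := by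
    intro p
    have h2 := hsum p
    rw [Finset.sum_congr rfl (g := fun _ => (1 / 2 : ℝ) ^ p)
      (fun e he => by rw [(Finset.mem_filter.1 he).2]), Finset.sum_const, nsmul_eq_mul] at h2
    have h3 := mul_le_mul_of_nonneg_right h2 (show (0 : ℝ) ≤ 2 ^ p by positivity)
    rw [mul_assoc, ← mul_pow, mul_right_comm, ← mul_pow] at h3
    norm_num at h3 ⊢
    exact h3
  have h4 : (U.card : ℝ) ≤ ∑ p ∈ Finset.range (U.sup s + 1), (1 / 4 : ℝ) ^ p * W := by
    have h5 : U.card = ∑ p ∈ Finset.range (U.sup s + 1), (U.filter fun e => s e = p).card :=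
      Finset.card_eq_sum_card_fiberwise fun e he =>
        Finset.mem_coe.2 (Finset.mem_range.2 (Nat.lt_succ_of_le (Finset.le_sup he)))
    rw [h5, Nat.cast_sum]
    exact Finset.sum_le_sum fun p _ => h1 p
  have h6 : ∑ p ∈ Finset.range (U.sup s + 1), (1 / 4 : ℝ) ^ p * W ≤ 2 * W := by
    rw [← Finset.sum_mul]
    refine mul_le_mul_of_nonneg_right (le_trans (Finset.sum_le_sum fun p _ => ?_)
      (sum_geometric_two_le (U.sup s + 1))) hW0
    exact pow_le_pow_left₀ (by norm_num) (by norm_num) p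
  linarith

theorem exists_isEdgeMatching (M : G.edgeSet → Prop)
    (hM : ∀ e f, G.lineGraph.Adj e f → M e → ¬ M f) :
    ∃ F : Finset (Sym2 V), IsEdgeMatching G F ∧ (∀ e : G.edgeSet, (e : Sym2 V) ∈ F ↔ M e) ∧
      ∀ e : G.edgeSet, (e : Sym2 V) ∈ G.edgeFinset \ coveredEdges G F ↔
        ¬ M e ∧ ∀ f, G.lineGraph.Adj e f → ¬ M f := by
  classical
  have hF : ∀ e : G.edgeSet,
      (e : Sym2 V) ∈ G.edgeFinset.filter (fun e => ∃ h : e ∈ G.edgeSet, M ⟨e, h⟩) ↔ M e := by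
    intro e
    rw [Finset.mem_filter, SimpleGraph.mem_edgeFinset]
    exact ⟨fun h => h.2.2, fun h => ⟨e.2, e.2, h⟩⟩
  generalize hFdef : G.edgeFinset.filter (fun e => ∃ h : e ∈ G.edgeSet, M ⟨e, h⟩) = F at hF
  have hFE : F ⊆ G.edgeFinset := hFdef ▸ Finset.filter_subset _ _
  refine ⟨F, ⟨hFE, fun e he f hf hne hmeet => ?_⟩, hF, fun e => ?_⟩
  · have he' := SimpleGraph.mem_edgeFinset.1 (hFE he)
    have hf' := SimpleGraph.mem_edgeFinset.1 (hFE hf)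
    obtain ⟨v, hv, hv'⟩ := hmeet
    exact hM ⟨e, he'⟩ ⟨f, hf'⟩ (SimpleGraph.lineGraph_adj_iff_exists.2
      ⟨fun h => hne (congrArg Subtype.val h), v, hv, hv'⟩) ((hF ⟨e, he'⟩).1 he)
      ((hF ⟨f, hf'⟩).1 hf)
  · have heE : (e : Sym2 V) ∈ G.edgeFinset := SimpleGraph.mem_edgeFinset.2 e.2
    simp only [coveredEdges, Finset.mem_sdiff, Finset.mem_filter, heE, true_and, not_exists,
      not_and]
    constructor
    · refine fun h => ⟨fun hMe => ?_, fun f hef hMf => ?_⟩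
      · obtain ⟨e, he⟩ := e
        induction e with
        | h u v =>
          exact h _ ((hF _).2 hMe) ⟨u, Sym2.mem_mk_left u v, Sym2.mem_mk_left u v⟩
      · exact h f ((hF f).2 hMf) (SimpleGraph.lineGraph_adj_iff_exists.1 hef).2
    · rintro ⟨h1, h2⟩ f hf hmeet
      have hf' := SimpleGraph.mem_edgeFinset.1 (hFE hf)
      have hMf := (hF ⟨f, hf'⟩).1 hf
      by_cases hef : e = ⟨f, hf'⟩
      · exact h1 (hef ▸ hMf)
      · exact h2 _ (SimpleGraph.lineGraph_adj_iff_exists.2 ⟨hef, hmeet⟩) hMf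

end Uncovered

/-! ### The algorithm -/

/-- The parameter `ℓ` of the algorithm. -/
noncomputable def levelParam (c : ℕ) (κ L : ℝ) : ℕ := 8 * c + 8 * logBound κ L + 64

/-- The deterministic algorithm for almost maximal matchings and edge dominating sets. -/
noncomputable def edgeDominatingSetAlgorithm (c : ℕ) (κ ε : ℝ) : LocalAlgorithm :=
  Protocol.toLocal (fun L => matchProtocol (levelParam c κ L) (2 ^ (logBound κ L + 1)))
    fun L u v => matchInit (levelParam c κ L) (edgeData κ ε L u.2 v.2) (pairId u.1 v.1)

section Algorithm

variable {V : Type*} [Fintype V] {G : SimpleGraph V} [DecidableRel G.Adj]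

variable (G) in
/-- The weight and the number of phases of an edge. -/
noncomputable def edgeLabel (κ ε L : ℝ) : Sym2 V → ℝ × ℕ :=
  Sym2.lift ⟨fun u v => edgeData κ ε L (G.degree u) (G.degree v), fun _ _ => edgeData_comm ..⟩

/-- The identifier of an edge. -/
def edgeId (ident : V → ℕ) : Sym2 V → ℕ :=
  Sym2.lift ⟨fun u v => pairId (ident u) (ident v), fun _ _ => pairId_comm ..⟩

theorem edgeId_injective {V : Type*} {ident : V → ℕ} (h : Function.Injective ident) :
    Function.Injective (edgeId ident) := by
  intro e f
  induction e with
  | h u v =>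
    induction f with
    | h u' v' =>
      intro hef
      have hef' : pairId (ident u) (ident v) = pairId (ident u') (ident v') := hef
      rcases eq_of_pairId_eq hef' with ⟨h1, h2⟩ | ⟨h1, h2⟩
      · rw [h h1, h h2]
      · rw [h h1, h h2, Sym2.eq_swap]

theorem edgeId_le {V : Type*} [Fintype V] {G : SimpleGraph V} {ident : V → ℕ} {c : ℕ} (h : ∀ v, ident v ≤ Fintype.card V ^ c)
    (e : G.edgeSet) : edgeId ident e ≤ Fintype.card V ^ (2 * c + 2) := by
  obtain ⟨e, he⟩ := e
  induction e with
  | h u v =>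
    have hne : u ≠ v := G.ne_of_adj he
    exact pairId_le (Fintype.one_lt_card_iff.2 ⟨u, v, hne⟩) (h u) (h v)

/-- Ensures that the initial exponents are at most `ℓ`. With `B = logBound κ L`, a closed
neighbourhood weighs at most `2 ^ (B + 2)` and an edge at least `2 ^ -(B + 3)`, so `ℓ ≥ 2B + 9` is
enough. -/
theorem sixteen_mul_closedWeight_edgeLabel_le [Fintype G.edgeSet] {κ ε L : ℝ} (c : ℕ)
    (hΔ : G.maxDegree ≤ 2 ^ logBound κ L) (e : G.edgeSet) :
    16 * closedWeight G.lineGraph (fun e => (edgeLabel G κ ε L e).1) e ≤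
      (edgeLabel G κ ε L e).1 * 2 ^ levelParam c κ L := by
  classical
  have hle : ∀ e, (edgeLabel G κ ε L e).1 ≤ 1 := by
    intro e
    induction e with
    | h u v => exact edgeData_fst_le_one ..
  have hge : (1 / 2) ^ (logBound κ L + 3) ≤ (edgeLabel G κ ε L e).1 := by
    obtain ⟨e, he⟩ := e
    induction e with
    | h u v =>
      exact le_edgeData_fst ((G.degree_le_maxDegree u).trans hΔ)
        ((G.degree_le_maxDegree v).trans hΔ)
  have hcard : closedWeight G.lineGraph (fun e => (edgeLabel G κ ε L e).1) e ≤
      2 ^ (logBound κ L + 2) := by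
    calc closedWeight G.lineGraph (fun e => (edgeLabel G κ ε L e).1) e
        ≤ closedWeight G.lineGraph (fun _ => 1) e := closedWeight_mono (fun e : G.edgeSet => hle e) e
      _ = 1 + (Finset.univ.filter (G.lineGraph.Adj e)).card := by
          rw [closedWeight, Finset.sum_boole]
      _ ≤ 1 + 2 * 2 ^ logBound κ L := by
          have h1 := card_lineGraph_adj_le e
          have h2 : (Finset.univ.filter (G.lineGraph.Adj e)).card ≤ 2 * 2 ^ logBound κ L := by
            refine le_trans ?_ (h1.trans (Nat.mul_le_mul_left 2 hΔ))
            exact le_of_eq (by congr)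
          have h3 : ((Finset.univ.filter (G.lineGraph.Adj e)).card : ℝ) ≤
            2 * 2 ^ logBound κ L := by exact_mod_cast h2
          linarith
      _ ≤ 2 ^ (logBound κ L + 2) := by
          rw [pow_add]
          have : (1 : ℝ) ≤ 2 ^ logBound κ L := one_le_pow₀ one_le_two
          linarith
  calc 16 * closedWeight G.lineGraph (fun e => (edgeLabel G κ ε L e).1) e
      ≤ 16 * 2 ^ (logBound κ L + 2) := by gcongr
    _ = (1 / 2) ^ (logBound κ L + 3) * 2 ^ (2 * logBound κ L + 9) := by
        rw [show 2 * logBound κ L + 9 = (logBound κ L + 3) + (logBound κ L + 6) by ring,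
          pow_add 2 (logBound κ L + 3), ← mul_assoc, ← mul_pow, pow_add 2 _ 2, pow_add 2 _ 6]
        norm_num
        ring
    _ ≤ (1 / 2) ^ (logBound κ L + 3) * 2 ^ levelParam c κ L := by
        refine mul_le_mul_of_nonneg_left (pow_le_pow_right₀ one_le_two ?_) (by positivity)
        rw [levelParam]
        omega
    _ ≤ (edgeLabel G κ ε L e).1 * 2 ^ levelParam c κ L := by gcongr

theorem edgeDominatingSetAlgorithm_spec [DecidableEq V] {c : ℕ} {κ ε L : ℝ}
    (ports : PortNumbering G) {ident : V → ℕ} (hinj : Function.Injective ident)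
    (hid : ∀ v, ident v ≤ Fintype.card V ^ c) (hL : 0 < L)
    (hΔ : G.maxDegree ≤ 2 ^ logBound κ L) {N : ℕ}
    (hN : ∀ u v, (edgeData κ ε L (G.degree u) (G.degree v)).2 ≤ N) :
    ∃ F : Finset (Sym2 V), IsEdgeMatching G F ∧
      (edgeDominatingSetAlgorithm c κ ε).ComputesIn ports ident L
        (logStar (Fintype.card V) + 1 + N * (phaseSteps (levelParam c κ L)).length + 1 + 1 + 1)
        (F ∪ (G.edgeFinset \ coveredEdges G F)) ∧
      ∀ p, ∑ e ∈ (G.edgeFinset \ coveredEdges G F).filter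
          (fun e => (edgeLabel G κ ε L e).2 = p), (edgeLabel G κ ε L e).1 ≤
        (127 / 128) ^ p * ∑ e ∈ G.edgeFinset, (edgeLabel G κ ε L e).1 := by
  classical
  have hℓ : 20 ≤ levelParam c κ L := by rw [levelParam]; omega
  obtain ⟨M, hout, hM, hsum⟩ := matchProtocol_spec (H := G.lineGraph) (ℓ := levelParam c κ L)
    (D := 2 ^ (logBound κ L + 1)) hℓ
    (by
      rw [← pow_succ']
      refine Nat.pow_le_pow_right two_pos ?_
      rw [levelParam]
      omega)
    (by positivity)
    (fun e => by
      refine le_trans (le_of_eq (by congr)) ((card_lineGraph_adj_le e).trans ?_)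
      rw [pow_succ']
      exact Nat.mul_le_mul_left 2 hΔ)
    coveredByTwoCliques_lineGraph (fun e : G.edgeSet => edgeLabel G κ ε L e)
    (fun e : G.edgeSet => edgeId ident e)
    (fun e f hef h => (SimpleGraph.lineGraph_adj_iff_exists.1 hef).1
      (Subtype.ext (edgeId_injective hinj h)))
    (fun e => by
      obtain ⟨e, he⟩ := e
      induction e with
      | h u v => exact edgeData_fst_pos ..)
    (sixteen_mul_closedWeight_edgeLabel_le c hΔ)
    (R := logStar (Fintype.card V)) (N := N)
    (fun e => levelOf_le_logStar (k := 2 * c + 2) (by omega) (by rw [levelParam]; omega)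
      (edgeId_le hid e))
    (fun e => by
      obtain ⟨e, he⟩ := e
      induction e with
      | h u v => exact hN u v)
  obtain ⟨F, hF, hFM, hFU⟩ := exists_isEdgeMatching M hM
  refine ⟨F, hF, ?_, fun p => ?_⟩
  · refine Protocol.toLocal_computesIn _ _ ports ident hL _ (fun v p => rfl) _ _ _ hout fun e => ?_
    rw [Finset.mem_union, hFM, hFU, decide_eq_true_iff]
    tauto
  · refine le_trans (le_of_eq ?_) ((hsum p).trans (le_of_eq ?_))
    · rw [← Finset.sum_filter]
      refine Eq.trans (Finset.sum_congr (Finset.ext fun e => ?_) fun _ _ => rfl)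
        (Finset.sum_map _ (Function.Embedding.subtype (· ∈ G.edgeSet))
          (fun e => (edgeLabel G κ ε L e).1))
      simp only [Finset.mem_filter, Finset.mem_map, Finset.mem_univ, true_and,
        Function.Embedding.subtype_apply]
      constructor
      · rintro ⟨h1, h2⟩
        have he : e ∈ G.edgeSet := SimpleGraph.mem_edgeFinset.1 (Finset.mem_sdiff.1 h1).1
        exact ⟨⟨e, he⟩, ⟨h2, (hFU ⟨e, he⟩).1 h1⟩, rfl⟩
      · rintro ⟨e, ⟨h1, h2⟩, rfl⟩
        exact ⟨(hFU e).2 h2, h1⟩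
    · congr 1
      exact (Finset.sum_subtype (p := (· ∈ G.edgeSet)) G.edgeFinset (fun e => SimpleGraph.mem_edgeFinset)
        (fun e => (edgeLabel G κ ε L e).1)).symm

end Algorithm

/-! ### The running time -/

theorem phaseSteps_length_le {ℓ : ℕ} (hℓ : 1 ≤ ℓ) : (phaseSteps ℓ).length ≤ 132 * ℓ ^ 2 := by
  have h : iterPrime ℓ ≤ 64 * ℓ := (primeAbove_le (by omega)).trans (by omega)
  rw [phaseSteps_length]
  calc 3 + ℓ * (1 + 2 * iterPrime ℓ) ≤ 3 + ℓ * (1 + 2 * (64 * ℓ)) := by gcongr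
    _ ≤ 132 * ℓ ^ 2 := by nlinarith

theorem logBound_le {κ L lam : ℝ} (hκ : 1 ≤ κ) (hlam : 1 ≤ lam) (hL : 0 < L) (h : L ≤ κ * lam) :
    (logBound κ L : ℝ) ≤ (κ ^ 2 + 1) * lam := by
  have h1 := (Nat.ceil_lt_add_one (show 0 ≤ κ * L by positivity)).le
  have h2 : κ * L ≤ κ * (κ * lam) := by gcongr
  rw [logBound]
  nlinarith

theorem levelParam_le {κ L lam : ℝ} (c : ℕ) (hκ : 1 ≤ κ) (hlam : 1 ≤ lam) (hL : 0 < L)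
    (h : L ≤ κ * lam) :
    (levelParam c κ L : ℝ) ≤ (8 * c + 8 * (κ ^ 2 + 1) + 64) * lam := by
  have h1 := logBound_le hκ hlam hL h
  have h2 : (c : ℝ) ≤ c * lam := le_mul_of_one_le_right (by positivity) hlam
  rw [levelParam]
  push_cast
  nlinarith

/-- The constant in the running time. -/
noncomputable def timeConstant (c : ℕ) (κ : ℝ) : ℝ :=
  2000 * (κ ^ 2 + 1 + 4) * (132 * (8 * c + 8 * (κ ^ 2 + 1) + 64) ^ 2) + 4

theorem four_le_timeConstant (c : ℕ) (κ : ℝ) : 4 ≤ timeConstant c κ := by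
  rw [timeConstant]
  have : 0 ≤ 2000 * (κ ^ 2 + 1 + 4) * (132 * (8 * (c : ℝ) + 8 * (κ ^ 2 + 1) + 64) ^ 2) := by
    positivity
  linarith

theorem time_le {κ L lam μ : ℝ} {c N s : ℕ} (hκ : 1 ≤ κ) (hlam : 1 ≤ lam) (hL : 0 < L)
    (h : L ≤ κ * lam) (hμ : 1 ≤ μ) (hN : (N : ℝ) ≤ 2000 * (κ ^ 2 + 1 + 4) * μ) :
    ((s + 1 + N * (phaseSteps (levelParam c κ L)).length + 1 + 1 + 1 : ℕ) : ℝ) ≤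
      timeConstant c κ * (lam ^ 2 * μ + s) := by
  have hlen : ((phaseSteps (levelParam c κ L)).length : ℝ) ≤ 132 * (levelParam c κ L : ℝ) ^ 2 := by
    exact_mod_cast phaseSteps_length_le (by rw [levelParam]; omega)
  have hlen' : ((phaseSteps (levelParam c κ L)).length : ℝ) ≤
      132 * ((8 * c + 8 * (κ ^ 2 + 1) + 64) * lam) ^ 2 := by
    refine hlen.trans ?_
    have := levelParam_le c hκ hlam hL h
    gcongr
  have hmul : (N : ℝ) * (phaseSteps (levelParam c κ L)).length ≤
      2000 * (κ ^ 2 + 1 + 4) * μ * (132 * ((8 * c + 8 * (κ ^ 2 + 1) + 64) * lam) ^ 2) := by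
    gcongr
  have h1 : 1 ≤ lam ^ 2 * μ := one_le_mul_of_one_le_of_one_le (one_le_pow₀ hlam) hμ
  have h2 : (s : ℝ) ≤ timeConstant c κ * s :=
    le_mul_of_one_le_left (by positivity) (by linarith [four_le_timeConstant c κ])
  have h3 : timeConstant c κ * (lam ^ 2 * μ) =
      2000 * (κ ^ 2 + 1 + 4) * μ * (132 * ((8 * c + 8 * (κ ^ 2 + 1) + 64) * lam) ^ 2) +
        4 * (lam ^ 2 * μ) := by
    rw [timeConstant]
    ring
  push_cast
  linarith

/-! ### The approximation guarantee -/

section Guarantee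

variable {V : Type*} [Fintype V] {G : SimpleGraph V} [DecidableRel G.Adj]

theorem card_uncovered_le_mul_card {κ ε L : ℝ} (hε : 0 < ε) (hε1 : ε ≤ 1) (hΔ0 : 1 ≤ G.maxDegree)
    (hΔ : G.maxDegree ≤ 2 ^ logBound κ L) {U : Finset (Sym2 V)}
    (hsum : ∀ p, ∑ e ∈ U.filter (fun e => (edgeLabel G κ ε L e).2 = p), (edgeLabel G κ ε L e).1 ≤
      (127 / 128) ^ p * ∑ e ∈ G.edgeFinset, (edgeLabel G κ ε L e).1) :
    (U.card : ℝ) ≤ ε / (4 * G.maxDegree) * G.edgeFinset.card := by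
  have hx : ∀ e, edgeLabel G κ ε L e =
      (1, 128 * (logBound κ L + 2 + ⌈Real.logb 2 (1 / ε)⌉₊)) := by
    intro e
    induction e with
    | h u v => exact if_pos hε1
  have h := hsum (128 * (logBound κ L + 2 + ⌈Real.logb 2 (1 / ε)⌉₊))
  simp only [hx, Finset.filter_true, Finset.sum_const, nsmul_eq_mul, mul_one] at h
  refine h.trans (mul_le_mul_of_nonneg_right ((pow_mul_le_half_pow _).trans ?_) (by positivity))
  have h1 : 1 / ε ≤ 2 ^ ⌈Real.logb 2 (1 / ε)⌉₊ := le_two_pow_ceil_logb (by positivity)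
  have h2 : (G.maxDegree : ℝ) ≤ 2 ^ logBound κ L := by exact_mod_cast hΔ
  have h3 : (1 : ℝ) ≤ G.maxDegree := by exact_mod_cast hΔ0
  rw [one_div, inv_pow, ← inv_inv (ε / _), inv_div]
  refine inv_anti₀ (by positivity) ?_
  rw [pow_add, pow_add]
  calc 4 * (G.maxDegree : ℝ) / ε = G.maxDegree * 2 ^ 2 * (1 / ε) := by ring
    _ ≤ 2 ^ logBound κ L * 2 ^ 2 * 2 ^ ⌈Real.logb 2 (1 / ε)⌉₊ := by gcongr

variable [DecidableEq V]

theorem isAlmostMaximalMatching_of_card_le {F : Finset (Sym2 V)} (hF : IsEdgeMatching G F) {δ : ℝ}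
    (h : ((G.edgeFinset \ coveredEdges G F).card : ℝ) ≤ δ * G.edgeFinset.card) :
    IsAlmostMaximalMatching G δ F := by
  classical
  refine ⟨hF, ?_⟩
  have hsub : coveredEdges G F ⊆ G.edgeFinset := by
    intro e he
    simp only [coveredEdges, Finset.mem_filter] at he
    exact he.1
  have h1 := Finset.card_sdiff_add_card_eq_card hsub
  have h2 : ((G.edgeFinset \ coveredEdges G F).card : ℝ) + (coveredEdges G F).card =
    G.edgeFinset.card := by exact_mod_cast h1
  linarith

/-- The edges of scale `p` are exactly those with `384 p` phases, and `384 p = 128 · 3p` phases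
reduce the weight by `8⁻ᵖ`. -/
theorem card_uncovered_le_of_one_lt {κ ε L : ℝ} (hε1 : 1 < ε) {U : Finset (Sym2 V)}
    (hsum : ∀ p, ∑ e ∈ U.filter (fun e => (edgeLabel G κ ε L e).2 = p), (edgeLabel G κ ε L e).1 ≤
      (127 / 128) ^ p * ∑ e ∈ G.edgeFinset, (edgeLabel G κ ε L e).1)
    {D : Finset (Sym2 V)} (hD : IsEdgeDominatingSet G D) : (U.card : ℝ) ≤ ε / 2 * D.card := by
  obtain ⟨s, hs⟩ : ∃ s : Sym2 V → ℕ, ∀ u v,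
      s s(u, v) = max (scale ε (G.degree u)) (scale ε (G.degree v)) :=
    ⟨Sym2.lift ⟨fun u v => max (scale ε (G.degree u)) (scale ε (G.degree v)),
      fun _ _ => max_comm _ _⟩, fun _ _ => rfl⟩
  have hx : ∀ e, edgeLabel G κ ε L e = ((1 / 2) ^ s e, 384 * s e) := by
    intro e
    induction e with
    | h u v =>
      rw [hs]
      exact if_neg hε1.not_ge
  refine card_uncovered_le_of_scale s (by linarith) (fun e v hv => ?_) (fun p => ?_) hD
  · refine (le_two_pow_scale (by linarith) _).trans ?_
    refine mul_le_mul_of_nonneg_left (pow_le_pow_right₀ one_le_two ?_) (by linarith)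
    induction e with
    | h u w =>
      rw [hs]
      rcases Sym2.mem_iff.1 hv with rfl | rfl
      exacts [le_max_left _ _, le_max_right _ _]
  · have h := hsum (384 * p)
    simp only [hx, Nat.mul_right_inj (show 384 ≠ 0 by norm_num)] at h
    refine h.trans (mul_le_mul_of_nonneg_right ?_ (Finset.sum_nonneg fun e _ => by positivity))
    rw [show 384 * p = 128 * (3 * p) by ring]
    refine (pow_mul_le_half_pow _).trans (le_of_eq ?_)
    rw [pow_mul]
    norm_num

theorem isEdgeMatching_edgeFinset (h : G.maxDegree ≤ 1) : IsEdgeMatching G G.edgeFinset := by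
  refine ⟨subset_rfl, fun e he f hf hne => ?_⟩
  rintro ⟨v, hv, hv'⟩
  have h1 : (G.edgeFinset.filter fun e => v ∈ e).card ≤ 1 := by
    rw [card_filter_mem_edgeFinset]
    exact (G.degree_le_maxDegree v).trans h
  exact hne (Finset.card_le_one.1 h1 e (Finset.mem_filter.2 ⟨he, hv⟩) f
    (Finset.mem_filter.2 ⟨hf, hv'⟩))

theorem edgeFinset_sdiff_coveredEdges_edgeFinset :
    G.edgeFinset \ coveredEdges G G.edgeFinset = ∅ := by
  classical
  rw [Finset.sdiff_eq_empty_iff_subset]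
  intro e he
  simp only [coveredEdges, Finset.mem_filter]
  refine ⟨he, e, he, ?_⟩
  induction e with
  | h u v => exact ⟨u, Sym2.mem_mk_left u v, Sym2.mem_mk_left u v⟩

end Guarantee

/-! ### The main theorem. -/

theorem mainTheorem6 (c : ℕ) (κ : ℝ) (hκ : 1 ≤ κ) :
    ∃ (C : ℝ) (A : ℝ → LocalAlgorithm), ∀ ε : ℝ, 0 < ε →
      ∀ (V : Type*) [Fintype V] [DecidableEq V] (G : SimpleGraph V) [DecidableRel G.Adj]
        (ports : PortNumbering G) (ident : V → ℕ) (L : ℝ),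
        Function.Injective ident → (∀ v, ident v ≤ Fintype.card V ^ c) →
        Real.logb 2 G.maxDegree ≤ κ * L → L ≤ κ * Real.logb 2 G.maxDegree →
        ∃ (T : ℕ) (D : Finset (Sym2 V)),
          (T : ℝ) ≤ C * (Real.logb 2 G.maxDegree ^ 2 * max 1 (Real.logb 2 (G.maxDegree / ε))
            + logStar (Fintype.card V)) ∧
          (A ε).ComputesIn ports ident L T D ∧
          IsApproxMinimumEdgeDominatingSet G (2 + ε) D ∧
          ∃ M : Finset (Sym2 V), IsEdgeMatching G M ∧
            (ε ≤ 1 → IsAlmostMaximalMatching G (ε / (4 * G.maxDegree)) M) ∧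
            D = M ∪ (G.edgeFinset \ coveredEdges G M) := by
  refine ⟨timeConstant c κ, edgeDominatingSetAlgorithm c κ, ?_⟩
  intro ε hε V _ _ G _ ports ident L hinj hid hΔL hLΔ
  rcases le_or_gt L 0 with hL | hL
  · have hΔ : G.maxDegree ≤ 1 := by
      by_contra hcon
      have h1 : (1 : ℝ) < G.maxDegree := by exact_mod_cast not_le.1 hcon
      have h2 := Real.logb_pos one_lt_two h1
      nlinarith
    have hM := isEdgeMatching_edgeFinset hΔ
    have hU := edgeFinset_sdiff_coveredEdges_edgeFinset (G := G)
    refine ⟨0, G.edgeFinset ∪ (G.edgeFinset \ coveredEdges G G.edgeFinset), ?_, ?_, ?_,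
      G.edgeFinset, hM, fun _ => ?_, rfl⟩
    · have := four_le_timeConstant c κ
      rw [Nat.cast_zero]
      positivity
    · exact Protocol.toLocal_computesIn_of_nonpos _ _ ports ident hL _ fun e =>
        Finset.mem_union_left _ (SimpleGraph.mem_edgeFinset.2 e.2)
    · refine isApproxMinimumEdgeDominatingSet_union hM fun D _ => ?_
      rw [hU, Finset.card_empty, Nat.cast_zero]
      positivity
    · refine isAlmostMaximalMatching_of_card_le hM ?_
      rw [hU, Finset.card_empty, Nat.cast_zero]
      positivity
  -- A positive estimate implies `Δ ≥ 2`, so `log Δ ≥ 1` absorbs all additive constants in the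
  -- running time.
  · have hlog : 0 < Real.logb 2 G.maxDegree := by
      by_contra hcon
      nlinarith
    have hΔ2 : 2 ≤ G.maxDegree := by
      by_contra hcon
      have : G.maxDegree = 0 ∨ G.maxDegree = 1 := by omega
      rcases this with h | h <;> simp [h] at hlog
    have hlam : 1 ≤ Real.logb 2 G.maxDegree := by
      rw [Real.le_logb_iff_rpow_le one_lt_two (by positivity), Real.rpow_one]
      exact_mod_cast hΔ2
    have hΔ : G.maxDegree ≤ 2 ^ logBound κ L := by
      have h1 : (G.maxDegree : ℝ) ≤ 2 ^ logBound κ L := by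
        rw [← Real.rpow_natCast, ← Real.logb_le_iff_le_rpow one_lt_two (by positivity)]
        exact hΔL.trans (Nat.le_ceil _)
      exact_mod_cast h1
    obtain ⟨N, hN, hNle⟩ : ∃ N : ℕ,
        (∀ u v, (edgeData κ ε L (G.degree u) (G.degree v)).2 ≤ N) ∧
        (N : ℝ) ≤ 2000 * (κ ^ 2 + 1 + 4) * max 1 (Real.logb 2 (G.maxDegree / ε)) := by
      refine ⟨⌊2000 * (κ ^ 2 + 1 + 4) * max 1 (Real.logb 2 (G.maxDegree / ε))⌋₊, fun u v => ?_,
        Nat.floor_le (by positivity)⟩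
      exact Nat.le_floor (edgeData_snd_le hε (G.degree_le_maxDegree u) (G.degree_le_maxDegree v)
        (by omega) (by nlinarith) (logBound_le hκ hlam hL hLΔ))
    obtain ⟨F, hF, hcomp, hsum⟩ := edgeDominatingSetAlgorithm_spec ports hinj hid hL hΔ hN
    refine ⟨_, _, time_le hκ hlam hL hLΔ (le_max_left _ _) hNle, hcomp,
      isApproxMinimumEdgeDominatingSet_union hF fun D hD => ?_, F, hF,
      fun hε1 => isAlmostMaximalMatching_of_card_le hF
        (card_uncovered_le_mul_card hε hε1 (by omega) hΔ hsum), rfl⟩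
    have hhalf : ε / 2 * (D.card : ℝ) ≤ ε * D.card := by
      have : 0 ≤ ε * (D.card : ℝ) := by positivity
      linarith
    refine le_trans ?_ hhalf
    rcases le_or_gt ε 1 with hε1 | hε1
    · refine (card_uncovered_le_mul_card hε hε1 (by omega) hΔ hsum).trans ?_
      -- An edge dominating set has at least `|E|/(2Δ)` edges, which turns the bound relative to
      -- `|E|` into one relative to `|D|`.
      have h1 := hD.card_edgeFinset_le
      have h2 : (0 : ℝ) < G.maxDegree := by
        have : 0 < G.maxDegree := by omega
        exact_mod_cast this
      calc ε / (4 * G.maxDegree) * (G.edgeFinset.card : ℝ)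
          ≤ ε / (4 * G.maxDegree) * (2 * G.maxDegree * D.card) := by gcongr
        _ = ε / 2 * D.card := by field_simp; ring
    · exact card_uncovered_le_of_one_lt hε1 hsum hD
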